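/- **Setting.** Let $f:I=[0,1]\to I$ be a piecewise $C^1$ Markov map with partition points $0=a_0<\dots<a_J=1$: on each open interval $I_j=(a_j,a_{j+1})$, $0\le j<J$, $f$ is $C^1$ with $|f'|\ge\chi$ for one constant $\chi>1$, and each $f(I_i)$ either contains $I_j$ or is disjoint from it (the values of $f$ at the $a_j$ are arbitrary). Let $A$ be its adjacency matrix on the alphabet $\mathcal A=\{0,\dots,J-1\}$ ($A_{ij}=1$ iff $f(I_i)\supseteq I_j$), assumed transitive (irreducible), and let $(\Sigma_A,\sigma)$ be the two-sided subshift of finite type. Let $\pi(\omega)=\bigcap_k\overline{\{x: f^i(x)\in I_{\omega_i},\ 0\le i<k\}}$ be the coding map for admissible one-sided sequences; $\pi_*\mu$ is the push-forward to $I$ of a measure $\mu$ on $\Sigma_A$ through the coordinates of index $\ge 0$. Let $c$ be a left endpoint of some $I_j$ and let $\ell$ be the length of the maximal interval of $C^1$ monotonicity of $f$ with left endpoint $c$. Let $c$ be right periodic with period $N$: $N\ge1$ is least such that $\lim_{x\to c^+}f^N(x)=c$ and $f^N((c,c+\delta))\subset(c,c+\ell)$ for some $\delta>0$. Let $w=w_0\dots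 w_{N-1}$ be the word with $f^i(x)\in I_{w_i}$ for all $x>c$ close enough to $c$ (so $\pi(www\dots)=c$). Let $b(x)=|\log(x-c)|$ on $(c,c+\ell)$ and $b=0$ elsewhere. A probability measure $\mu$ on $I$ is *adapted* if $\mu(\{c\})=0$ and $\int b\,d\mu<\infty$, and *nonadapted* otherwise; $\mathcal N_c$ is the set of nonadapted $f$-invariant ergodic Borel probability measures. $\overline d(\nu_1,\nu_2)$ is the infimum of $m\{(x,y):x_1\ne y_1\}$ over all $(\sigma\times\sigma)$-invariant couplings $m$ of $\nu_1,\nu_2$. **Construction A.** Let $n$ be the period of $A$ (the greatest common divisor of the lengths of its closed paths), $L=N/n$, and let $\Sigma_1$ be the set of $x\in\Sigma_A$ such that $x_0$ can be reached from $w_0$ by a path whose length is a multiple of $n$. Reading $\Sigma_1$ in consecutive blocks of length $n$ gives a mixing subshift of finite type $\Sigma_{A_1}$ over $\mathcal A^n$, with shift $\tilde\sigma$ corresponding to $\sigma^n$; let $\tilde\pi:\Sigma_{A_1}\to\Sigma_1$ be concatenation and let $\tilde w$ be $w$ read in blocks, a word of length $L$. Fix $t\ge0$ and, for each symbol $s$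 of $\Sigma_{A_1}$, words $v(s),v'(s)$ of length $t$ such that $s\,v(s)\,\tilde w$ and $\tilde w\,v'(s)\,s$ are $A_1$-admissible. Let $p=(p_k)_{k\ge1}$ be a probability vector with $p_k=0$ unless $k=1$ or $k=2t+jL+1$ for some $j\ge1$, and with $\mathbb E(p):=\sum_k kp_k<\infty$. Let $\lambda_p$ be the Bernoulli measure on $\mathbb N^{\mathbb Z}$, let $$\eta(\dots n_{-1}\star n_0n_1\dots)=(\dots10^{n_{-1}-1}\star10^{n_0-1}10^{n_1-1}\dots)$$ ($\star$ precedes position $0$), and for Borel $U\subset\{0,1\}^{\mathbb Z}$ put $$\mu_p(U)=\frac1{\mathbb E(p)}\sum_{m\ge0}\sum_{k\ge m+1}\eta_*\lambda_p\big(\sigma^{-m}(U)\cap[10^{k-1}1]\big).$$ Let $G$ be the set of $y\in\{0,1\}^{\mathbb Z}$ all of whose maximal strings of zeros are of the form $(a,b)\cap\mathbb Z$ with $b-a=2t+kL+1$, $k\ge1$. For $y\in G$ let $T_y(\tilde x)$ be $\tilde x$ with, for each such string, the symbols in positions $a,\dots,b$ replaced by $\tilde x_a\,v(\tilde x_a)\,\tilde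 w^k\,v'(\tilde x_b)\,\tilde x_b$; for $y\notin G$ let $T_y$ be the identity. For a $\sigma$-invariant ergodic probability measure $\nu$ on $\Sigma_A$, let $\tilde\nu$ be $n\,\nu|_{\Sigma_1}$ read in blocks, let $\tilde\nu_p$ be the image of $\tilde\nu\times\mu_p$ under $(\tilde x,y)\mapsto T_y(\tilde x)$, and put $$\mu_{\nu,p}=\frac1n\sum_{i=0}^{n-1}\sigma^i_*\tilde\pi_*\tilde\nu_p .$$ **Proposition 3.2.** Connecting words $v,v'$ as above exist for some $t$. For every such choice of $t,v,v'$, every $\sigma$-invariant ergodic probability measure $\nu$ on $\Sigma_A$ and every $p$ as above, $\mu_{\nu,p}$ is a $\sigma$-invariant probability measure on $\Sigma_A$; it is ergodic whenever $\gcd\{k:p_k\neq0\}=1$ (in particular whenever $p_1>0$). Moreover: 1. if $p=(1,0,0,\dots)$, then $\mu_{\nu,p}=\nu$; 2. $\overline d(\nu,\mu_{\nu,p})\le\dfrac{\mathbb E(p)-1}{\mathbb E(p)}$; 3. if $p_k\asymp k^{-3}$ along the indices $k=2t+jL+1$, $j\ge1$ (that is, for some $r\ge1$ and $K$, $r^{-1}k^{-3}\le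 p_k\le rk^{-3}$ for all such $k\ge K$), then $\pi_*\mu_{\nu,p}$ is nonadapted. If in addition $\gcd\{k:p_k\ne0\}=1$, and either every iterate $f^i$ is right-continuous at $c$ or $\pi_*\mu_{\nu,p}(\{c\})=0$, then $\pi_*\mu_{\nu,p}\in\mathcal N_c$. -/

import Mathlib

open MeasureTheory Filter Topology
open scoped unitInterval ENNReal

noncomputable section

namespace NonadaptedA

/-! ### Shift spaces, invariant measures, joinings and the d-bar distance -/

/-- The left shift on two-sided sequences. -/
def shift {α : Type*} (x : ℤ → α) : ℤ → α := fun i => x (i + 1)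

/-- The two-sided subshift of finite type given by an adjacency relation. -/
def SFT {α : Type*} (A : α → α → Prop) : Set (ℤ → α) := {x | ∀ i, A (x i) (x (i + 1))}

/-- Shift-invariant Borel probability measures carried by the subshift of finite type of `A`. -/
def InvMeasure {α : Type*} [MeasurableSpace α] (A : α → α → Prop) (μ : Measure (ℤ → α)) : Prop :=
  IsProbabilityMeasure μ ∧ MeasurePreserving shift μ μ ∧ μ (SFT A)ᶜ = 0

/-- Ergodic shift-invariant Borel probability measures carried by the subshift of finite type
of `A`. -/
def ErgMeasure {α : Type*} [MeasurableSpace α] (A : α → α → Prop) (μ : Measure (ℤ → α)) : Prop :=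
  InvMeasure A μ ∧ Ergodic shift μ

/-- Joinings of two measures on the full shift. -/
def IsJoining {α : Type*} [MeasurableSpace α] (ν₁ ν₂ : Measure (ℤ → α))
    (m : Measure ((ℤ → α) × (ℤ → α))) : Prop :=
  IsProbabilityMeasure m ∧ MeasurePreserving (Prod.map shift shift) m m ∧
    m.map Prod.fst = ν₁ ∧ m.map Prod.snd = ν₂

/-- The d-bar distance; with values in `[0, ∞]`, so that it would be `∞` if there were no
joinings. -/
def dbar {α : Type*} [MeasurableSpace α] (ν₁ ν₂ : Measure (ℤ → α)) : ℝ≥0∞ :=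
  ⨅ (m : Measure ((ℤ → α) × (ℤ → α))) (_ : IsJoining ν₁ ν₂ m), m {q | q.1 1 ≠ q.2 1}

/-! ### Cyclic structure of a transitive subshift of finite type -/

/-- There is an `A`-admissible path with `k` edges from `i` to `j`. -/
def HasPath {α : Type*} (A : α → α → Prop) (k : ℕ) (i j : α) : Prop :=
  ∃ u : ℕ → α, u 0 = i ∧ u k = j ∧ ∀ m < k, A (u m) (u (m + 1))

/-- Transitivity of the subshift of finite type: any symbol can be reached from any symbol. -/
def IsTransitive {α : Type*} (A : α → α → Prop) : Prop := ∀ i j, ∃ k, 0 < k ∧ HasPath A k i j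

/-- `n` is the period of `A`, the greatest common divisor of the lengths of its closed paths. For a
transitive `A` this is the number of cyclically permuted classes. -/
def IsPeriod {α : Type*} (A : α → α → Prop) (n : ℕ) : Prop :=
  IsGreatest {d : ℕ | ∀ i k, HasPath A k i i → d ∣ k} n

/-- The cyclic class of symbols which contains `s₀`, where `n` is the period. -/
def cyclicClass {α : Type*} (A : α → α → Prop) (n : ℕ) (s₀ : α) : Set α :=
  {s | ∃ m, HasPath A (m * n) s₀ s}

/-- The piece, invariant under the `n`-th power of the shift, of the subshift of finite type formed
by the sequences whose symbol in position `0` belongs to the cyclic class of `s₀`. -/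
def cyclicPiece {α : Type*} (A : α → α → Prop) (n : ℕ) (s₀ : α) : Set (ℤ → α) :=
  {x | x ∈ SFT A ∧ x 0 ∈ cyclicClass A n s₀}

/-- The symbols of the `n`-block presentation of `cyclicPiece A n s₀`: the `A`-admissible words of
length `n` which start in the cyclic class of `s₀`. -/
def IsBlockSymbol {α : Type*} (A : α → α → Prop) (n : ℕ) (s₀ : α) (u : Fin n → α) : Prop :=
  (∀ i j : Fin n, (j : ℕ) = i + 1 → A (u i) (u j)) ∧
    ∀ i : Fin n, (i : ℕ) = 0 → u i ∈ cyclicClass A n s₀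

/-- The adjacency relation of the `n`-block presentation of `cyclicPiece A n s₀`: the last letter of
the first block is followed by the first letter of the second one. -/
def blockAdj {α : Type*} (A : α → α → Prop) (n : ℕ) (s₀ : α) (u u' : Fin n → α) : Prop :=
  IsBlockSymbol A n s₀ u ∧ IsBlockSymbol A n s₀ u' ∧
    ∀ i j : Fin n, (i : ℕ) + 1 = n → (j : ℕ) = 0 → A (u i) (u' j)

/-- Cutting a sequence into consecutive blocks of length `n`. -/
def block {α : Type*} (n : ℕ) (x : ℤ → α) : ℤ → Fin n → α := fun i j => x (i * n + j)

/-- Concatenating a sequence of blocks of length `n`, the inverse of `block n`. -/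
def unblock {α : Type*} (n : ℕ) [NeZero n] (x : ℤ → Fin n → α) : ℤ → α :=
  fun i => x (i / n) (Fin.ofNat n (i % n).toNat)

/-- The correspondence from block measures to measures on the original shift space: the average of
the first `n` shifts of the unblocked measure. -/
def fromBlocks {α : Type*} [MeasurableSpace α] (n : ℕ) [NeZero n]
    (κ : Measure (ℤ → Fin n → α)) : Measure (ℤ → α) :=
  (n : ℝ≥0∞)⁻¹ • ∑ i ∈ Finset.range n, (κ.map (unblock n)).map (shift^[i])

/-- The inverse correspondence: `n` times the restriction to the distinguished cyclic piece, read
in blocks. -/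
def toBlocks {α : Type*} [MeasurableSpace α] (A : α → α → Prop) (n : ℕ) (s₀ : α)
    (ν : Measure (ℤ → α)) : Measure (ℤ → Fin n → α) :=
  ((n : ℝ≥0∞) • ν.restrict (cyclicPiece A n s₀)).map (block n)

/-! ### The renewal measure on `{0,1}^ℤ`; the symbols `1` and `0` are `true` and `false` -/

/-- The mean of a probability vector. -/
def mean (p : PMF ℕ) : ℝ := ∑' k : ℕ, (k : ℝ) * (p k).toReal

/-- The Bernoulli measure on `ℕ^ℤ`. -/
def bernoulli (p : PMF ℕ) : Measure (ℤ → ℕ) := Measure.infinitePi fun _ : ℤ => p.toMeasure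

/-- The position of the `j`-th `1` in `… 1 0^{n₋₁-1} ⋆ 1 0^{n₀-1} 1 0^{n₁-1} …`, where the `1` right
after `⋆` is number `0` and is in position `0`. -/
def onePos (x : ℤ → ℕ) (j : ℤ) : ℤ :=
  ∑ i ∈ Finset.Ico 0 j, (x i : ℤ) - ∑ i ∈ Finset.Ico j 0, (x i : ℤ)

open Classical in
/-- The map `(… n₋₁ ⋆ n₀ n₁ …) ↦ (… 1 0^{n₋₁-1} ⋆ 1 0^{n₀-1} 1 0^{n₁-1} …)`. -/
def eta (x : ℤ → ℕ) : ℤ → Bool := fun i => decide (∃ j, onePos x j = i)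

/-- The cylinder `[1 0^{k-1} 1]`, for `k ≥ 1`. -/
def gapCylinder (k : ℕ) : Set (ℤ → Bool) :=
  {y | y 0 = true ∧ (∀ i : ℤ, 0 < i → i < k → y i = false) ∧ y k = true}

/-- The invariant measure on `{0,1}^ℤ` induced by the Bernoulli measure: the value on `U` is
`r ∑_{n ≥ 0} ∑_{k ≥ n+1} (eta_* bernoulli) (shift^{-n} U ∩ [1 0^{k-1} 1])`, where `r` is the
inverse of the mean; here `k = n + 1 + j`. -/
def renewalMeasure (p : PMF ℕ) : Measure (ℤ → Bool) :=
  ENNReal.ofReal (mean p)⁻¹ • Measure.sum fun n : ℕ => Measure.sum fun j : ℕ =>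
    (((bernoulli p).map eta).restrict (gapCylinder (n + 1 + j))).map (shift^[n])

/-! ### Overwriting -/

/-- The vectors to which the construction applies: only `p₁` and `p_{2t+kL+1}` with `k ≥ 1` may be
nonzero. -/
def IsAdmissibleVector (t L : ℕ) (p : PMF ℕ) : Prop :=
  ∀ m, p m ≠ 0 → m = 1 ∨ ∃ k, 1 ≤ k ∧ m = 2 * t + k * L + 1

/-- The good sequences: each maximal string of zeros is an interval `(a, b) ∩ ℤ` with
`b - a = 2t+kL+1` for some `k ≥ 1`. -/
def goodSet (t L : ℕ) : Set (ℤ → Bool) :=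
  {y | ∀ i, y i = false → ∃ a b : ℤ, a < i ∧ i < b ∧ y a = true ∧ y b = true ∧
    (∀ j, a < j → j < b → y j = false) ∧ ∃ k : ℕ, 1 ≤ k ∧ b - a = 2 * t + k * L + 1}

/-- Connecting words of length `t`: for each symbol `s`, the word `v s` leads from `s` to the word
`W` of length `L`, and the word `v' s` leads from `W` to `s`. -/
def IsConnector {β : Type*} (B : β → β → Prop) (symb : Set β) (L : ℕ) (W : ℕ → β) (t : ℕ)
    (v v' : β → Fin t → β) : Prop :=
  ∀ s ∈ symb,
    List.IsChain B ([s] ++ List.ofFn (v s) ++ List.ofFn fun i : Fin L => W i) ∧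
    List.IsChain B ((List.ofFn fun i : Fin L => W i) ++ List.ofFn (v' s) ++ [s])

open Classical in
/-- The overwriting map. If `y` is good and `(a, b) ∩ ℤ` is a maximal string of zeros of `y` with
`b - a = 2t+kL+1`, then the symbols of `x` in positions `a, …, b` are replaced by the word
`x_a (v x_a) W^k (v' x_b) x_b`; all other symbols are kept. If `y` is not good, `x` is kept. -/
def overwrite {β : Type*} (L : ℕ) (W : ℕ → β) (t : ℕ) (v v' : β → Fin t → β)
    (y : ℤ → Bool) (x : ℤ → β) : ℤ → β := fun i =>
  if y ∈ goodSet t L ∧ y i = false then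
    let a : ℤ := sSup {j | j < i ∧ y j = true}
    let b : ℤ := sInf {j | i < j ∧ y j = true}
    if h : (i - a - 1).toNat < t then v (x a) ⟨(i - a - 1).toNat, h⟩
    else if h' : (b - 1 - i).toNat < t then v' (x b) (Fin.rev ⟨(b - 1 - i).toNat, h'⟩)
    else W (((i - a - 1).toNat - t) % L)
  else x i

/-- The word `w` of length `N = L n` read in blocks of length `n`; `w` is given as the periodic
sequence `www…`, and the first `L` blocks matter. -/
def blockWord {α : Type*} (n : ℕ) (w : ℕ → α) : ℕ → Fin n → α := fun j i => w (j * n + i)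

/-- The joining `φ_*(ν̃ × μ_p)` with `φ(x, y) = (x, overwrite y x)`. -/
def jointMeasure {α : Type*} [MeasurableSpace α] (A : α → α → Prop) (n : ℕ) (w : ℕ → α) (L t : ℕ)
    (v v' : (Fin n → α) → Fin t → Fin n → α) (ν : Measure (ℤ → α)) (p : PMF ℕ) :
    Measure ((ℤ → Fin n → α) × (ℤ → Fin n → α)) :=
  ((toBlocks A n (w 0) ν).prod (renewalMeasure p)).map
    fun q => (q.1, overwrite L (blockWord n w) t v v' q.2 q.1)

/-- The measure `μ_{ν,p}`: the second marginal of the joining, brought back to the original shift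
space. -/
def constructionA {α : Type*} [MeasurableSpace α] (A : α → α → Prop) (n : ℕ) [NeZero n]
    (w : ℕ → α) (L t : ℕ) (v v' : (Fin n → α) → Fin t → Fin n → α) (ν : Measure (ℤ → α))
    (p : PMF ℕ) : Measure (ℤ → α) :=
  fromBlocks n ((jointMeasure A n w L t v v' ν p).map Prod.snd)

/-! ### Markov interval maps, coding, adapted measures -/

/-- A self-map of `[0,1]` regarded as a function on `ℝ` (constant outside `[0,1]`); only its values
in `[0,1]` are used. -/
def realLift (f : I → I) : ℝ → ℝ := fun x => (f (Set.projIcc 0 1 zero_le_one x) : ℝ)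

/-- A piecewise `C¹`, uniformly expanding Markov map of `[0,1]` with `J` partition intervals. Its
values at the partition points are arbitrary. -/
structure MarkovMap (J : ℕ) where
  /-- the map -/
  f : I → I
  /-- the partition points -/
  pt : Fin (J + 1) → I
  pt_strictMono : StrictMono pt
  pt_zero : pt 0 = 0
  pt_last : pt (Fin.last J) = 1
  contDiffOn : ∀ j : Fin J,
    ContDiffOn ℝ 1 (realLift f) (Set.Ioo (pt j.castSucc : ℝ) (pt j.succ : ℝ))
  expanding : ∃ χ : ℝ, 1 < χ ∧ ∀ j : Fin J,
    ∀ x ∈ Set.Ioo (pt j.castSucc : ℝ) (pt j.succ : ℝ), χ ≤ |deriv (realLift f) x|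
  markov : ∀ i j : Fin J,
    Set.Ioo (pt j.castSucc) (pt j.succ) ⊆ f '' Set.Ioo (pt i.castSucc) (pt i.succ) ∨
    Disjoint (Set.Ioo (pt j.castSucc) (pt j.succ)) (f '' Set.Ioo (pt i.castSucc) (pt i.succ))

namespace MarkovMap

variable {J : ℕ} (M : MarkovMap J)

/-- The open partition intervals. -/
def piece (j : Fin J) : Set I := Set.Ioo (M.pt j.castSucc) (M.pt j.succ)

/-- The adjacency relation of the coding: the image of the `i`-th interval covers the `j`-th. -/
def adj (i j : Fin J) : Prop := M.piece j ⊆ M.f '' M.piece i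

/-- The points whose itinerary starts with `ω₀ … ω_{k-1}`. -/
def cylinder (ω : ℕ → Fin J) (k : ℕ) : Set I := {x | ∀ i < k, M.f^[i] x ∈ M.piece (ω i)}

/-- The coding map from one-sided sequences to `[0,1]`: for an admissible `ω`, the unique point in
the closures of all cylinders of `ω`. -/
def coding (ω : ℕ → Fin J) : I := Classical.epsilon fun x => ∀ k, x ∈ closure (M.cylinder ω k)

/-- The push-forward to `[0,1]` of a measure on the two-sided shift space under the coding map. -/
def push (μ : Measure (ℤ → Fin J)) : Measure I := μ.map fun x => M.coding fun i : ℕ => x i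

/-- The length `ℓ` of the maximal interval of `C¹` monotonicity with left endpoint `c`. -/
def monoLength (c : I) : ℝ :=
  sSup {s : ℝ | 0 < s ∧ (c : ℝ) + s ≤ 1 ∧
    ContDiffOn ℝ 1 (realLift M.f) (Set.Ioo (c : ℝ) (c + s)) ∧
    (StrictMonoOn (realLift M.f) (Set.Ioo (c : ℝ) (c + s)) ∨
      StrictAntiOn (realLift M.f) (Set.Ioo (c : ℝ) (c + s)))}

/-- `c` is the left endpoint of a partition interval and is right periodic with (least) period
`N`. -/
def IsRightPeriodic (c : I) (N : ℕ) : Prop :=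
  (∃ j : Fin J, c = M.pt j.castSucc) ∧
  IsLeast {m : ℕ | 0 < m ∧ Tendsto (M.f^[m]) (𝓝[>] c) (𝓝 c) ∧
    ∃ δ : ℝ, 0 < δ ∧ ∀ x : I, (c : ℝ) < x → (x : ℝ) < c + δ →
      (c : ℝ) < M.f^[m] x ∧ (M.f^[m] x : ℝ) < c + M.monoLength c} N

/-- `w` is the right itinerary of `c`: for each `i`, the `i`-th iterate of the map sends the points
slightly to the right of `c` into the interval number `w i`. If `c` is right periodic, this is the
sequence `www…` formed by the word which codes the (right) orbit of `c`. -/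
def IsRightItinerary (c : I) (w : ℕ → Fin J) : Prop :=
  ∀ i, ∀ᶠ x in 𝓝[>] c, M.f^[i] x ∈ M.piece (w i)

open Classical in
/-- The function `b(x) = |log (x - c)|` on `(c, c + ℓ)`, and `0` elsewhere. -/
def b (c x : I) : ℝ :=
  if (c : ℝ) < x ∧ (x : ℝ) < c + M.monoLength c then |Real.log (x - c)| else 0

/-- Adaptedness with respect to `c`. -/
def IsAdapted (c : I) (μ : Measure I) : Prop :=
  μ {c} = 0 ∧ ∫⁻ x, ENNReal.ofReal (M.b c x) ∂μ < ⊤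

/-- The set `𝒩_c` of nonadapted ergodic invariant Borel probability measures. -/
def nonadaptedErg (c : I) : Set (Measure I) :=
  {μ | IsProbabilityMeasure μ ∧ Ergodic M.f μ ∧ ¬ M.IsAdapted c μ}

end MarkovMap

end NonadaptedA

end

open NonadaptedA

set_option linter.unusedSectionVars false

noncomputable section

namespace NonadaptedA

/-! ### Paths, residues and connecting words -/

section Paths

variable {α : Type*} {A : α → α → Prop}

/-! Everything is done in the block presentation of one cyclic class, where the adjacency relation
is mixing, and transferred back by averaging over `n` shifts. Transitivity gives a residue modulo
`n` that grows by one along every edge, and all long paths compatible with residues exist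
(`exists_residue`). This yields connecting words of one common length (`exists_connector`). It also
shows that reading an ergodic measure in blocks preserves ergodicity and is undone by the average
(`ergodic_toBlocks`, `fromBlocks_toBlocks`).

The renewal measure is the tower over the Bernoulli shift whose height is the first gap
(`lintegral_renewalMeasure`). Overwriting commutes with the shift and keeps sequences admissible
(`overwrite_shift`, `overwrite_mem_SFT`), so the new block measure is a factor of a product with the
renewal measure. Ergodicity of that product reduces to the skew product (n, z) ↦ (σn, σ^{n₀} z). An
invariant set there can be approximated, for fixed z, both by an event of the past and by an event
of the future of the Bernoulli sequence. These are independent, so almost every fibre is trivial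
(`skew_fibre_trivial`) and the set depends on z only. As a set of z it is invariant under σ^k for
every k of positive probability, hence under σ when the gcd is 1 (`skew_trivial`).

The d-bar bound comes from the pair of original and overwritten sequence: they can differ only where
the renewal sequence has a zero, which has probability at most (E-1)/E (`Setup.dbar_le`).

For nonadaptedness, following `w` for R periods puts the coded point within χ^{-RN} of `c`, so
|log(x-c)| is at least RN log χ. A gap with j repetitions contains starting points with j, j-1, …, 1
repetitions left and contributes about j²/2 to the integral of R. With p_k of order k^{-3} this sums
like the harmonic series (`HasCubicTail.tsum_eq_top`, `Setup.tsum_prefixSet`, `not_isAdapted`).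

The coding map semiconjugates the shift to the map away from the partition points. If partition
points carry mass, finitely many futures code them, so some future is an atom. Ergodicity and the
positive mass of every prefix of `www…` then force the measure onto the orbit of that periodic
sequence (`ae_orbit_of_atom`). Right continuity rescues the semiconjugacy there, and absence of an
atom at `c` excludes the case (`ae_semiconj`). -/

lemma HasPath.refl (i : α) : HasPath A 0 i i := ⟨fun _ => i, rfl, rfl, by simp⟩

lemma HasPath.trans {k l : ℕ} {i j h : α} (h₁ : HasPath A k i j) (h₂ : HasPath A l j h) :
    HasPath A (k + l) i h := by
  obtain ⟨u, u0, uk, hu⟩ := h₁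
  obtain ⟨v, v0, vl, hv⟩ := h₂
  refine ⟨fun m => if m ≤ k then u m else v (m - k), by simp [u0], ?_, fun m hm => ?_⟩
  · by_cases hl : l = 0
    · subst hl; simp [uk, ← vl, v0]
    · have : ¬ k + l ≤ k := by omega
      simp [hl, vl]
  · rcases lt_trichotomy m k with h | h | h
    · simp only [h.le, if_true, Nat.succ_le_of_lt h]
      exact hu m h
    · subst h
      have := hv 0 (by omega)
      simp [uk, ← v0, this]
    · have e : m + 1 - k = (m - k) + 1 := by omega
      simp only [not_le.2 h, if_false, show ¬ m + 1 ≤ k by omega, e]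
      exact hv (m - k) (by omega)

lemma HasPath.single {i j : α} (h : A i j) : HasPath A 1 i j :=
  ⟨fun m => if m = 0 then i else j, by simp, by simp, fun m hm => by
    obtain rfl : m = 0 := by omega
    simpa using h⟩

/-- A chain of symbols gives paths between its members. -/
lemma HasPath.of_seq {u : ℕ → α} (hu : ∀ i, A (u i) (u (i + 1))) (k : ℕ) :
    HasPath A k (u 0) (u k) := ⟨u, rfl, rfl, fun m _ => hu m⟩

/-- The cyclic structure of a transitive adjacency relation with period `n`: there is a residue
function compatible with the relation, and all sufficiently long paths compatible with the residues
exist. -/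
lemma exists_residue [Finite α] (hA : IsTransitive A) {n : ℕ} [NeZero n] (hn : IsPeriod A n)
    (s₀ : α) :
    ∃ r : α → ZMod n, (∀ s s', A s s' → r s' = r s + 1) ∧ r s₀ = 0 ∧
      cyclicClass A n s₀ = {s | r s = 0} ∧
      ∃ K : ℕ, ∀ k, K ≤ k → ∀ i j, (k : ZMod n) = r j - r i → HasPath A k i j := by
  have hcl : ∀ i k, HasPath A k i i → (k : ZMod n) = 0 := fun i k h =>
    (ZMod.natCast_eq_zero_iff _ _).2 (hn.1 i k h)
  choose a ha0 ha using hA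
  -- Two paths from `s₀` to `s` close up with the same return path, so their lengths agree modulo
  -- `n`. The length of any chosen path therefore serves as residue.
  have key : ∀ s k, HasPath A k s₀ s → (k : ZMod n) = a s₀ s := by
    intro s k h
    have h1 := hcl _ _ (h.trans (ha s s₀))
    have h2 := hcl _ _ ((ha s₀ s).trans (ha s s₀))
    push_cast at h1 h2
    rw [← h2] at h1
    exact add_right_cancel h1
  refine ⟨fun s => a s₀ s, fun s s' h => ?_, ?_, ?_, ?_⟩
  · have := key s' _ ((ha s₀ s).trans (HasPath.single h))
    push_cast at this
    exact this.symm
  · exact hcl _ _ (ha s₀ s₀)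
  · ext s
    simp only [cyclicClass, Set.mem_ofPred_eq]
    constructor
    · rintro ⟨m, hm⟩
      rw [← key s _ hm]; simp
    · intro h
      obtain ⟨m, hm⟩ := (ZMod.natCast_eq_zero_iff _ _).1 h
      exact ⟨m, by rw [mul_comm, ← hm]; exact ha s₀ s⟩
  -- The return lengths at `s₀` alone already have gcd `n`. Inserting a closed path at `i` into a
  -- loop through `i` shows that their gcd divides every closed length. Hence all large multiples of
  -- `n` are return lengths at `s₀`.
  · let S : AddSubmonoid ℕ :=
      { carrier := {k | HasPath A k s₀ s₀}
        zero_mem' := HasPath.refl _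
        add_mem' := fun h h' => h.trans h' }
    have hS : (S : Set ℕ) = {k | HasPath A k s₀ s₀} := rfl
    have hg : Nat.setGcd (S : Set ℕ) ∣ n := by
      have hd : ∀ i k, HasPath A k i i → Nat.setGcd (S : Set ℕ) ∣ k := by
        intro i k h
        have h1 : Nat.setGcd (S : Set ℕ) ∣ a s₀ i + a i s₀ :=
          Nat.setGcd_dvd_of_mem ((ha s₀ i).trans (ha i s₀))
        have h2 : Nat.setGcd (S : Set ℕ) ∣ a s₀ i + k + a i s₀ :=
          Nat.setGcd_dvd_of_mem (((ha s₀ i).trans h).trans (ha i s₀))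
        have : a s₀ i + k + a i s₀ = (a s₀ i + a i s₀) + k := by ring
        rw [this] at h2
        exact (Nat.dvd_add_right h1).1 h2
      have hle := hn.2 hd
      have hdv : n ∣ Nat.setGcd (S : Set ℕ) := Nat.dvd_setGcd_iff.2 fun m hm => hn.1 _ _ hm
      have hpos : 0 < Nat.setGcd (S : Set ℕ) :=
        Nat.pos_of_ne_zero fun h0 => by
          have := hd s₀ _ (ha s₀ s₀)
          rw [h0, zero_dvd_iff] at this
          have := ha0 s₀ s₀
          omega
      rw [le_antisymm hle (Nat.le_of_dvd hpos hdv)]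
    obtain ⟨K₀, hK₀⟩ := Nat.exists_mem_closure_of_ge (S : Set ℕ)
    rw [AddSubmonoid.closure_eq] at hK₀
    -- `B` bounds the detours i → s₀ → j. What remains of a path length after the detour is a large
    -- multiple of `n`, spent on a loop at `s₀`.
    obtain ⟨B, hB⟩ := (Set.finite_range fun q : α × α => a q.1 s₀ + a s₀ q.2).bddAbove
    refine ⟨K₀ + B, fun k hk i j hij => ?_⟩
    have hb : a i s₀ + a s₀ j ≤ B := hB ⟨(i, j), rfl⟩
    obtain ⟨q, rfl⟩ := Nat.exists_eq_add_of_le (show a i s₀ + a s₀ j ≤ k by omega)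
    have h2 := hcl _ _ ((ha s₀ i).trans (ha i s₀))
    have hq : n ∣ q := by
      rw [← ZMod.natCast_eq_zero_iff]
      push_cast at hij h2
      linear_combination hij - h2
    have hp : HasPath A q s₀ s₀ := hK₀ q (by omega) (hg.trans hq)
    have := ((ha i s₀).trans hp).trans (ha s₀ j)
    convert this using 1
    ring

end Paths

section Connectors

variable {α : Type*} {A : α → α → Prop}

/-- The word `s v W₀ W₁ …` as a sequence. -/
def entrySeq {β : Type*} {t : ℕ} (s : β) (v : Fin t → β) (W : ℕ → β) (i : ℕ) : β :=
  if i = 0 then s else if h : i - 1 < t then v ⟨i - 1, h⟩ else W (i - 1 - t)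

/-- The word `W₀ … W_{L-1} v s` as a sequence. -/
def exitSeq {β : Type*} {t : ℕ} (L : ℕ) (W : ℕ → β) (v : Fin t → β) (s : β) (i : ℕ) : β :=
  if i < L then W i else if h : i - L < t then v ⟨i - L, h⟩ else s

/-- Replaces the list formulation by an indexed sequence, which can be compared position by position
with the overwritten sequence. -/
lemma isChain_entry_iff {β : Type*} {B : β → β → Prop} {t L : ℕ} {s : β} {v : Fin t → β}
    {W : ℕ → β} :
    List.IsChain B ([s] ++ List.ofFn v ++ List.ofFn fun i : Fin L => W i) ↔
      ∀ i, i < t + L → B (entrySeq s v W i) (entrySeq s v W (i + 1)) := by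
  have e : [s] ++ List.ofFn v ++ List.ofFn (fun i : Fin L => W i) =
      List.ofFn fun i : Fin (1 + t + L) => entrySeq s v W i := by
    refine List.ext_getElem (by simp; ring) fun i h₁ h₂ => ?_
    simp only [List.getElem_append, List.getElem_ofFn, entrySeq, List.getElem_singleton,
      List.length_append, List.length_singleton, List.length_ofFn]
    split_ifs <;> first | rfl | omega | (congr 1; omega)
  rw [e, List.isChain_iff_getElem]
  simp only [List.length_ofFn, List.getElem_ofFn]
  exact ⟨fun h i hi => h i (by omega), fun h i hi => h i (by omega)⟩

lemma isChain_exit_iff {β : Type*} {B : β → β → Prop} {t L : ℕ} {s : β} {v : Fin t → β}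
    {W : ℕ → β} :
    List.IsChain B ((List.ofFn fun i : Fin L => W i) ++ List.ofFn v ++ [s]) ↔
      ∀ i, i < L + t → B (exitSeq L W v s i) (exitSeq L W v s (i + 1)) := by
  have e : (List.ofFn fun i : Fin L => W i) ++ List.ofFn v ++ [s] =
      List.ofFn fun i : Fin (L + t + 1) => exitSeq L W v s i := by
    refine List.ext_getElem (by simp; ring) fun i h₁ h₂ => ?_
    simp only [List.getElem_append, List.getElem_ofFn, exitSeq, List.getElem_singleton,
      List.length_append, List.length_ofFn]
    split_ifs <;> first | rfl | omega
  rw [e, List.isChain_iff_getElem]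
  simp only [List.length_ofFn, List.getElem_ofFn]
  exact ⟨fun h i hi => h i (by omega), fun h i hi => h i (by omega)⟩

lemma residue_seq {n : ℕ} {r : α → ZMod n} (hr : ∀ s s', A s s' → r s' = r s + 1) {g : ℕ → α}
    {T : ℕ} (hg : ∀ m, m + 1 < T → A (g m) (g (m + 1))) (h0 : r (g 0) = 0) (m : ℕ) (hm : m < T) :
    r (g m) = m := by
  induction m with
  | zero => simpa using h0
  | succ m ih =>
    rw [hr _ _ (hg m hm), ih (by omega)]
    push_cast; rfl

/-- Residues grow by one per letter, so starting at residue 0 every block again starts in the class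
of `s₀`. Only the first `T * n` letters of `g` are constrained, which allows finite words padded
arbitrarily. -/
lemma blockAdj_blockWord {n : ℕ} [NeZero n] {s₀ : α} {r : α → ZMod n}
    (hr : ∀ s s', A s s' → r s' = r s + 1) (hcl : cyclicClass A n s₀ = {s | r s = 0}) {g : ℕ → α}
    {T : ℕ} (hg : ∀ m, m + 1 < T * n → A (g m) (g (m + 1))) (h0 : r (g 0) = 0) (i : ℕ)
    (hi : i + 1 < T) :
    blockAdj A n s₀ (blockWord n g i) (blockWord n g (i + 1)) := by
  have hn := NeZero.pos n
  have hsym : ∀ i, i < T → IsBlockSymbol A n s₀ (blockWord n g i) := by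
    intro i hi
    have hT : i * n + n ≤ T * n := by nlinarith
    refine ⟨fun a b hab => ?_, fun a ha => ?_⟩
    · have := hg (i * n + a) (by have := a.2; have := b.2; omega)
      simpa [blockWord, hab, add_assoc] using this
    · rw [hcl]
      simp only [blockWord, ha, add_zero, Set.mem_ofPred_eq]
      rw [residue_seq hr hg h0 _ (by omega)]
      simp
  refine ⟨hsym i (by omega), hsym _ hi, fun a b ha hb => ?_⟩
  have hT : (i + 1) * n + n ≤ T * n := by nlinarith
  have := hg (i * n + a) (by nlinarith)
  simp only [blockWord, hb, add_zero]
  have e : (i + 1) * n = i * n + a + 1 := by rw [add_assoc, ha]; ring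
  rw [e]
  exact this

/-- A block ends at residue n-1 and the next one starts at 0, so a path with `K * n + 1` edges
between them has the right length modulo `n`. Its `K * n` interior letters form `K` blocks, and a
large `K` works for all symbols at once. -/
lemma exists_connector [Finite α] (hA : IsTransitive A) {n : ℕ} [NeZero n] (hn : IsPeriod A n)
    {w : ℕ → α} (hw : ∀ i, A (w i) (w (i + 1))) {L : ℕ} (hL : 0 < L) :
    ∃ (t : ℕ) (v v' : (Fin n → α) → Fin t → Fin n → α),
      IsConnector (blockAdj A n (w 0)) {u | IsBlockSymbol A n (w 0) u} L (blockWord n w) t v v' := by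
  obtain ⟨r, hr, hr0, hcl, K, hK⟩ := exists_residue hA hn (w 0)
  have hn0 := NeZero.pos n
  have hLn : 0 < L * n := Nat.mul_pos hL hn0
  have hsym : ∀ s : Fin n → α, IsBlockSymbol A n (w 0) s → ∀ i : Fin n, r (s i) = (i : ℕ) := by
    intro s hs ⟨i, hi⟩
    induction i with
    | zero => have := hs.2 ⟨0, hi⟩ rfl; rw [hcl] at this; simpa using this
    | succ i ih =>
      rw [hr _ _ (hs.1 ⟨i, by omega⟩ ⟨i + 1, hi⟩ rfl), ih (by omega)]
      push_cast; rfl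
  have hwr : ∀ i, r (w i) = i := fun i =>
    residue_seq (T := i + 1) hr (fun m _ => hw m) hr0 i (by omega)
  have hpath : ∀ s : Fin n → α, ∃ u u' : ℕ → α, IsBlockSymbol A n (w 0) s →
      (u 0 = s ⟨n - 1, by omega⟩ ∧ u (K * n + 1) = w 0 ∧ ∀ m < K * n + 1, A (u m) (u (m + 1))) ∧
      (u' 0 = w (L * n - 1) ∧ u' (K * n + 1) = s ⟨0, hn0⟩ ∧
        ∀ m < K * n + 1, A (u' m) (u' (m + 1))) := by
    intro s
    by_cases hs : IsBlockSymbol A n (w 0) s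
    · have hKn : K ≤ K * n + 1 := by nlinarith
      obtain ⟨u, hu⟩ := hK (K * n + 1) hKn (s ⟨n - 1, by omega⟩) (w 0) (by
        rw [hsym s hs, hr0]
        simp [Nat.cast_sub (show 1 ≤ n from hn0)])
      obtain ⟨u', hu'⟩ := hK (K * n + 1) hKn (w (L * n - 1)) (s ⟨0, hn0⟩) (by
        rw [hsym s hs, hwr]
        simp [Nat.cast_sub (show 1 ≤ L * n from hLn)])
      exact ⟨u, u', fun _ => ⟨hu, hu'⟩⟩
    · exact ⟨w, w, fun h => absurd h hs⟩
  choose u u' hu using hpath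
  refine ⟨K, fun s j i => u s (1 + j * n + i), fun s j i => u' s (1 + j * n + i), fun s hs => ?_⟩
  obtain ⟨⟨u0, uK, hu⟩, u'0, u'K, hu'⟩ := hu s hs
  rw [isChain_entry_iff, isChain_exit_iff]
  constructor
  -- The symbol, the interior of the path and `w` spliced into one sequence of letters. The interior
  -- starts at index 1 of `u s`, since index 0 is the last letter of `s`.
  · let g : ℕ → α := fun m => if h : m < n then s ⟨m, h⟩ else
      if m < n + K * n then u s (m - n + 1) else w (m - (n + K * n))
    have hg : ∀ m, A (g m) (g (m + 1)) := by
      intro m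
      simp only [g]
      by_cases h1 : m + 1 < n
      · rw [dif_pos (by omega), dif_pos h1]; exact hs.1 _ _ rfl
      rw [dif_neg h1]
      by_cases h2 : m + 1 = n
      · have e : m + 1 - n = 0 := by omega
        rw [dif_pos (by omega), e]
        have hsm : s ⟨m, by omega⟩ = u s 0 := by rw [u0]; congr 2; omega
        rw [hsm]
        split_ifs with h3
        · exact hu 0 (by omega)
        · have hk : K * n = 0 := by omega
          rw [hk, add_zero, e, ← uK, hk]; exact hu 0 (by omega)
      rw [dif_neg (by omega)]
      by_cases h3 : m + 1 < n + K * n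
      · rw [if_pos (by omega), if_pos h3, show m + 1 - n + 1 = m - n + 1 + 1 by omega]
        exact hu _ (by omega)
      rw [if_neg h3]
      by_cases h4 : m < n + K * n
      · rw [if_pos h4, show m + 1 - (n + K * n) = 0 by omega, ← uK,
          show K * n + 1 = m - n + 1 + 1 by omega]
        exact hu _ (by omega)
      · rw [if_neg h4, show m + 1 - (n + K * n) = m - (n + K * n) + 1 by omega]; exact hw _
    have he : ∀ i, entrySeq s (fun (j : Fin K) (i : Fin n) => u s (1 + j * n + i)) (blockWord n w) i
        = blockWord n g i := by
      intro i
      funext a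
      have ha := a.2
      rcases i with _ | i
      · simp [entrySeq, blockWord, g]
      have h1 : (i + 1) * n = i * n + n := by ring
      simp only [entrySeq, blockWord, g, h1, Nat.add_sub_cancel, Nat.add_eq_zero_iff, one_ne_zero,
        and_false, if_false]
      by_cases h : i < K
      · have : i * n + n ≤ K * n := by nlinarith
        rw [dif_pos h, dif_neg (by omega), if_pos (by omega)]
        congr 1; omega
      · have : K * n ≤ i * n := Nat.mul_le_mul_right _ (by omega)
        rw [dif_neg h, dif_neg (by omega), if_neg (by omega), blockWord, Nat.sub_mul]
        congr 1; omega
    intro i hi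
    rw [he, he]
    exact blockAdj_blockWord (T := i + 2) hr hcl (fun m _ => hg m)
      (by simp only [g]; rw [dif_pos hn0, hsym s hs]; simp) i (by omega)
  -- The mirror image of the entry word. The final `w 0` is padding beyond the `(L + K + 1) * n`
  -- letters that matter.
  · let g : ℕ → α := fun m => if m < L * n then w m else
      if m < L * n + K * n then u' s (m - L * n + 1) else
      if h : m - (L * n + K * n) < n then s ⟨m - (L * n + K * n), h⟩ else w 0
    have hg : ∀ m, m + 1 < (L + K + 1) * n → A (g m) (g (m + 1)) := by
      intro m hm
      have hm' : m + 1 < L * n + K * n + n := by linarith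
      simp only [g]
      by_cases h1 : m + 1 < L * n
      · rw [if_pos (by omega), if_pos h1]; exact hw _
      rw [if_neg h1]
      by_cases h2 : m + 1 = L * n
      · have e : m + 1 - L * n = 0 := by omega
        have em : m = L * n - 1 := by omega
        rw [if_pos (by omega), e, em, ← u'0]
        split_ifs with h3 h4
        · exact hu' 0 (by omega)
        · have hk : K * n = 0 := by omega
          have := hu' 0 (by omega)
          rw [hk] at u'K
          rw [u'K] at this
          convert this using 3
          omega
        · omega
      rw [if_neg (by omega)]
      by_cases h3 : m + 1 < L * n + K * n
      · rw [if_pos (by omega), if_pos h3, show m + 1 - L * n + 1 = m - L * n + 1 + 1 by omega]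
        exact hu' _ (by omega)
      rw [if_neg h3, dif_pos (show m + 1 - (L * n + K * n) < n by omega)]
      by_cases h4 : m < L * n + K * n
      · have := hu' (m - L * n + 1) (by omega)
        rw [show m - L * n + 1 + 1 = K * n + 1 by omega, u'K] at this
        rw [if_pos h4]
        convert this using 3
        omega
      · rw [if_neg h4, dif_pos (by omega)]
        exact hs.1 _ _ (by simp; omega)
    have he : ∀ i, i < L + K + 1 →
        exitSeq L (blockWord n w) (fun (j : Fin K) (i : Fin n) => u' s (1 + j * n + i)) s i
        = blockWord n g i := by
      intro i hi
      funext a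
      have ha := a.2
      simp only [exitSeq, blockWord, g]
      by_cases h : i < L
      · have : i * n + n ≤ L * n := by nlinarith
        rw [if_pos h, if_pos (by omega), blockWord]
      have hLi : L * n ≤ i * n := Nat.mul_le_mul_right _ (by omega)
      rw [if_neg h, if_neg (by omega)]
      by_cases h' : i - L < K
      · have : i * n + n ≤ L * n + K * n := by
          rw [← add_mul]
          have : i + 1 ≤ L + K := by omega
          nlinarith
        rw [dif_pos h', if_pos (by omega)]
        simp only [Nat.sub_mul]
        congr 1; omega
      · obtain rfl : i = L + K := by omega
        have : (L + K) * n = L * n + K * n := by ring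
        rw [dif_neg h', if_neg (by omega), dif_pos (by omega)]
        congr 1; ext; simp; omega
    intro i hi
    rw [he i (by omega), he (i + 1) (by omega)]
    exact blockAdj_blockWord (T := L + K + 1) hr hcl hg
      (by simp only [g]; rw [if_pos hLn, hr0]) i (by omega)

end Connectors

/-! ### Shifts -/

section Shift

variable {α : Type*}

/-- The power of the shift with an integer exponent. -/
def zshift (k : ℤ) (x : ℤ → α) : ℤ → α := fun i => x (i + k)

lemma shift_iterate (m : ℕ) (x : ℤ → α) (i : ℤ) : (shift^[m] x) i = x (i + m) := by
  induction m generalizing x with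
  | zero => simp
  | succ m ih => rw [Function.iterate_succ_apply, ih]; simp [shift, add_assoc]

lemma shift_iterate_eq (m : ℕ) : (shift^[m] : (ℤ → α) → ℤ → α) = zshift m := by
  funext x i; exact shift_iterate m x i

@[simp] lemma zshift_zero (x : ℤ → α) : zshift 0 x = x := by funext i; simp [zshift]

lemma zshift_zshift (k l : ℤ) (x : ℤ → α) : zshift k (zshift l x) = zshift (k + l) x := by
  funext i; simp [zshift, add_assoc]

lemma shift_mem_SFT {A : α → α → Prop} {x : ℤ → α} (hx : x ∈ SFT A) (m : ℕ) :
    shift^[m] x ∈ SFT A := by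
  intro i
  rw [shift_iterate, shift_iterate, show i + 1 + (m : ℤ) = i + m + 1 by ring]
  exact hx _

variable [MeasurableSpace α]

@[fun_prop] lemma measurable_shift : Measurable (shift : (ℤ → α) → ℤ → α) := by
  unfold shift; fun_prop

@[fun_prop] lemma measurable_zshift (k : ℤ) : Measurable (zshift k : (ℤ → α) → ℤ → α) := by
  unfold zshift; fun_prop

lemma measurePreserving_zshift {μ : Measure (ℤ → α)} (h : MeasurePreserving shift μ μ) (k : ℤ) :
    MeasurePreserving (zshift k) μ μ := by
  have hpos : ∀ m : ℕ, MeasurePreserving (zshift m) μ μ := fun m => by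
    rw [← shift_iterate_eq]; exact h.iterate m
  obtain ⟨m, rfl | rfl⟩ := k.eq_nat_or_neg
  · exact hpos m
  · refine ⟨measurable_zshift _, ?_⟩
    conv_lhs => rw [← (hpos m).map_eq]
    rw [Measure.map_map (measurable_zshift _) (measurable_zshift _)]
    convert Measure.map_id using 2
    funext x
    simp [zshift_zshift]

end Shift

/-! ### Cyclic averages -/

section Average

variable {X Y : Type*} [MeasurableSpace X] [MeasurableSpace Y]

/-- The average of the first `n` images of a measure. -/
def cyclicAverage (T : X → X) (n : ℕ) (m : Measure X) : Measure X :=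
  (n : ℝ≥0∞)⁻¹ • ∑ i ∈ Finset.range n, m.map T^[i]

lemma cyclicAverage_apply {T : X → X} (hT : Measurable T) {n : ℕ} {m : Measure X} {s : Set X}
    (hs : MeasurableSet s) :
    cyclicAverage T n m s = (n : ℝ≥0∞)⁻¹ * ∑ i ∈ Finset.range n, m (T^[i] ⁻¹' s) := by
  simp only [cyclicAverage, Measure.smul_apply, Measure.finsetSum_apply, smul_eq_mul]
  congr 1
  exact Finset.sum_congr rfl fun i _ => Measure.map_apply (hT.iterate i) hs

lemma isProbabilityMeasure_cyclicAverage {T : X → X} (hT : Measurable T) {n : ℕ} [NeZero n]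
    {m : Measure X} [IsProbabilityMeasure m] : IsProbabilityMeasure (cyclicAverage T n m) := by
  refine ⟨?_⟩
  rw [cyclicAverage_apply hT MeasurableSet.univ]
  simp only [Set.preimage_univ, measure_univ, Finset.sum_const, Finset.card_range, nsmul_eq_mul,
    mul_one]
  exact ENNReal.inv_mul_cancel (by simp [NeZero.ne n]) (by simp)

lemma map_cyclicAverage {T : X → X} (hT : Measurable T) {S : Y → Y} (hS : Measurable S) {g : X → Y}
    (hg : Measurable g) (h : ∀ x, g (T x) = S (g x)) (n : ℕ) (m : Measure X) :
    (cyclicAverage T n m).map g = cyclicAverage S n (m.map g) := by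
  have hi : ∀ i, g ∘ T^[i] = S^[i] ∘ g := fun i => by
    funext x
    exact (Function.Semiconj.iterate_right (f := g) h i) x
  ext s hs
  rw [Measure.map_apply hg hs, cyclicAverage_apply hT (hg hs), cyclicAverage_apply hS hs]
  congr 1
  refine Finset.sum_congr rfl fun i _ => ?_
  rw [Measure.map_apply hg ((hS.iterate i) hs), ← Set.preimage_comp, ← Set.preimage_comp, hi]

lemma measurePreserving_cyclicAverage {T : X → X} (hT : Measurable T) {n : ℕ} {m : Measure X}
    (hm : m.map T^[n] = m) : MeasurePreserving T (cyclicAverage T n m) (cyclicAverage T n m) := by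
  refine ⟨hT, ?_⟩
  rw [map_cyclicAverage hT hT hT (fun _ => rfl)]
  unfold cyclicAverage
  congr 1
  have h1 : ∀ i, (m.map T).map T^[i] = m.map T^[i + 1] := fun i => by
    rw [Measure.map_map (hT.iterate i) hT, ← Function.iterate_succ]
  simp only [h1]
  have h2 := Finset.sum_range_succ (fun i => m.map T^[i]) n
  rw [Finset.sum_range_succ', hm] at h2
  ext s hs
  have h3 := congrArg (fun μ : Measure X => μ s) h2
  rcases Nat.eq_zero_or_pos n with rfl | hn
  · simp
  -- The two sums differ by exchanging the `n`-th image for the zeroth, and these are equal. Peeling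
  -- off one end of each sum avoids subtracting measures.
  · obtain ⟨k, rfl⟩ := Nat.exists_eq_succ_of_ne_zero hn.ne'
    rw [Finset.sum_range_succ, Finset.sum_range_succ' (fun i => m.map T^[i]), hm]
    simp

lemma ergodic_of_measure_eq_zero {T : X → X} {μ : Measure X} (h : MeasurePreserving T μ μ)
    (h0 : ∀ s, MeasurableSet s → T ⁻¹' s = s → μ s = 0 ∨ μ sᶜ = 0) : Ergodic T μ := by
  refine ⟨h, ⟨fun {s} hs hTs => ?_⟩⟩
  rw [eventuallyConst_set']
  rcases h0 s hs hTs with h | h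
  · exact Or.inl (ae_eq_empty.2 h)
  · exact Or.inr (ae_eq_univ.2 h)

lemma measure_zero_or_of_ergodic {T : X → X} {μ : Measure X} (h : Ergodic T μ) {s : Set X}
    (hs : NullMeasurableSet s μ) (hTs : T ⁻¹' s =ᵐ[μ] s) : μ s = 0 ∨ μ sᶜ = 0 := by
  rcases h.quasiErgodic.ae_empty_or_univ₀ hs hTs with h | h
  · exact Or.inl (ae_eq_empty.1 h)
  · exact Or.inr (ae_eq_univ.1 h)

/-- A `T`-invariant set has the same mass under each of the `n` images, and its preimage under `g`
is `S`-invariant. Ergodicity of `κ` alone therefore decides its measure; `T^[n]` need not be ergodic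
for the average. -/
lemma ergodic_cyclicAverage {T : X → X} (hT : Measurable T) {S : Y → Y} {n : ℕ}
    {κ : Measure Y} {g : Y → X} (hg : Measurable g) (h : ∀ y, g (S y) = T^[n] (g y))
    (hκ : Ergodic S κ) : Ergodic T (cyclicAverage T n (κ.map g)) := by
  have hinv : (κ.map g).map T^[n] = κ.map g := by
    conv_rhs => rw [← hκ.map_eq]
    rw [Measure.map_map (hT.iterate n) hg, Measure.map_map hg hκ.measurable]
    congr 1; funext y; exact (h y).symm
  refine ergodic_of_measure_eq_zero (measurePreserving_cyclicAverage hT hinv) fun s hs hTs => ?_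
  have hi : ∀ {s : Set X}, T ⁻¹' s = s → ∀ i, T^[i] ⁻¹' s = s := fun {s} hTs i => by
    induction i with
    | zero => rfl
    | succ i ih => rw [Function.iterate_succ', Set.preimage_comp, hTs, ih]
  have hTs' : T ⁻¹' sᶜ = sᶜ := by rw [Set.preimage_compl, hTs]
  have key : S ⁻¹' (g ⁻¹' s) = g ⁻¹' s := by
    ext y
    simp only [Set.mem_preimage, h]
    exact Set.ext_iff.1 (hi hTs n) (g y)
  rw [cyclicAverage_apply hT hs, cyclicAverage_apply hT hs.compl]
  simp only [hi hTs, hi hTs', Measure.map_apply hg hs, Measure.map_apply hg hs.compl]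
  rcases measure_zero_or_of_ergodic hκ (hg hs).nullMeasurableSet
    (Filter.EventuallyEq.of_eq key) with h0 | h0
  · left; simp [h0]
  · right; simp [Set.preimage_compl, h0]

end Average

/-! ### Blocks -/

section Blocks

variable {α : Type*} {n : ℕ} [NeZero n]

lemma unblock_block (x : ℤ → α) : unblock n (block n x) = x := by
  have hn : (0 : ℤ) < n := by exact_mod_cast NeZero.pos n
  funext i
  have h1 := Int.emod_nonneg i hn.ne'
  have h2 := Int.emod_lt_of_pos i hn
  have h3 : (i % n).toNat < n := by omega
  simp only [unblock, block, Fin.val_ofNat, Nat.mod_eq_of_lt h3]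
  congr 1
  rw [Int.toNat_of_nonneg h1]
  exact Int.ediv_mul_add_emod i n

lemma unblock_shift (x : ℤ → Fin n → α) : unblock n (shift x) = shift^[n] (unblock n x) := by
  have hn : (n : ℤ) ≠ 0 := by exact_mod_cast NeZero.ne n
  funext i
  rw [shift_iterate]
  simp only [unblock, shift]
  rw [Int.add_ediv_of_dvd_right (dvd_refl _), Int.ediv_self hn, Int.add_emod_right]

lemma block_shift (x : ℤ → α) : block n (shift^[n] x) = shift (block n x) := by
  funext i j
  simp only [block, shift, shift_iterate]
  congr 1; ring

lemma block_shift_mul (k : ℕ) (x : ℤ → α) :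
    block n (shift^[k * n] x) = shift^[k] (block n x) := by
  induction k generalizing x with
  | zero => simp
  | succ k ih =>
    rw [Nat.succ_mul, Function.iterate_add_apply, ih, block_shift, Function.iterate_succ_apply]

lemma unblock_mul_add (x : ℤ → Fin n → α) (q : ℤ) (j : ℕ) (hj : j < n) :
    unblock n x (q * n + j) = x q ⟨j, hj⟩ := by
  have hn : (n : ℤ) ≠ 0 := by exact_mod_cast NeZero.ne n
  have h1 : (q * n + j) / (n : ℤ) = q := by
    rw [add_comm, Int.add_mul_ediv_right _ _ hn, Int.ediv_eq_zero_of_lt (by omega) (by omega)]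
    simp
  have h2 : (q * n + j) % (n : ℤ) = j := by
    rw [add_comm, Int.add_mul_emod_self_right, Int.emod_eq_of_lt (by omega) (by omega)]
  simp only [unblock, h1, h2]
  congr 1
  ext
  simp [Nat.mod_eq_of_lt hj]

lemma exists_eq_mul_add (n : ℕ) [NeZero n] (i : ℤ) :
    ∃ (q : ℤ) (j : ℕ), j < n ∧ i = q * n + j := by
  have hn : (0 : ℤ) < n := by exact_mod_cast NeZero.pos n
  refine ⟨i / n, (i % n).toNat, ?_, ?_⟩
  · have := Int.emod_lt_of_pos i hn
    have := Int.emod_nonneg i hn.ne'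
    omega
  · rw [Int.toNat_of_nonneg (Int.emod_nonneg i hn.ne')]
    exact (Int.ediv_mul_add_emod i n).symm

lemma unblock_mem_SFT {A : α → α → Prop} {s₀ : α} {x : ℤ → Fin n → α}
    (hx : x ∈ SFT (blockAdj A n s₀)) : unblock n x ∈ SFT A := by
  intro i
  obtain ⟨q, j, hj, rfl⟩ := exists_eq_mul_add n i
  rw [unblock_mul_add _ _ _ hj]
  by_cases h : j + 1 < n
  · have := unblock_mul_add x q (j + 1) h
    push_cast at this
    rw [add_assoc, this]
    exact (hx q).1.1 _ _ rfl
  · have hjn : j + 1 = n := by omega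
    have e : q * n + j + 1 = (q + 1) * n + (0 : ℕ) := by
      push_cast
      have : (n : ℤ) = j + 1 := by exact_mod_cast hjn.symm
      rw [this]; ring
    rw [e, unblock_mul_add x (q + 1) 0 (NeZero.pos n)]
    exact (hx q).2.2 _ _ hjn rfl

variable [MeasurableSpace α]

@[fun_prop] lemma measurable_unblock :
    Measurable (unblock n : (ℤ → Fin n → α) → ℤ → α) := by
  unfold unblock; fun_prop

@[fun_prop] lemma measurable_block (n : ℕ) : Measurable (block n : (ℤ → α) → ℤ → Fin n → α) := by
  unfold block; fun_prop

lemma fromBlocks_eq (κ : Measure (ℤ → Fin n → α)) :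
    fromBlocks n κ = cyclicAverage shift n (κ.map (unblock n)) := rfl

lemma map_unblock_shift {κ : Measure (ℤ → Fin n → α)} (hκ : MeasurePreserving shift κ κ) :
    (κ.map (unblock n)).map shift^[n] = κ.map (unblock n) := by
  conv_rhs => rw [← hκ.map_eq]
  rw [Measure.map_map (measurable_shift.iterate n) measurable_unblock,
    Measure.map_map measurable_unblock measurable_shift]
  congr 1
  funext x
  exact (unblock_shift x).symm

lemma measurableSet_SFT {β : Type*} [MeasurableSpace β] [Countable β] [DiscreteMeasurableSpace β]
    (B : β → β → Prop) : MeasurableSet (SFT B) := by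
  have : SFT B = ⋂ i : ℤ, (fun x : ℤ → β => (x i, x (i + 1))) ⁻¹' {q | B q.1 q.2} := by
    ext x; simp [SFT]
  rw [this]
  exact MeasurableSet.iInter fun i => (by fun_prop : Measurable _) (MeasurableSet.of_discrete)

variable [Finite α] [DiscreteMeasurableSpace α]

lemma invMeasure_fromBlocks {A : α → α → Prop} {s₀ : α} {κ : Measure (ℤ → Fin n → α)}
    [IsProbabilityMeasure κ] (hκ : MeasurePreserving shift κ κ)
    (hs : ∀ᵐ x ∂κ, x ∈ SFT (blockAdj A n s₀)) : InvMeasure A (fromBlocks n κ) := by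
  rw [fromBlocks_eq]
  have : IsProbabilityMeasure (κ.map (unblock n)) :=
    Measure.isProbabilityMeasure_map measurable_unblock.aemeasurable
  refine ⟨isProbabilityMeasure_cyclicAverage measurable_shift,
    measurePreserving_cyclicAverage measurable_shift (map_unblock_shift hκ), ?_⟩
  rw [cyclicAverage_apply measurable_shift (measurableSet_SFT A).compl]
  refine mul_eq_zero_of_right _ (Finset.sum_eq_zero fun i _ => ?_)
  rw [Measure.map_apply measurable_unblock
    ((measurable_shift.iterate i) (measurableSet_SFT A).compl)]
  refine measure_mono_null (fun x hx => ?_) (ae_iff.1 hs)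
  intro hx'
  exact hx (shift_mem_SFT (unblock_mem_SFT hx') i)

lemma ergodic_fromBlocks {κ : Measure (ℤ → Fin n → α)} (hκ : Ergodic shift κ) :
    Ergodic shift (fromBlocks n κ) :=
  ergodic_cyclicAverage measurable_shift measurable_unblock unblock_shift hκ

end Blocks

/-! ### Reading an ergodic measure in blocks -/

section ToBlocks

variable {α : Type*} {A : α → α → Prop} {n : ℕ} [NeZero n] {s₀ : α} {r : α → ZMod n}

/-- The part of the shift space with residue `i` in position `0`. -/
def residueSet (r : α → ZMod n) (i : ℕ) : Set (ℤ → α) := {x | r (x 0) = i}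

lemma residue_shift_iterate (hr : ∀ s s', A s s' → r s' = r s + 1) {x : ℤ → α} (hx : x ∈ SFT A)
    (i : ℕ) : r (x i) = r (x 0) + i := by
  induction i with
  | zero => simp
  | succ i ih =>
    have := hr _ _ (hx i)
    push_cast
    rw [this, ih, add_assoc]

lemma cyclicPiece_eq (hcl : cyclicClass A n s₀ = {s | r s = 0}) :
    cyclicPiece A n s₀ = SFT A ∩ residueSet r 0 := by
  ext x; simp [cyclicPiece, hcl, residueSet]

variable [MeasurableSpace α] [Finite α] [DiscreteMeasurableSpace α]

lemma measurableSet_residueSet (r : α → ZMod n) (i : ℕ) : MeasurableSet (residueSet r i) :=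
  (measurable_pi_apply (X := fun _ : ℤ => α) 0) (MeasurableSet.of_discrete (s := {s | r s = i}))

lemma measurableSet_cyclicPiece (A : α → α → Prop) (n : ℕ) (s₀ : α) :
    MeasurableSet (cyclicPiece A n s₀) :=
  (measurableSet_SFT A).inter ((measurable_pi_apply (X := fun _ : ℤ => α) 0)
    (MeasurableSet.of_discrete (s := cyclicClass A n s₀)))

variable {ν : Measure (ℤ → α)}

lemma InvMeasure.ae_mem (hν : InvMeasure A ν) : ∀ᵐ x ∂ν, x ∈ SFT A := hν.2.2

/-- For almost every x, being in the distinguished piece is the same as having residue `i` after `i`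
shifts; invariance of `ν` does the rest. -/
lemma map_shift_restrict_cyclicPiece (hr : ∀ s s', A s s' → r s' = r s + 1)
    (hcl : cyclicClass A n s₀ = {s | r s = 0}) (hν : InvMeasure A ν) (i : ℕ) :
    (ν.restrict (cyclicPiece A n s₀)).map shift^[i] = ν.restrict (residueSet r i) := by
  have hm := (measurable_shift (α := α)).iterate i
  ext s hs
  rw [Measure.map_apply hm hs, Measure.restrict_apply (hm hs), Measure.restrict_apply hs,
    ← (hν.2.1.iterate i).measure_preimage (hs.inter (measurableSet_residueSet r i)).nullMeasurableSet]
  refine measure_congr ?_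
  filter_upwards [hν.ae_mem] with x hx
  apply propext
  change (shift^[i] x ∈ s ∧ x ∈ cyclicPiece A n s₀) ↔ shift^[i] x ∈ s ∧ r ((shift^[i] x) 0) = i
  rw [cyclicPiece_eq hcl, shift_iterate, zero_add, residue_shift_iterate hr hx]
  simp [residueSet, hx]

lemma sum_restrict_residueSet (ν : Measure (ℤ → α)) (r : α → ZMod n) :
    ∑ i ∈ Finset.range n, ν.restrict (residueSet r i) = ν := by
  ext s hs
  have h1 : ∀ i ∈ Finset.range n,
      ν.restrict (residueSet r i) s = ν.restrict s ((fun x : ℤ → α => (r (x 0)).val) ⁻¹' {i}) := by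
    intro i hi
    rw [Measure.restrict_apply hs, Measure.restrict_apply' hs, Set.inter_comm]
    congr 2
    ext x
    simp only [residueSet, Set.mem_ofPred_eq, Set.mem_preimage, Set.mem_singleton_iff]
    constructor
    · intro h; rw [h, ZMod.val_natCast, Nat.mod_eq_of_lt (Finset.mem_range.1 hi)]
    · rintro rfl; simp
  rw [Measure.finsetSum_apply, Finset.sum_congr rfl h1, sum_measure_preimage_singleton]
  · have : (fun x : ℤ → α => (r (x 0)).val) ⁻¹' (Finset.range n : Set ℕ) = Set.univ := by
      ext x; simp [ZMod.val_lt]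
    rw [this]; simp
  · intro i _
    exact (measurable_pi_apply (X := fun _ : ℤ => α) 0)
      (MeasurableSet.of_discrete (s := {s | (r s).val = i}))

lemma fromBlocks_toBlocks (hr : ∀ s s', A s s' → r s' = r s + 1)
    (hcl : cyclicClass A n s₀ = {s | r s = 0}) (hν : InvMeasure A ν) :
    fromBlocks n (toBlocks A n s₀ ν) = ν := by
  have hn : (n : ℝ≥0∞) ≠ 0 := by simp [NeZero.ne n]
  have h1 : (toBlocks A n s₀ ν).map (unblock n) = (n : ℝ≥0∞) • ν.restrict (cyclicPiece A n s₀) := by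
    rw [toBlocks, Measure.map_map measurable_unblock (measurable_block n)]
    convert Measure.map_id using 2
    funext x
    exact unblock_block x
  rw [fromBlocks, h1]
  simp only [Measure.map_smul, map_shift_restrict_cyclicPiece hr hcl hν]
  rw [← Finset.smul_sum, sum_restrict_residueSet, smul_smul, ENNReal.inv_mul_cancel hn (by simp),
    one_smul]

/-- The cyclic average preserves total mass, so the normalization is read off from recovering `ν`.
-/
lemma isProbabilityMeasure_toBlocks (hr : ∀ s s', A s s' → r s' = r s + 1)
    (hcl : cyclicClass A n s₀ = {s | r s = 0}) (hν : InvMeasure A ν) :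
    IsProbabilityMeasure (toBlocks A n s₀ ν) := by
  have := hν.1
  have hn : (n : ℝ≥0∞) ≠ 0 := by simp [NeZero.ne n]
  have h := congrArg (fun μ : Measure (ℤ → α) => μ Set.univ) (fromBlocks_toBlocks hr hcl hν)
  simp only [fromBlocks_eq, cyclicAverage_apply measurable_shift MeasurableSet.univ,
    Set.preimage_univ, Finset.sum_const, Finset.card_range, measure_univ,
    Measure.map_apply measurable_unblock MeasurableSet.univ, nsmul_eq_mul, ← mul_assoc,
    ENNReal.inv_mul_cancel hn (by simp), one_mul] at h
  exact ⟨h⟩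

lemma measurePreserving_toBlocks (hr : ∀ s s', A s s' → r s' = r s + 1)
    (hcl : cyclicClass A n s₀ = {s | r s = 0}) (hν : InvMeasure A ν) :
    MeasurePreserving shift (toBlocks A n s₀ ν) (toBlocks A n s₀ ν) := by
  refine ⟨measurable_shift, ?_⟩
  have hc : (shift ∘ block n : (ℤ → α) → ℤ → Fin n → α) = block n ∘ shift^[n] := by
    funext x; exact (block_shift x).symm
  have h0 := map_shift_restrict_cyclicPiece hr hcl hν 0
  have h1 := map_shift_restrict_cyclicPiece hr hcl hν n
  have h2 : residueSet r n = residueSet r 0 := by simp [residueSet]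
  rw [h2, ← h0, Function.iterate_zero, Measure.map_id] at h1
  rw [toBlocks, Measure.map_map measurable_shift (measurable_block n), hc,
    ← Measure.map_map (measurable_block n) (measurable_shift.iterate n), Measure.map_smul, h1]

lemma ae_mem_SFT_toBlocks (hr : ∀ s s', A s s' → r s' = r s + 1)
    (hcl : cyclicClass A n s₀ = {s | r s = 0}) :
    ∀ᵐ x ∂toBlocks A n s₀ ν, x ∈ SFT (blockAdj A n s₀) := by
  refine (ae_map_iff (p := fun x => x ∈ SFT (blockAdj A n s₀)) (measurable_block n).aemeasurable
    (measurableSet_SFT _)).2 ?_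
  refine Measure.ae_smul_measure ?_ _
  filter_upwards [ae_restrict_mem (measurableSet_cyclicPiece A n s₀)] with x hx
  rw [cyclicPiece_eq hcl] at hx
  have hsym : ∀ i : ℤ, IsBlockSymbol A n s₀ (block n x i) := by
    intro i
    refine ⟨fun a b hab => ?_, fun a ha => ?_⟩
    · have := hx.1 (i * n + (a : ℕ))
      simpa [block, hab, add_assoc] using this
    · rw [hcl]
      have hz : ∀ i : ℕ, r (x (i * n)) = 0 ∧ r (x (-(i * n))) = 0 := by
        intro i
        have h0 : r (x 0) = 0 := by simpa [residueSet] using hx.2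
        constructor
        · have := residue_shift_iterate hr hx.1 (i * n)
          push_cast at this
          rw [this, h0]; simp
        · have hx' : zshift (-(i * n)) x ∈ SFT A := fun j => by
            have := hx.1 (j + -(i * n))
            simpa [zshift, add_right_comm] using this
          have := residue_shift_iterate hr hx' (i * n)
          simp only [zshift, Nat.cast_mul, add_neg_cancel, zero_add, h0, CharP.cast_eq_zero,
            mul_zero, add_zero] at this
          exact this.symm
      simp only [block, ha, Set.mem_ofPred_eq, Nat.cast_zero, add_zero]
      obtain ⟨m, rfl | rfl⟩ := i.eq_nat_or_neg
      · exact (hz m).1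
      · rw [neg_mul]; exact (hz m).2
  refine fun i => ⟨hsym i, hsym _, fun a b ha hb => ?_⟩
  have := hx.1 (i * n + (a : ℕ))
  simp only [block, hb]
  convert this using 2
  push_cast [← ha]; ring

lemma ergodic_toBlocks (hr : ∀ s s', A s s' → r s' = r s + 1)
    (hcl : cyclicClass A n s₀ = {s | r s = 0}) (hν : ErgMeasure A ν) :
    Ergodic shift (toBlocks A n s₀ ν) := by
  refine ergodic_of_measure_eq_zero (measurePreserving_toBlocks hr hcl hν.1) fun U hU hTU => ?_
  have hper : ∀ (k : ℕ) (y : ℤ → Fin n → α), shift^[k] y ∈ U ↔ y ∈ U := by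
    intro k
    induction k with
    | zero => simp
    | succ k ih =>
      intro y
      rw [Function.iterate_succ_apply, ih]
      exact Set.ext_iff.1 hTU y
  -- The saturation of `U`: shift until the residue is 0, then read in blocks. Since `U` is
  -- invariant, the choice of `i` within its class modulo `n` is immaterial, so `V` is
  -- shift-invariant almost everywhere and meets the piece in the preimage of `U`.
  let V : Set (ℤ → α) := {x | ∃ i : ℕ, r (x 0) + i = 0 ∧ block n (shift^[i] x) ∈ U}
  have hV : MeasurableSet V := by
    have : V = ⋃ i : ℕ, ((fun x : ℤ → α => x 0) ⁻¹' {s | r s + i = 0}) ∩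
        (fun x => block n (shift^[i] x)) ⁻¹' U := by
      ext x; simp [V]
    rw [this]
    refine MeasurableSet.iUnion fun i => ((measurable_pi_apply (X := fun _ : ℤ => α) 0)
      MeasurableSet.of_discrete).inter ?_
    exact ((measurable_block n).comp (measurable_shift.iterate i)) hU
  have hinv : shift ⁻¹' V =ᵐ[ν] V := by
    filter_upwards [hν.1.ae_mem] with x hx
    apply propext
    have h1 : r (x 1) = r (x 0) + 1 := by simpa using residue_shift_iterate hr hx 1
    change (∃ i : ℕ, r (x (0 + 1)) + i = 0 ∧ block n (shift^[i] (shift x)) ∈ U) ↔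
      ∃ i : ℕ, r (x 0) + i = 0 ∧ block n (shift^[i] x) ∈ U
    rw [zero_add, h1]
    constructor
    · rintro ⟨i, hi, hi'⟩
      exact ⟨i + 1, by push_cast; rw [← hi]; ring, hi'⟩
    · rintro ⟨i, hi, hi'⟩
      -- The shift cannot be undone with a natural exponent, so n-1 further steps are taken,
      -- completing one block.
      obtain ⟨m, hm⟩ := Nat.exists_eq_succ_of_ne_zero (NeZero.ne n)
      refine ⟨i + m, ?_, ?_⟩
      · have : ((m + 1 : ℕ) : ZMod n) = 0 := by rw [← Nat.succ_eq_add_one, ← hm]; simp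
        push_cast at this ⊢
        linear_combination hi + this
      · rw [← Function.iterate_succ_apply (f := shift), show (i + m).succ = n + i by omega,
          Function.iterate_add_apply, block_shift]
        exact (hper 1 _).2 hi'
  have hCV : ∀ x ∈ cyclicPiece A n s₀, (x ∈ V ↔ block n x ∈ U) := by
    intro x hx
    rw [cyclicPiece_eq hcl] at hx
    have h0 : r (x 0) = 0 := by simpa [residueSet] using hx.2
    constructor
    · rintro ⟨i, hi, hi'⟩
      rw [h0, zero_add, ZMod.natCast_eq_zero_iff] at hi
      obtain ⟨k, rfl⟩ := hi
      rw [mul_comm, block_shift_mul] at hi'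
      exact (hper k _).1 hi'
    · intro h
      exact ⟨0, by simp [h0], by simpa using h⟩
  have hmeas : ∀ W : Set (ℤ → Fin n → α), MeasurableSet W →
      toBlocks A n s₀ ν W = n * ν (block n ⁻¹' W ∩ cyclicPiece A n s₀) := by
    intro W hW
    rw [toBlocks, Measure.map_apply (measurable_block n) hW, Measure.smul_apply,
      Measure.restrict_apply ((measurable_block n) hW), smul_eq_mul]
  rw [hmeas _ hU, hmeas _ hU.compl]
  rcases measure_zero_or_of_ergodic hν.2 hV.nullMeasurableSet hinv with h | h
  · left
    rw [measure_mono_null (fun x hx => (hCV x hx.2).2 hx.1) h, mul_zero]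
  · right
    rw [measure_mono_null (t := Vᶜ) (fun x hx hxV => hx.1 ((hCV x hx.2).1 hxV)) h, mul_zero]

end ToBlocks

/-! ### The positions of the ones -/

section OnePos

@[simp] lemma onePos_zero (x : ℤ → ℕ) : onePos x 0 = 0 := by simp [onePos]

lemma onePos_succ (x : ℤ → ℕ) (j : ℤ) : onePos x (j + 1) = onePos x j + x j := by
  unfold onePos
  rcases le_or_gt 0 j with h | h
  · have h1 : Finset.Ico 0 (j + 1) = insert j (Finset.Ico 0 j) := by ext; simp; omega
    have h2 : Finset.Ico (j + 1) 0 = ∅ := by ext; simp; omega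
    have h3 : Finset.Ico j 0 = ∅ := by ext; simp; omega
    rw [h1, h2, h3, Finset.sum_insert (by simp)]
    simp; ring
  · have h1 : Finset.Ico j 0 = insert j (Finset.Ico (j + 1) 0) := by ext; simp; omega
    have h2 : Finset.Ico 0 j = ∅ := by ext; simp; omega
    have h3 : Finset.Ico 0 (j + 1) = ∅ := by ext; simp; omega
    rw [h1, h2, h3, Finset.sum_insert (by simp)]
    simp

lemma onePos_one (x : ℤ → ℕ) : onePos x 1 = x 0 := by
  have := onePos_succ x 0
  simpa using this

lemma onePos_zshift (x : ℤ → ℕ) (k j : ℤ) :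
    onePos (zshift k x) j = onePos x (j + k) - onePos x k := by
  induction j using Int.induction_on with
  | zero => simp
  | succ i ih =>
    rw [onePos_succ, ih, add_right_comm, onePos_succ]
    simp only [zshift]; ring
  | pred i ih =>
    have h1 := onePos_succ (zshift k x) (-i - 1)
    have h2 := onePos_succ x (-i - 1 + k)
    rw [show (-i - 1 + 1 : ℤ) = -i by ring, ih] at h1
    rw [show (-i - 1 + k + 1 : ℤ) = -i + k by ring] at h2
    simp only [zshift] at h1
    omega

lemma eta_eq_true {x : ℤ → ℕ} {i : ℤ} : eta x i = true ↔ ∃ j, onePos x j = i := by simp [eta]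

/-- Shifting the sequence of gaps recentres at another `1`. The Bernoulli shift is thus the return
map to the sequences with a `1` at the origin. -/
lemma eta_zshift (x : ℤ → ℕ) (k : ℤ) : eta (zshift k x) = zshift (onePos x k) (eta x) := by
  funext i
  rw [Bool.eq_iff_iff, eta_eq_true, zshift, eta_eq_true]
  simp only [onePos_zshift]
  constructor
  · rintro ⟨j, hj⟩
    exact ⟨j + k, by omega⟩
  · rintro ⟨j, hj⟩
    exact ⟨j - k, by rw [sub_add_cancel]; omega⟩

lemma onePos_strictMono {x : ℤ → ℕ} (hx : ∀ i, x i ≠ 0) : StrictMono (onePos x) :=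
  strictMono_int_of_lt_succ fun j => by
    rw [onePos_succ]; have := hx j; omega

lemma eta_between {x : ℤ → ℕ} (hx : ∀ i, x i ≠ 0) {i j : ℤ} (h1 : onePos x j < i)
    (h2 : i < onePos x (j + 1)) : eta x i = false := by
  rw [← Bool.not_eq_true, eta_eq_true]
  rintro ⟨l, rfl⟩
  have h1 := (onePos_strictMono hx).lt_iff_lt.1 h1
  have h2 := (onePos_strictMono hx).lt_iff_lt.1 h2
  omega

lemma exists_onePos_le_lt {x : ℤ → ℕ} (hx : ∀ i, x i ≠ 0) (i : ℤ) :
    ∃ j, onePos x j ≤ i ∧ i < onePos x (j + 1) := by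
  have hge : ∀ j : ℕ, (j : ℤ) ≤ onePos x j := by
    intro j
    induction j with
    | zero => simp
    | succ j ih =>
      push_cast
      rw [onePos_succ]
      have := hx j
      omega
  have hle : ∀ j : ℕ, onePos x (-j) ≤ -j := by
    intro j
    induction j with
    | zero => simp
    | succ j ih =>
      have h := onePos_succ x (-((j + 1 : ℕ) : ℤ))
      rw [show -((j + 1 : ℕ) : ℤ) + 1 = -j by push_cast; ring] at h
      have := hx (-((j + 1 : ℕ) : ℤ))
      push_cast at *
      omega
  have hmono := (onePos_strictMono hx).monotone
  obtain ⟨j, hj, hj'⟩ := Int.exists_greatest_of_bdd (P := fun j => onePos x j ≤ i)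
    ⟨i.natAbs, fun z hz => by
      by_contra! hlt
      have h1 := hge z.toNat
      rw [Int.toNat_of_nonneg (by omega)] at h1
      omega⟩
    ⟨-i.natAbs, (hle _).trans (by omega)⟩
  refine ⟨j, hj, ?_⟩
  by_contra! h
  have := hj' _ h
  omega

lemma eta_zero (x : ℤ → ℕ) : eta x 0 = true := eta_eq_true.2 ⟨0, by simp⟩

lemma eta_apply_zero (x : ℤ → ℕ) : eta x (x 0) = true := eta_eq_true.2 ⟨1, onePos_one x⟩

lemma eta_lt_apply_zero {x : ℤ → ℕ} (hx : ∀ i, x i ≠ 0) {i : ℤ} (h1 : 0 < i) (h2 : i < x 0) :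
    eta x i = false :=
  eta_between (j := 0) hx (by simpa using h1) (by simpa [onePos_one] using h2)

lemma eta_mem_gapCylinder {x : ℤ → ℕ} (hx : ∀ i, x i ≠ 0) {k : ℕ} (hk : k ≠ 0) :
    eta x ∈ gapCylinder k ↔ x 0 = k := by
  constructor
  · rintro ⟨-, h1, h2⟩
    rcases lt_trichotomy (x 0) k with h | h | h
    · have := h1 (x 0) (by have := hx 0; omega) (by exact_mod_cast h)
      rw [eta_apply_zero] at this
      exact absurd this (by simp)
    · exact h
    · rw [eta_lt_apply_zero hx (by omega) (by exact_mod_cast h)] at h2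
      exact absurd h2 (by simp)
  · rintro rfl
    exact ⟨eta_zero x, fun i h1 h2 => eta_lt_apply_zero hx h1 h2, eta_apply_zero x⟩

lemma eta_mem_goodSet {t L : ℕ} {p : PMF ℕ} (hp : IsAdmissibleVector t L p) {x : ℤ → ℕ}
    (hx : ∀ i, x i ≠ 0) (hxp : ∀ i, p (x i) ≠ 0) : eta x ∈ goodSet t L := by
  intro i hi
  obtain ⟨j, hj, hj'⟩ := exists_onePos_le_lt hx i
  have hlt : onePos x j < i := lt_of_le_of_ne hj fun h => by
    rw [← Bool.not_eq_true, eta_eq_true] at hi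
    exact hi ⟨j, h⟩
  refine ⟨_, _, hlt, hj', eta_eq_true.2 ⟨_, rfl⟩, eta_eq_true.2 ⟨_, rfl⟩,
    fun l h1 h2 => eta_between hx h1 h2, ?_⟩
  rw [onePos_succ] at hj' ⊢
  rcases hp _ (hxp j) with h | ⟨k, hk, h⟩
  · omega
  · exact ⟨k, hk, by rw [h]; push_cast; ring⟩

lemma zshift_mem_goodSet {t L : ℕ} (k : ℤ) {y : ℤ → Bool} :
    zshift k y ∈ goodSet t L ↔ y ∈ goodSet t L := by
  have key : ∀ (k : ℤ) {y : ℤ → Bool}, y ∈ goodSet t L → zshift k y ∈ goodSet t L := by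
    intro k y hy i hi
    obtain ⟨a, b, h1, h2, h3, h4, h5, h6⟩ := hy (i + k) hi
    refine ⟨a - k, b - k, by omega, by omega, by simpa [zshift] using h3,
      by simpa [zshift] using h4, fun j hj hj' => h5 (j + k) (by omega) (by omega), ?_⟩
    rw [sub_sub_sub_cancel_right]; exact h6
  refine ⟨fun h => ?_, key k⟩
  have := key (-k) h
  rwa [zshift_zshift, neg_add_cancel, zshift_zero] at this

lemma measurable_onePos (j : ℤ) : Measurable fun x : ℤ → ℕ => onePos x j := by
  unfold onePos
  refine Measurable.sub ?_ ?_ <;>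
  exact Finset.measurable_sum _ fun i _ =>
    (Measurable.of_discrete (f := fun k : ℕ => (k : ℤ))).comp (measurable_pi_apply i)

lemma measurable_eta : Measurable eta := by
  refine measurable_pi_iff.2 fun i => measurable_to_bool ?_
  have : (fun x => eta x i) ⁻¹' {true} = ⋃ j : ℤ, (fun x => onePos x j) ⁻¹' {i} := by
    ext x; simp [eta]
  rw [this]
  exact MeasurableSet.iUnion fun j => measurable_onePos j (measurableSet_singleton i)

lemma measurableSet_coord (i : ℤ) (b : Bool) : MeasurableSet {y : ℤ → Bool | y i = b} :=
  measurableSet_preimage (f := fun y : ℤ → Bool => y i) (measurable_pi_apply i)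
    (measurableSet_singleton b)

lemma measurableSet_gapCylinder (k : ℕ) : MeasurableSet (gapCylinder k) := by
  have : gapCylinder k = {y | y 0 = true} ∩ (⋂ (i : ℤ) (_ : 0 < i) (_ : i < k), {y | y i = false}) ∩
      {y | y k = true} := by
    ext y; simp [gapCylinder, and_assoc]
  rw [this]
  exact ((measurableSet_coord _ _).inter (MeasurableSet.iInter fun i => MeasurableSet.iInter fun _ =>
    MeasurableSet.iInter fun _ => measurableSet_coord _ _)).inter (measurableSet_coord _ _)

/-- `(a, b)` is a maximal string of zeros of `y`. -/
def IsGap (a b : ℤ) : Set (ℤ → Bool) :=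
  {y | y a = true ∧ y b = true ∧ ∀ j, a < j → j < b → y j = false}

lemma measurableSet_isGap (a b : ℤ) : MeasurableSet (IsGap a b) := by
  have : IsGap a b = {y | y a = true} ∩ ({y | y b = true} ∩
      ⋂ (j : ℤ) (_ : a < j) (_ : j < b), {y | y j = false}) := by
    ext y; simp [IsGap]
  rw [this]
  exact (measurableSet_coord _ _).inter ((measurableSet_coord _ _).inter
    (MeasurableSet.iInter fun i => MeasurableSet.iInter fun _ =>
    MeasurableSet.iInter fun _ => measurableSet_coord _ _))

lemma mem_goodSet_iff {t L : ℕ} {y : ℤ → Bool} : y ∈ goodSet t L ↔ ∀ i, y i = false →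
    ∃ a b : ℤ, a < i ∧ i < b ∧ y ∈ IsGap a b ∧ ∃ k : ℕ, 1 ≤ k ∧ b - a = 2 * t + k * L + 1 := by
  simp only [goodSet, IsGap, Set.mem_ofPred_eq, and_assoc]

lemma measurableSet_goodSet (t L : ℕ) : MeasurableSet (goodSet t L) := by
  have : goodSet t L = ⋂ i : ℤ, {y : ℤ → Bool | y i = false}ᶜ ∪
      ⋃ (a : ℤ) (b : ℤ) (_ : a < i ∧ i < b ∧ ∃ k : ℕ, 1 ≤ k ∧ b - a = 2 * t + k * L + 1),
        IsGap a b := by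
    ext y
    rw [mem_goodSet_iff]
    simp only [Set.mem_iInter, Set.mem_union, Set.mem_compl_iff, Set.mem_ofPred_eq, Set.mem_iUnion,
      exists_prop, imp_iff_not_or]
    refine forall_congr' fun i => or_congr Iff.rfl (exists_congr fun a => exists_congr fun b => ?_)
    tauto
  rw [this]
  exact MeasurableSet.iInter fun i => (measurableSet_coord _ _).compl.union
    (MeasurableSet.iUnion fun a => MeasurableSet.iUnion fun b => MeasurableSet.iUnion fun _ =>
      measurableSet_isGap a b)

end OnePos

/-! ### The Bernoulli measure -/

section Bernoulli

variable {p : PMF ℕ}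

instance : IsProbabilityMeasure (bernoulli p) := by unfold bernoulli; infer_instance

lemma measurePreserving_eval_bernoulli (p : PMF ℕ) (i : ℤ) :
    MeasurePreserving (fun x : ℤ → ℕ => x i) (bernoulli p) p.toMeasure :=
  measurePreserving_eval_infinitePi (fun _ : ℤ => p.toMeasure) i

lemma measurePreserving_shift_bernoulli (p : PMF ℕ) :
    MeasurePreserving shift (bernoulli p) (bernoulli p) := by
  refine ⟨measurable_shift, ?_⟩
  exact Measure.map_infinitePi_infinitePi_of_inj (P := fun _ : ℤ => p.toMeasure)
    (f := fun i : ℤ => i + 1) (add_left_injective 1)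

lemma bernoulli_eval (p : PMF ℕ) (i : ℤ) (k : ℕ) : bernoulli p {x | x i = k} = p k := by
  have := (measurePreserving_eval_bernoulli p i).measure_preimage
    (measurableSet_singleton k).nullMeasurableSet
  rw [PMF.toMeasure_apply_singleton _ _ (measurableSet_singleton k)] at this
  exact this

lemma ae_bernoulli_ne_zero (p : PMF ℕ) : ∀ᵐ x ∂bernoulli p, ∀ i, p (x i) ≠ 0 := by
  refine ae_all_iff.2 fun i => ?_
  have h : ∀ᵐ k ∂p.toMeasure, p k ≠ 0 := by
    rw [ae_iff, PMF.toMeasure_apply_eq_zero_iff _ MeasurableSet.of_discrete, Set.disjoint_left]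
    intro k hk hk'
    simp at hk'
    exact hk hk'
  exact (measurePreserving_eval_bernoulli p i).quasiMeasurePreserving.ae h

lemma lintegral_bernoulli_eval (p : PMF ℕ) (i : ℤ) (f : ℕ → ℝ≥0∞) :
    ∫⁻ x, f (x i) ∂bernoulli p = ∑' k, f k * p k := by
  rw [(measurePreserving_eval_bernoulli p i).lintegral_comp (Measurable.of_discrete (f := f)),
    lintegral_countable']
  exact tsum_congr fun k => by
    rw [PMF.toMeasure_apply_singleton _ _ (measurableSet_singleton k)]

lemma ofReal_mean (h : Summable fun k : ℕ => (k : ℝ) * (p k).toReal) :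
    ENNReal.ofReal (mean p) = ∑' k : ℕ, (k : ℝ≥0∞) * p k := by
  rw [mean, ENNReal.ofReal_tsum_of_nonneg (fun k => by positivity) h]
  refine tsum_congr fun k => ?_
  rw [ENNReal.ofReal_mul (by positivity), ENNReal.ofReal_natCast,
    ENNReal.ofReal_toReal (p.apply_ne_top k)]

lemma lintegral_bernoulli_zero (h : Summable fun k : ℕ => (k : ℝ) * (p k).toReal) :
    ∫⁻ x, (x 0 : ℝ≥0∞) ∂bernoulli p = ENNReal.ofReal (mean p) := by
  rw [ofReal_mean h, lintegral_bernoulli_eval p 0 fun k => (k : ℝ≥0∞)]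

lemma one_le_mean (h : Summable fun k : ℕ => (k : ℝ) * (p k).toReal) (h0 : p 0 = 0) :
    1 ≤ mean p := by
  rw [← ENNReal.one_le_ofReal, ofReal_mean h, ← p.tsum_coe]
  refine ENNReal.tsum_le_tsum fun k => ?_
  rcases Nat.eq_zero_or_pos k with rfl | hk
  · simp [h0]
  · exact le_mul_of_one_le_left (by simp) (by exact_mod_cast hk)

lemma ae_bernoulli_pos (h0 : p 0 = 0) : ∀ᵐ x ∂bernoulli p, ∀ i, x i ≠ 0 := by
  filter_upwards [ae_bernoulli_ne_zero p] with x hx i h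
  exact hx i (by rw [h, h0])

end Bernoulli

/-! ### The renewal measure -/

section Renewal

variable {p : PMF ℕ}

/-- Tower formula: the cylinder `[1 0^{k-1} 1]` is the event that the first gap is `k`, so the
double sum of the definition collapses to the levels `m < x 0` over the Bernoulli base. All later
statements on the renewal measure go through this formula. -/
lemma lintegral_renewalMeasure (h0 : p 0 = 0) {g : (ℤ → Bool) → ℝ≥0∞} (hg : Measurable g) :
    ∫⁻ y, g y ∂renewalMeasure p = ENNReal.ofReal (mean p)⁻¹ *
      ∫⁻ x, ∑ m ∈ Finset.range (x 0), g (shift^[m] (eta x)) ∂bernoulli p := by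
  have hG : ∀ m, Measurable fun x => g (shift^[m] (eta x)) := fun m =>
    hg.comp ((measurable_shift.iterate m).comp measurable_eta)
  have hterm : ∀ m j : ℕ, ∫⁻ y, g y ∂(((bernoulli p).map eta).restrict
      (gapCylinder (m + 1 + j))).map (shift^[m]) =
      ∫⁻ x, {x : ℤ → ℕ | x 0 = m + 1 + j}.indicator (fun x => g (shift^[m] (eta x))) x
        ∂bernoulli p := by
    intro m j
    rw [lintegral_map hg (measurable_shift.iterate m),
      ← lintegral_indicator (measurableSet_gapCylinder _),
      lintegral_map (Measurable.indicator (by fun_prop) (measurableSet_gapCylinder _))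
        measurable_eta]
    refine lintegral_congr_ae ?_
    filter_upwards [ae_bernoulli_pos h0] with x hx
    have := eta_mem_gapCylinder hx (k := m + 1 + j) (by omega)
    by_cases h : x 0 = m + 1 + j
    · rw [Set.indicator_of_mem (this.2 h), Set.indicator_of_mem (by exact h)]
    · rw [Set.indicator_of_notMem (fun h' => h (this.1 h')), Set.indicator_of_notMem (by exact h)]
  have hmeas : ∀ m j : ℕ, Measurable
      ({x : ℤ → ℕ | x 0 = m + 1 + j}.indicator (fun x => g (shift^[m] (eta x)))) := fun m j =>
    (hG m).indicator (measurableSet_preimage (f := fun x : ℤ → ℕ => x 0) (measurable_pi_apply 0)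
      (measurableSet_singleton (m + 1 + j)))
  simp only [renewalMeasure, lintegral_smul_measure, lintegral_sum_measure, hterm, smul_eq_mul]
  congr 1
  simp_rw [← lintegral_tsum fun j => (hmeas _ j).aemeasurable]
  rw [← lintegral_tsum fun m => (Measurable.tsum fun j => hmeas m j).aemeasurable]
  refine lintegral_congr fun x => ?_
  have hin : ∀ m : ℕ, ∑' j : ℕ, {x : ℤ → ℕ | x 0 = m + 1 + j}.indicator
      (fun x => g (shift^[m] (eta x))) x = if m < x 0 then g (shift^[m] (eta x)) else 0 := by
    intro m
    split_ifs with h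
    · rw [tsum_eq_single (x 0 - m - 1)]
      · exact Set.indicator_of_mem (by simp; omega) _
      · intro j hj
        exact Set.indicator_of_notMem (by simp; omega) _
    · rw [ENNReal.tsum_eq_zero]
      intro j
      exact Set.indicator_of_notMem (by simp; omega) _
  simp_rw [hin]
  rw [tsum_eq_sum (s := Finset.range (x 0))]
  · exact Finset.sum_congr rfl fun m hm => if_pos (Finset.mem_range.1 hm)
  · intro m hm
    exact if_neg (by simpa using hm)

lemma mean_mul_inv (h : Summable fun k : ℕ => (k : ℝ) * (p k).toReal) (h0 : p 0 = 0) :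
    ENNReal.ofReal (mean p)⁻¹ * ENNReal.ofReal (mean p) = 1 := by
  have := one_le_mean h h0
  rw [← ENNReal.ofReal_mul (by positivity), inv_mul_cancel₀ (by positivity), ENNReal.ofReal_one]

lemma isProbabilityMeasure_renewalMeasure (h : Summable fun k : ℕ => (k : ℝ) * (p k).toReal)
    (h0 : p 0 = 0) : IsProbabilityMeasure (renewalMeasure p) := by
  refine ⟨?_⟩
  rw [← lintegral_one, lintegral_renewalMeasure h0 measurable_const]
  simp only [Finset.sum_const, Finset.card_range, nsmul_eq_mul, mul_one]
  rw [lintegral_bernoulli_zero h, mean_mul_inv h h0]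

lemma measurePreserving_shift_renewalMeasure (h0 : p 0 = 0) :
    MeasurePreserving shift (renewalMeasure p) (renewalMeasure p) := by
  refine ⟨measurable_shift, ?_⟩
  ext s hs
  set g : (ℤ → Bool) → ℝ≥0∞ := s.indicator 1
  have hg : Measurable g := measurable_one.indicator hs
  have hG : ∀ m, Measurable fun x => g (shift^[m] (eta x)) := fun m =>
    hg.comp ((measurable_shift.iterate m).comp measurable_eta)
  rw [← lintegral_indicator_one hs, ← lintegral_indicator_one hs,
    lintegral_map hg measurable_shift,
    lintegral_renewalMeasure (g := fun y => g (shift y)) h0 (hg.comp measurable_shift),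
    lintegral_renewalMeasure h0 hg]
  congr 1
  have h1 : ∫⁻ x, g (eta (shift x)) ∂bernoulli p = ∫⁻ x, g (eta x) ∂bernoulli p :=
    (measurePreserving_shift_bernoulli p).lintegral_comp (hg.comp measurable_eta)
  have hS : Measurable fun x => g (eta x) := hG 0
  have hS' : Measurable fun x => g (eta (shift x)) := hS.comp measurable_shift
  -- The levels of the shifted sum run from 1 to `x 0` instead of 0 to `x 0 - 1`. The surplus top
  -- level is the base of the next tower, which has the same integral as the bottom level.
  -- Finiteness lets that integral be added to both sides and cancelled.
  have hfin : ∫⁻ x, g (eta x) ∂bernoulli p ≠ ∞ := by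
    refine ne_of_lt (lt_of_le_of_lt (lintegral_mono (g := fun _ => 1) fun x => ?_) ?_)
    · exact Set.indicator_le_self' (by simp) _
    · simp
  rw [← ENNReal.add_left_inj hfin, ← lintegral_add_right _ hS]
  conv_rhs => rw [← h1]
  rw [← lintegral_add_right _ hS']
  refine lintegral_congr fun x => ?_
  have e : eta (shift x) = shift^[x 0] (eta x) := by
    rw [shift_iterate_eq, ← onePos_one, ← eta_zshift]; rfl
  rw [e]
  simp only [← Function.iterate_succ_apply' shift]
  rw [← Finset.sum_range_succ (fun m => g (shift^[m] (eta x))), Finset.sum_range_succ']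
  simp

lemma ae_renewalMeasure (h0 : p 0 = 0) {Q : Set (ℤ → Bool)} (hQ : MeasurableSet Q)
    (h : ∀ᵐ x ∂bernoulli p, ∀ m, shift^[m] (eta x) ∈ Q) : ∀ᵐ y ∂renewalMeasure p, y ∈ Q := by
  change renewalMeasure p Qᶜ = 0
  rw [← lintegral_indicator_one hQ.compl,
    lintegral_renewalMeasure h0 (measurable_one.indicator hQ.compl)]
  refine mul_eq_zero_of_right _ ?_
  rw [lintegral_eq_zero_of_ae_eq_zero]
  filter_upwards [h] with x hx
  exact Finset.sum_eq_zero fun m _ => Set.indicator_of_notMem (by simpa using hx m) _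

lemma ae_renewalMeasure_pure : ∀ᵐ y ∂renewalMeasure (PMF.pure 1), ∀ i, y i = true := by
  refine ae_all_iff.2 fun i => ae_renewalMeasure (by simp) (measurableSet_coord i true) ?_
  filter_upwards [ae_bernoulli_ne_zero (PMF.pure 1)] with x hx m
  have hx1 : x = fun _ => 1 := by
    funext i
    by_contra h
    exact hx i (by simp [PMF.pure_apply, h])
  have hpos : ∀ j, onePos x j = j := by
    intro j
    induction j using Int.induction_on with
    | zero => simp
    | succ i ih => rw [onePos_succ, ih, hx1]; simp
    | pred i ih =>
      have := onePos_succ x (-i - 1)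
      rw [sub_add_cancel, ih, hx1] at this
      rw [hx1]
      push_cast at this
      omega
  change (shift^[m] (eta x)) i = true
  rw [shift_iterate, eta_eq_true]
  exact ⟨_, hpos _⟩

lemma renewalMeasure_coord_false (h : Summable fun k : ℕ => (k : ℝ) * (p k).toReal) (h0 : p 0 = 0)
    (i : ℤ) : renewalMeasure p {y | y i = false} ≤ ENNReal.ofReal ((mean p - 1) / mean p) := by
  have := isProbabilityMeasure_renewalMeasure h h0
  have hE := one_le_mean h h0
  have hi : renewalMeasure p {y | y i = false} = renewalMeasure p {y | y 0 = false} := by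
    have := (measurePreserving_zshift (measurePreserving_shift_renewalMeasure h0) i).measure_preimage
      (measurableSet_coord 0 false).nullMeasurableSet
    rw [← this]
    congr 1
    ext y; simp [zshift]
  have hc : {y : ℤ → Bool | y 0 = false} = {y | y 0 = true}ᶜ := by ext; simp
  rw [hi, hc, prob_compl_eq_one_sub (measurableSet_coord _ _)]
  -- The bottom level of the tower always has a `1` at the origin, and its mass is 1/E.
  have hlow : ENNReal.ofReal (mean p)⁻¹ ≤ renewalMeasure p {y | y 0 = true} := by
    rw [← lintegral_indicator_one (measurableSet_coord _ _), lintegral_renewalMeasure h0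
      (measurable_one.indicator (measurableSet_coord _ _))]
    conv_lhs => rw [← mul_one (ENNReal.ofReal (mean p)⁻¹)]
    refine mul_le_mul_right ?_ _
    calc (1 : ℝ≥0∞) = ∫⁻ x, 1 ∂bernoulli p := by simp
      _ ≤ _ := lintegral_mono_ae ?_
    filter_upwards [ae_bernoulli_pos h0] with x hx
    refine le_trans ?_ (Finset.single_le_sum (fun _ _ => zero_le)
      (Finset.mem_range.2 (Nat.pos_of_ne_zero (hx 0))))
    rw [Set.indicator_of_mem]
    · simp
    · exact eta_zero x
  refine (tsub_le_tsub_left hlow 1).trans ?_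
  rw [← ENNReal.ofReal_one, ← ENNReal.ofReal_sub _ (by positivity)]
  refine ENNReal.ofReal_le_ofReal (le_of_eq ?_)
  field_simp

end Renewal

/-! ### A random ergodic theorem for the skew product over the Bernoulli shift -/

section Skew

open ProbabilityTheory

variable {β : Type*} [MeasurableSpace β] {p : PMF ℕ} {μ : Measure (ℤ → β)}

/-- The powers of the skew product over the Bernoulli shift whose fibre maps are powers of the
shift. -/
def skew (k : ℤ) (q : (ℤ → ℕ) × (ℤ → β)) : (ℤ → ℕ) × (ℤ → β) :=
  (zshift k q.1, zshift (onePos q.1 k) q.2)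

omit [MeasurableSpace β] in
lemma skew_skew (k l : ℤ) (q : (ℤ → ℕ) × (ℤ → β)) : skew k (skew l q) = skew (k + l) q := by
  simp [skew, zshift_zshift, onePos_zshift]

omit [MeasurableSpace β] in
lemma skew_preimage {B : Set ((ℤ → ℕ) × (ℤ → β))} (hB : skew 1 ⁻¹' B = B) (k : ℤ) :
    skew k ⁻¹' B = B := by
  have h1 : ∀ q, skew 1 q ∈ B ↔ q ∈ B := Set.ext_iff.1 hB
  ext q
  change skew k q ∈ B ↔ q ∈ B
  induction k using Int.induction_on with
  | zero => simp [skew]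
  | succ i ih => rw [add_comm, ← skew_skew, h1, ih]
  | pred i ih => rw [← ih, ← h1 (skew (-i - 1) q), skew_skew, add_sub_cancel]

lemma measurable_zshift_uncurry {Z : Type*} [MeasurableSpace Z] {k : Z → ℤ} {z : Z → ℤ → β}
    (hk : Measurable k) (hz : Measurable z) : Measurable fun q => zshift (k q) (z q) := by
  have : Measurable fun r : ℤ × (ℤ → β) => zshift r.1 r.2 :=
    measurable_from_prod_countable_right fun k => measurable_zshift k
  exact this.comp (hk.prodMk hz)

lemma measurePreserving_skew [SFinite μ] (hμ : MeasurePreserving shift μ μ) (k : ℤ) :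
    MeasurePreserving (skew k) ((bernoulli p).prod μ) ((bernoulli p).prod μ) := by
  refine MeasurePreserving.skew_product
    (measurePreserving_zshift (measurePreserving_shift_bernoulli p) k)
    (g := fun x z => zshift (onePos x k) z) ?_ ?_
  · exact measurable_zshift_uncurry ((measurable_onePos k).comp measurable_fst) measurable_snd
  · exact Filter.Eventually.of_forall fun x => (measurePreserving_zshift hμ _).map_eq

/-- Independence of complementary sets of coordinates, with dependence expressed pointwise because
that is what can be checked for preimages under the skew product. -/
lemma bernoulli_inter {S : Set ℤ} {P Q : Set (ℤ → ℕ)} (hP : MeasurableSet P)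
    (hQ : MeasurableSet Q) (hPS : ∀ x x' : ℤ → ℕ, (∀ i ∈ S, x i = x' i) → (x ∈ P ↔ x' ∈ P))
    (hQS : ∀ x x' : ℤ → ℕ, (∀ i ∉ S, x i = x' i) → (x ∈ Q ↔ x' ∈ Q)) :
    bernoulli p (P ∩ Q) = bernoulli p P * bernoulli p Q := by
  classical
  have hind : iIndepFun (fun (i : ℤ) (x : ℤ → ℕ) => x i) (bernoulli p) :=
    iIndepFun_infinitePi (P := fun _ : ℤ => p.toMeasure) (X := fun _ x => x)
      fun _ => measurable_id
  have h := indep_iSup_of_disjoint (m := fun i : ℤ =>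
    MeasurableSpace.comap (fun x : ℤ → ℕ => x i) inferInstance)
    (fun i => (measurable_pi_apply i).comap_le) hind (disjoint_compl_right (a := S))
  have key : ∀ (S : Set ℤ) {P : Set (ℤ → ℕ)}, MeasurableSet P →
      (∀ x x' : ℤ → ℕ, (∀ i ∈ S, x i = x' i) → (x ∈ P ↔ x' ∈ P)) →
      MeasurableSet[⨆ i ∈ S, MeasurableSpace.comap (fun x : ℤ → ℕ => x i) inferInstance] P := by
    intro S P hP hPS
    -- Erasing the coordinates outside `S` is measurable for the σ-algebra of `S`, and `P` is its
    -- own preimage under the erasure.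
    have hρ : Measurable[⨆ i ∈ S, MeasurableSpace.comap (fun x : ℤ → ℕ => x i) inferInstance]
        (fun (x : ℤ → ℕ) (i : ℤ) => if i ∈ S then x i else 0) := by
      refine @measurable_pi_lambda _ _ _ (_) _ _ fun i => ?_
      by_cases hi : i ∈ S
      · simp only [hi, if_true]
        exact (comap_measurable _).mono (le_iSup₂ (f := fun i (_ : i ∈ S) =>
          MeasurableSpace.comap (fun x : ℤ → ℕ => x i) inferInstance) i hi) le_rfl
      · simp only [hi, if_false]
        exact measurable_const
    convert hρ hP using 1
    ext x
    exact hPS _ _ fun i hi => by simp [hi]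
  exact Indep_iff _ _ _ |>.1 h P Q (key S hP hPS) (key Sᶜ hQ hQS)

/-- Approximation of measurable sets by sets which depend on finitely many coordinates of the
Bernoulli shift. -/
lemma exists_approx [IsProbabilityMeasure μ] {B : Set ((ℤ → ℕ) × (ℤ → β))} (hB : MeasurableSet B)
    {ε : ℝ≥0∞} (hε : 0 < ε) : ∃ G : Set ((ℤ → ℕ) × (ℤ → β)), MeasurableSet G ∧
      (∃ m : ℕ, ∀ x x' z, (∀ i : ℤ, -m ≤ i → i < m → x i = x' i) → ((x, z) ∈ G ↔ (x', z) ∈ G)) ∧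
      ((bernoulli p).prod μ) (symmDiff G B) < ε := by
  let C : Set (Set ((ℤ → ℕ) × (ℤ → β))) := {G | MeasurableSet G ∧
    ∃ m : ℕ, ∀ x x' z, (∀ i : ℤ, -m ≤ i → i < m → x i = x' i) → ((x, z) ∈ G ↔ (x', z) ∈ G)}
  have hC : IsSetRing C := by
    refine ⟨⟨MeasurableSet.empty, 0, by simp⟩, ?_, ?_⟩
    · rintro s t ⟨hs, m, hm⟩ ⟨ht, m', hm'⟩
      refine ⟨hs.union ht, max m m', fun x x' z h => ?_⟩
      exact or_congr (hm x x' z fun i h1 h2 => h i (by omega) (by omega))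
        (hm' x x' z fun i h1 h2 => h i (by omega) (by omega))
    · rintro s t ⟨hs, m, hm⟩ ⟨ht, m', hm'⟩
      refine ⟨hs.diff ht, max m m', fun x x' z h => ?_⟩
      exact and_congr (hm x x' z fun i h1 h2 => h i (by omega) (by omega))
        (not_congr (hm' x x' z fun i h1 h2 => h i (by omega) (by omega)))
  have huniv : Set.univ ∈ C := ⟨MeasurableSet.univ, 0, by simp⟩
  have hgen : (inferInstance : MeasurableSpace ((ℤ → ℕ) × (ℤ → β))) =
      MeasurableSpace.generateFrom C := by
    refine le_antisymm (sup_le ?_ ?_) (MeasurableSpace.generateFrom_le fun s hs => hs.1)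
    · rw [← measurable_iff_comap_le]
      refine @measurable_pi_lambda _ _ _ (MeasurableSpace.generateFrom C) _ _ fun i s hs =>
        MeasurableSpace.measurableSet_generateFrom ⟨?_, ?_⟩
      · exact ((measurable_pi_apply i).comp measurable_fst) hs
      · refine ⟨i.natAbs + 1, fun x x' z h => ?_⟩
        simp [h i (by omega) (by omega)]
    · rw [← measurable_iff_comap_le]
      intro s hs
      exact MeasurableSpace.measurableSet_generateFrom ⟨measurable_snd hs, 0, by simp⟩
  obtain ⟨G, hG, hG'⟩ := exists_measure_symmDiff_lt_of_generateFrom_isSetRing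
    (μ := (bernoulli p).prod μ) hC ⟨{Set.univ}, by simp, by simpa using huniv, by simp⟩ hgen hB hε
  exact ⟨G, hG.1, hG.2, hG'⟩

/-- If independent events both approximate `B`, then `B` is nearly independent of its own
complement; as the two are disjoint, the product of their probabilities is small. -/
lemma prod_compl_le_of_indep {Ω : Type*} [MeasurableSpace Ω] {P : Measure Ω}
    [IsProbabilityMeasure P] {B E F : Set Ω} (h : P (E ∩ Fᶜ) = P E * P Fᶜ) :
    P B * P Bᶜ ≤ 2 * (P (symmDiff E B) + P (symmDiff F B)) := by
  have h1 : P B ≤ P E + P (symmDiff E B) := by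
    refine (measure_mono fun x hx => ?_).trans (measure_union_le _ _)
    by_cases hE : x ∈ E
    · exact Or.inl hE
    · exact Or.inr (Or.inr ⟨hx, hE⟩)
  have h2 : P Bᶜ ≤ P Fᶜ + P (symmDiff F B) := by
    refine (measure_mono fun x hx => ?_).trans (measure_union_le _ _)
    by_cases hF : x ∈ F
    · exact Or.inr (Or.inl ⟨hF, hx⟩)
    · exact Or.inl hF
  have h3 : P (E ∩ Fᶜ) ≤ P (symmDiff E B) + P (symmDiff F B) := by
    refine (measure_mono fun x hx => ?_).trans (measure_union_le _ _)
    by_cases hB : x ∈ B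
    · exact Or.inr (Or.inr ⟨hB, hx.2⟩)
    · exact Or.inl (Or.inl ⟨hx.1, hB⟩)
  calc P B * P Bᶜ ≤ (P E + P (symmDiff E B)) * P Bᶜ := by gcongr
    _ = P E * P Bᶜ + P (symmDiff E B) * P Bᶜ := add_mul _ _ _
    _ ≤ P E * (P Fᶜ + P (symmDiff F B)) + P (symmDiff E B) * 1 := by
        gcongr; exact prob_le_one
    _ = P (E ∩ Fᶜ) + P E * P (symmDiff F B) + P (symmDiff E B) := by rw [mul_add, h, mul_one]
    _ ≤ (P (symmDiff E B) + P (symmDiff F B)) + 1 * P (symmDiff F B) + P (symmDiff E B) := by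
        gcongr; exact prob_le_one
    _ = 2 * (P (symmDiff E B) + P (symmDiff F B)) := by ring

lemma measurable_fibre {B : Set ((ℤ → ℕ) × (ℤ → β))} (hB : MeasurableSet B) :
    Measurable fun z => bernoulli p ((fun x => (x, z)) ⁻¹' B) :=
  measurable_measure_prodMk_right hB

/-- The fibres of a set which is invariant under the skew product are trivial. -/
lemma skew_fibre_trivial [IsProbabilityMeasure μ] (hμ : MeasurePreserving shift μ μ)
    {B : Set ((ℤ → ℕ) × (ℤ → β))} (hB : MeasurableSet B) (hinv : skew 1 ⁻¹' B = B) :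
    ∀ᵐ z ∂μ, bernoulli p ((fun x => (x, z)) ⁻¹' B) = 0 ∨
      bernoulli p ((fun x => (x, z)) ⁻¹' Bᶜ) = 0 := by
  set f : (ℤ → β) → ℝ≥0∞ := fun z =>
    bernoulli p ((fun x => (x, z)) ⁻¹' B) * bernoulli p ((fun x => (x, z)) ⁻¹' Bᶜ) with hf
  have hfm : Measurable f := (measurable_fibre hB).mul (measurable_fibre hB.compl)
  have hle : ∀ ε : ℝ≥0∞, 0 < ε → ∫⁻ z, f z ∂μ ≤ 2 * (ε + ε) := by
    intro ε hε
    obtain ⟨G, hG, ⟨m, hm⟩, hGB⟩ := exists_approx (p := p) (μ := μ) hB hε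
    have hk : ∀ k : ℤ, MeasurableSet (skew k ⁻¹' G) ∧
        ((bernoulli p).prod μ) (symmDiff (skew k ⁻¹' G) B) ≤ ε := by
      intro k
      have hs := measurePreserving_skew (p := p) hμ k
      refine ⟨hs.measurable hG, ?_⟩
      conv_lhs => rw [← skew_preimage hinv k, ← Set.preimage_symmDiff]
      rw [hs.measure_preimage (hG.symmDiff hB).nullMeasurableSet]
      exact hGB.le
    -- For fixed `z`, moving the window [-m, m) of `G` by `m` leaves dependence on coordinates ≥ 0
    -- only, and moving it by `-m` on coordinates < 0 only. The fibre exponent `onePos x (±m)` is a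
    -- sum over the same side, so it does not spoil this.
    have hpt : ∀ z, f z ≤ 2 * (bernoulli p ((fun x => (x, z)) ⁻¹' (symmDiff (skew m ⁻¹' G) B)) +
        bernoulli p ((fun x => (x, z)) ⁻¹' (symmDiff (skew (-m) ⁻¹' G) B))) := by
      intro z
      refine prod_compl_le_of_indep (bernoulli_inter (S := {i | 0 ≤ i})
        (measurable_prodMk_right (hk m).1) (measurable_prodMk_right (hk (-m)).1).compl ?_ ?_)
      · intro x x' h
        have e : onePos x m = onePos x' m := by
          unfold onePos
          rw [Finset.Ico_eq_empty (a := (m : ℤ)) (by omega)]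
          simp only [Finset.sum_empty, sub_zero]
          exact Finset.sum_congr rfl fun i hi => by
            rw [h i (Finset.mem_Ico.1 hi).1]
        change (zshift m x, zshift (onePos x m) z) ∈ G ↔ (zshift m x', zshift (onePos x' m) z) ∈ G
        rw [e]
        refine hm _ _ _ fun i h1 h2 => h _ ?_
        change 0 ≤ i + m
        omega
      · intro x x' h
        have h' : ∀ i : ℤ, i < 0 → x i = x' i := fun i hi => h i (by simpa using hi)
        have e : onePos x (-m) = onePos x' (-m) := by
          unfold onePos
          rw [Finset.Ico_eq_empty (b := -(m : ℤ)) (by omega)]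
          simp only [Finset.sum_empty, zero_sub]
          rw [Finset.sum_congr rfl fun i hi => by rw [h' i (Finset.mem_Ico.1 hi).2]]
        refine not_congr ?_
        change (zshift (-m) x, zshift (onePos x (-m)) z) ∈ G ↔
          (zshift (-m) x', zshift (onePos x' (-m)) z) ∈ G
        rw [e]
        exact hm _ _ _ fun i h1 h2 => h' _ (by omega)
    calc ∫⁻ z, f z ∂μ ≤ ∫⁻ z, 2 * (bernoulli p ((fun x => (x, z)) ⁻¹' (symmDiff (skew m ⁻¹' G) B)) +
        bernoulli p ((fun x => (x, z)) ⁻¹' (symmDiff (skew (-m) ⁻¹' G) B))) ∂μ :=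
          lintegral_mono hpt
      _ = 2 * (((bernoulli p).prod μ) (symmDiff (skew m ⁻¹' G) B) +
          ((bernoulli p).prod μ) (symmDiff (skew (-m) ⁻¹' G) B)) := by
        have m1 := (hk m).1.symmDiff hB
        have m2 := (hk (-m)).1.symmDiff hB
        rw [Measure.prod_apply_symm m1, Measure.prod_apply_symm m2, lintegral_const_mul,
          lintegral_add_left (measurable_fibre m1)]
        exact (measurable_fibre m1).add (measurable_fibre m2)
      _ ≤ 2 * (ε + ε) := by
        gcongr
        · exact (hk m).2
        · exact (hk (-m)).2
  have h0 : ∫⁻ z, f z ∂μ = 0 := by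
    by_contra h
    have hlt : ∫⁻ z, f z ∂μ ≤ 2 * (1 + 1) := hle 1 one_pos
    have hne : ∫⁻ z, f z ∂μ ≠ ∞ := ne_top_of_le_ne_top (by norm_num) hlt
    -- With ε an eighth of the integral, the bound is half of the integral; the case ε = 1 served
    -- only to make it finite.
    have := hle ((8 : ℝ≥0∞)⁻¹ * ∫⁻ z, f z ∂μ) (by
      rw [pos_iff_ne_zero]
      simp [h])
    generalize ∫⁻ z, f z ∂μ = a at *
    lift a to NNReal using hne
    have h8 : (8 : ℝ≥0∞)⁻¹ = ((8⁻¹ : NNReal) : ℝ≥0∞) := by simp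
    rw [h8] at this
    norm_cast at this
    rw [ENNReal.coe_eq_zero] at h
    have hr : (a : ℝ) ≤ 2 * (8⁻¹ * a + 8⁻¹ * a) := by exact_mod_cast this
    have ha : 0 < (a : ℝ) := by positivity
    linarith
  filter_upwards [(lintegral_eq_zero_iff hfm).1 h0] with z hz
  exact mul_eq_zero.1 hz

/-- A random ergodic theorem: if the exponents of the fibre maps have greatest common divisor `1`,
then the skew product has only trivial invariant sets. -/
lemma skew_trivial [IsProbabilityMeasure μ] (hμ : Ergodic shift μ)
    (hgcd : ∀ d : ℕ, (∀ k, p k ≠ 0 → d ∣ k) → d = 1)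
    {B : Set ((ℤ → ℕ) × (ℤ → β))} (hB : MeasurableSet B) (hinv : skew 1 ⁻¹' B = B) :
    (∀ᵐ q ∂(bernoulli p).prod μ, q ∈ B) ∨ (∀ᵐ q ∂(bernoulli p).prod μ, q ∉ B) := by
  have hpres := hμ.toMeasurePreserving
  -- Fibres are null or full, so `B` agrees almost everywhere with a condition on `z` alone.
  set B₀ : Set (ℤ → β) := {z | bernoulli p ((fun x => (x, z)) ⁻¹' Bᶜ) = 0} with hB₀
  have hB₀m : MeasurableSet B₀ :=
    measurableSet_preimage (measurable_fibre hB.compl) (measurableSet_singleton 0)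
  have hae : ∀ᵐ q ∂(bernoulli p).prod μ, (q ∈ B ↔ q.2 ∈ B₀) := by
    have hm : MeasurableSet {q : (ℤ → ℕ) × (ℤ → β) | ¬ (q ∈ B ↔ q.2 ∈ B₀)} := by
      have : {q : (ℤ → ℕ) × (ℤ → β) | ¬ (q ∈ B ↔ q.2 ∈ B₀)} =
          symmDiff B (Prod.snd ⁻¹' B₀) := by
        ext q
        simp only [Set.mem_ofPred_eq, Set.mem_symmDiff, Set.mem_preimage]
        tauto
      rw [this]
      exact hB.symmDiff (measurable_snd hB₀m)
    rw [ae_iff, Measure.prod_apply_symm hm]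
    refine lintegral_eq_zero_of_ae_eq_zero ?_
    filter_upwards [skew_fibre_trivial (p := p) hpres hB hinv] with z hz
    by_cases hz0 : z ∈ B₀
    · refine measure_mono_null (fun x hx => ?_) hz0
      intro h
      exact hx (iff_of_true h hz0)
    · refine measure_mono_null (fun x hx => ?_) (hz.resolve_right hz0)
      by_contra h
      exact hx (iff_of_false h hz0)
  -- One step of the skew product moves `z` by `x 0`. The event `x 0 = k` has positive probability
  -- and is independent of `z`, so each such `k` preserves the set.
  have hk : ∀ k : ℕ, p k ≠ 0 → zshift (k : ℤ) ⁻¹' B₀ =ᵐ[μ] B₀ := by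
    intro k hpk
    have h1 : ∀ᵐ q ∂(bernoulli p).prod μ, (zshift (q.1 0 : ℤ) q.2 ∈ B₀ ↔ q.2 ∈ B₀) := by
      filter_upwards [hae,
        (measurePreserving_skew (p := p) hpres 1).quasiMeasurePreserving.ae hae] with q hq hq'
      rw [← hq, ← Set.ext_iff.1 hinv q, Set.mem_preimage, hq', skew, onePos_one]
    have h2 : ((bernoulli p).prod μ) ({x | x 0 = k} ×ˢ {z | ¬ (zshift (k : ℤ) z ∈ B₀ ↔ z ∈ B₀)})
        = 0 := by
      refine measure_mono_null (fun q hq => ?_) h1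
      obtain ⟨hq1, hq2⟩ := hq
      intro h
      change (zshift (q.1 0 : ℤ) q.2 ∈ B₀ ↔ q.2 ∈ B₀) at h
      rw [show q.1 0 = k from hq1] at h
      exact hq2 h
    rw [Measure.prod_prod, bernoulli_eval] at h2
    have h3 := (mul_eq_zero.1 h2).resolve_left hpk
    filter_upwards [measure_eq_zero_iff_ae_notMem.1 h3] with z hz
    exact propext (not_not.1 hz)
  -- The exponents preserving the set up to null sets form a subgroup of ℤ. Its generator divides
  -- every `k` with `p k ≠ 0`, hence is ±1.
  let H : AddSubgroup ℤ :=
    { carrier := {k | zshift k ⁻¹' B₀ =ᵐ[μ] B₀}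
      zero_mem' := by
        change zshift 0 ⁻¹' B₀ =ᵐ[μ] B₀
        rw [show zshift 0 ⁻¹' B₀ = B₀ from Set.ext fun z => by simp]
        exact Filter.EventuallyEq.rfl
      add_mem' := fun {a b} ha hb => by
        have h := ((measurePreserving_zshift hpres b).quasiMeasurePreserving.preimage_ae_eq
          (show zshift a ⁻¹' B₀ =ᵐ[μ] B₀ from ha)).trans (show zshift b ⁻¹' B₀ =ᵐ[μ] B₀ from hb)
        have e : zshift (a + b) ⁻¹' B₀ = zshift b ⁻¹' (zshift a ⁻¹' B₀) := by
          ext z; simp [zshift_zshift]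
        change zshift (a + b) ⁻¹' B₀ =ᵐ[μ] B₀
        rw [e]; exact h
      neg_mem' := fun {a} ha => by
        have h := ((measurePreserving_zshift hpres (-a)).quasiMeasurePreserving.preimage_ae_eq
          (show zshift a ⁻¹' B₀ =ᵐ[μ] B₀ from ha))
        have e : zshift (-a) ⁻¹' (zshift a ⁻¹' B₀) = B₀ := by
          ext z; simp [zshift_zshift]
        rw [e] at h
        exact h.symm }
  obtain ⟨a, ha⟩ := Int.subgroup_cyclic H
  have ha1 : a.natAbs = 1 := hgcd _ fun k hpk => by
    have : (k : ℤ) ∈ H := hk k hpk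
    rw [ha, AddSubgroup.mem_closure_singleton] at this
    obtain ⟨z, hz⟩ := this
    rw [← Int.natCast_dvd_natCast, Int.natAbs_dvd, ← hz]
    exact Dvd.intro_left z rfl
  have h1 : (1 : ℤ) ∈ H := by
    rw [ha, AddSubgroup.mem_closure_singleton]
    exact ⟨a, by have : a * a = 1 := by (rcases Int.natAbs_eq a with h | h <;> rw [h, ha1] <;> rfl)
                 simpa using this⟩
  have hT : shift ⁻¹' B₀ =ᵐ[μ] B₀ := h1
  have hsnd : ∀ {Q : Set (ℤ → β)}, μ Qᶜ = 0 → ∀ᵐ q ∂(bernoulli p).prod μ, q.2 ∈ Q := fun {Q} hQ =>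
    Measure.quasiMeasurePreserving_snd.ae (p := fun z => z ∈ Q) hQ
  rcases measure_zero_or_of_ergodic hμ hB₀m.nullMeasurableSet hT with h | h
  · right
    have := hsnd (Q := B₀ᶜ) (by rwa [compl_compl])
    filter_upwards [this, hae] with q h1 h2
    exact fun h3 => h1 (h2.1 h3)
  · left
    filter_upwards [hsnd h, hae] with q h1 h2
    exact h2.2 h1

/-- The product of an ergodic measure and the renewal measure is ergodic if the exponents of the
renewal measure have greatest common divisor `1`. -/
theorem ergodic_prod_renewalMeasure [IsProbabilityMeasure μ] (hμ : Ergodic shift μ)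
    (h : Summable fun k : ℕ => (k : ℝ) * (p k).toReal) (h0 : p 0 = 0)
    (hgcd : ∀ d : ℕ, (∀ k, p k ≠ 0 → d ∣ k) → d = 1) :
    Ergodic (Prod.map shift shift) (μ.prod (renewalMeasure p)) := by
  have := isProbabilityMeasure_renewalMeasure h h0
  have hpres := hμ.toMeasurePreserving
  refine ergodic_of_measure_eq_zero
    (hpres.prod (measurePreserving_shift_renewalMeasure h0)) fun U hU hTU => ?_
  -- An invariant set that is null over the base of the tower is null on every level, since
  -- invariance carries each level back to the base.
  have key : ∀ W : Set ((ℤ → β) × (ℤ → Bool)), MeasurableSet W → Prod.map shift shift ⁻¹' W = W →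
      (∀ᵐ q ∂(bernoulli p).prod μ, (q.2, eta q.1) ∉ W) → μ.prod (renewalMeasure p) W = 0 := by
    intro W hW hTW hnull
    have hper : ∀ (m : ℕ) z y, (zshift (m : ℤ) z, shift^[m] y) ∈ W ↔ (z, y) ∈ W := by
      intro m
      rw [← shift_iterate_eq]
      induction m with
      | zero => simp
      | succ m ih =>
        intro z y
        rw [Function.iterate_succ_apply, Function.iterate_succ_apply, ih]
        exact Set.ext_iff.1 hTW (z, y)
    rw [Measure.prod_apply_symm hW, lintegral_renewalMeasure h0 (measurable_measure_prodMk_right hW)]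
    refine mul_eq_zero_of_right _ (lintegral_eq_zero_of_ae_eq_zero ?_)
    filter_upwards [Measure.ae_ae_of_ae_prod hnull] with x hx
    refine Finset.sum_eq_zero fun m _ => ?_
    rw [← (measurePreserving_zshift hpres m).measure_preimage
      (measurable_prodMk_right hW).nullMeasurableSet]
    refine measure_mono_null (fun z hz => ?_) hx
    have : (zshift (m : ℤ) z, shift^[m] (eta x)) ∈ W := hz
    rw [hper] at this
    exact not_not.2 this
  set B : Set ((ℤ → ℕ) × (ℤ → β)) := (fun q => (q.2, eta q.1)) ⁻¹' U with hBdef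
  have hB : MeasurableSet B :=
    (measurable_snd.prodMk (measurable_eta.comp measurable_fst)) hU
  have hper : ∀ (m : ℕ) z y, (shift^[m] z, shift^[m] y) ∈ U ↔ (z, y) ∈ U := by
    intro m
    induction m with
    | zero => simp
    | succ m ih =>
      intro z y
      rw [Function.iterate_succ_apply, Function.iterate_succ_apply, ih]
      exact Set.ext_iff.1 hTU (z, y)
  have hinv : skew 1 ⁻¹' B = B := by
    ext q
    change (zshift (onePos q.1 1) q.2, eta (zshift 1 q.1)) ∈ U ↔ (q.2, eta q.1) ∈ U
    rw [eta_zshift, onePos_one, ← shift_iterate_eq, ← shift_iterate_eq, hper]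
  rcases skew_trivial (p := p) hμ hgcd hB hinv with hh | hh
  · right
    refine key Uᶜ hU.compl (by rw [Set.preimage_compl, hTU]) ?_
    filter_upwards [hh] with q hq
    exact not_not.2 hq
  · left
    exact key U hU hTU hh

end Skew

/-! ### Overwriting -/

section Overwrite

variable {β : Type*} {L : ℕ} {W : ℕ → β} {t : ℕ} {v v' : β → Fin t → β}

/-- The symbol written into a maximal string of zeros, in terms of the symbols at the ends of the
string and of the distances to these ends. -/
def gapSymbol (L : ℕ) (W : ℕ → β) (t : ℕ) (v v' : β → Fin t → β) (s s' : β) (l m : ℕ) : β :=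
  if h : l < t then v s ⟨l, h⟩
  else if h' : m < t then v' s' (Fin.rev ⟨m, h'⟩)
  else W ((l - t) % L)

lemma overwrite_of_true {y : ℤ → Bool} {x : ℤ → β} {i : ℤ} (h : y i = true) :
    overwrite L W t v v' y x i = x i := by
  simp [overwrite, h]

lemma overwrite_of_not_mem {y : ℤ → Bool} {x : ℤ → β} (h : y ∉ goodSet t L) :
    overwrite L W t v v' y x = x := by
  funext i; simp [overwrite, h]

lemma overwrite_of_gap {y : ℤ → Bool} {x : ℤ → β} {a b i : ℤ} (hy : y ∈ goodSet t L)
    (hab : y ∈ IsGap a b) (hai : a < i) (hib : i < b) :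
    overwrite L W t v v' y x i =
      gapSymbol L W t v v' (x a) (x b) (i - a - 1).toNat (b - 1 - i).toNat := by
  obtain ⟨h1, h2, h3⟩ := hab
  have ha : sSup {j | j < i ∧ y j = true} = a := by
    refine IsGreatest.csSup_eq ⟨⟨hai, h1⟩, fun j hj => ?_⟩
    by_contra! h
    have := h3 j h (hj.1.trans hib)
    rw [hj.2] at this
    exact absurd this (by simp)
  have hb : sInf {j | i < j ∧ y j = true} = b := by
    refine IsLeast.csInf_eq ⟨⟨hib, h2⟩, fun j hj => ?_⟩
    by_contra! h
    have := h3 j (hai.trans hj.1) h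
    rw [hj.2] at this
    exact absurd this (by simp)
  unfold overwrite
  rw [if_pos ⟨hy, h3 i hai hib⟩]
  simp only [ha, hb]
  rfl

lemma zshift_mem_isGap {y : ℤ → Bool} {a b : ℤ} (h : y ∈ IsGap a b) (k : ℤ) :
    zshift k y ∈ IsGap (a - k) (b - k) :=
  ⟨by simpa [zshift] using h.1, by simpa [zshift] using h.2.1,
    fun j h1 h2 => h.2.2 (j + k) (by omega) (by omega)⟩

/-- The rule refers only to the ends of the string of zeros and to distances from them, all of which
move with the shift. -/
lemma overwrite_shift (y : ℤ → Bool) (x : ℤ → β) :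
    overwrite L W t v v' (shift y) (shift x) = shift (overwrite L W t v v' y x) := by
  have hgood : shift y ∈ goodSet t L ↔ y ∈ goodSet t L := zshift_mem_goodSet 1
  by_cases hy : y ∈ goodSet t L
  · funext i
    cases hyi : y (i + 1) with
    | true =>
      rw [overwrite_of_true (show shift y i = true from hyi)]
      exact (overwrite_of_true hyi).symm
    | false =>
      obtain ⟨a, b, ha, hb, hab, -⟩ := mem_goodSet_iff.1 hy _ hyi
      rw [overwrite_of_gap (hgood.2 hy) (zshift_mem_isGap hab 1) (by omega) (by omega)]
      simp only [shift]
      rw [overwrite_of_gap hy hab ha hb]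
      congr 1
      · simp
      · simp
      · congr 1; ring
      · congr 1; ring
  · rw [overwrite_of_not_mem hy, overwrite_of_not_mem (fun h => hy (hgood.1 h))]

lemma measurable_overwrite [MeasurableSpace β] [Countable β] [DiscreteMeasurableSpace β] :
    Measurable fun q : (ℤ → β) × (ℤ → Bool) => overwrite L W t v v' q.2 q.1 := by
  refine measurable_pi_iff.2 fun i S hS => ?_
  -- Splitting by the ends `a`, `b` of the string around `i` gives countably many pieces on each of
  -- which the new symbol depends on `x a` and `x b` only.
  have hset : (fun q : (ℤ → β) × (ℤ → Bool) => overwrite L W t v v' q.2 q.1 i) ⁻¹' S =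
      (Prod.snd ⁻¹' (goodSet t L ∩ {y | y i = false})ᶜ ∩ (fun q : (ℤ → β) × (ℤ → Bool) => q.1 i) ⁻¹' S) ∪
      ⋃ (a : ℤ) (b : ℤ) (_ : a < i ∧ i < b), (Prod.snd ⁻¹' (goodSet t L ∩ IsGap a b)) ∩
        (fun q : (ℤ → β) × (ℤ → Bool) => (q.1 a, q.1 b)) ⁻¹'
          {s | gapSymbol L W t v v' s.1 s.2 (i - a - 1).toNat (b - 1 - i).toNat ∈ S} := by
    ext ⟨x, y⟩
    simp only [Set.mem_preimage, Set.mem_union, Set.mem_inter_iff, Set.mem_compl_iff,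
      Set.mem_ofPred_eq, Set.mem_iUnion, exists_prop]
    constructor
    · intro h
      by_cases hy : y ∈ goodSet t L ∧ y i = false
      · obtain ⟨a, b, ha, hb, hab, -⟩ := mem_goodSet_iff.1 hy.1 _ hy.2
        rw [overwrite_of_gap hy.1 hab ha hb] at h
        exact Or.inr ⟨a, b, ⟨ha, hb⟩, ⟨hy.1, hab⟩, h⟩
      · refine Or.inl ⟨hy, ?_⟩
        rwa [overwrite, if_neg hy] at h
    · rintro (⟨hy, h⟩ | ⟨a, b, ⟨ha, hb⟩, ⟨hy, hab⟩, h⟩)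
      · rwa [overwrite, if_neg hy]
      · rwa [overwrite_of_gap hy hab ha hb]
  rw [hset]
  refine MeasurableSet.union (MeasurableSet.inter ?_ ?_) ?_
  · exact measurable_snd ((measurableSet_goodSet t L).inter (measurableSet_coord i false)).compl
  · exact ((measurable_pi_apply i).comp measurable_fst) hS
  · refine MeasurableSet.iUnion fun a => MeasurableSet.iUnion fun b => MeasurableSet.iUnion fun _ =>
      MeasurableSet.inter ?_ ?_
    · exact measurable_snd ((measurableSet_goodSet t L).inter (measurableSet_isGap a b))
    · exact (((measurable_pi_apply a).comp measurable_fst).prodMk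
        ((measurable_pi_apply b).comp measurable_fst)) MeasurableSet.of_discrete

/-- In a string of zeros, the entry word followed by the repetitions of `W` is written. -/
lemma overwrite_entry (hW : ∀ j, W (j + L) = W j) {y : ℤ → Bool} {x : ℤ → β} {a b : ℤ} {k : ℕ}
    (hy : y ∈ goodSet t L) (hab : y ∈ IsGap a b) (hk : b - a = 2 * t + k * L + 1) {s : ℕ}
    (hs : s ≤ t + k * L) :
    overwrite L W t v v' y x (a + s) = entrySeq (x a) (v (x a)) W s := by
  have hmod : ∀ m, W (m % L) = W m := Function.Periodic.map_mod_nat hW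
  have hs' : (s : ℤ) ≤ t + k * L := by exact_mod_cast hs
  rcases s with _ | s
  · rw [Nat.cast_zero, add_zero, overwrite_of_true hab.1]
    rfl
  · push_cast at hs'
    rw [overwrite_of_gap hy hab (by omega) (by push_cast; omega)]
    have e : (a + ((s + 1 : ℕ) : ℤ) - a - 1).toNat = s := by omega
    rw [e]
    have e2 : ¬ (b - 1 - (a + ((s + 1 : ℕ) : ℤ))).toNat < t := by push_cast; omega
    simp only [gapSymbol, entrySeq, e2, hmod]
    simp

/-- In a string of zeros, the repetitions of `W` are followed by the exit word. -/
lemma overwrite_exit (hW : ∀ j, W (j + L) = W j) {y : ℤ → Bool} {x : ℤ → β} {a b : ℤ} {k : ℕ}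
    (hy : y ∈ goodSet t L) (hab : y ∈ IsGap a b) (hk : b - a = 2 * t + k * L + 1) {e : ℕ}
    (he : e ≤ k * L + t) :
    overwrite L W t v v' y x (a + t + 1 + e) = exitSeq (k * L) W (v' (x b)) (x b) e := by
  have hmod : ∀ m, W (m % L) = W m := Function.Periodic.map_mod_nat hW
  have he' : (e : ℤ) ≤ k * L + t := by exact_mod_cast he
  rcases he.lt_or_eq with h | h
  · have hz : (e : ℤ) < k * L + t := by exact_mod_cast h
    rw [overwrite_of_gap hy hab (by omega) (by omega)]
    have e1 : (a + t + 1 + (e : ℤ) - a - 1).toNat = t + e := by omega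
    rw [e1]
    have e3 : ((k * L : ℕ) : ℤ) = k * L := by push_cast; rfl
    have e2 : (b - 1 - (a + t + 1 + (e : ℤ))).toNat = k * L + t - 1 - e := by omega
    rw [e2]
    unfold gapSymbol exitSeq
    rw [dif_neg (by omega)]
    by_cases h' : e < k * L
    · rw [if_pos h', dif_neg (by omega), hmod]; congr 1; omega
    · rw [if_neg h', dif_pos (by omega), dif_pos (by omega)]
      congr 1
      ext
      simp only [Fin.val_rev]
      omega
  · have : a + t + 1 + (e : ℤ) = b := by rw [h]; push_cast; omega
    rw [this, overwrite_of_true hab.2.1]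
    unfold exitSeq
    rw [if_neg (by omega), dif_neg (by omega)]

/-- The entry and exit descriptions of a filled string overlap along the repetitions of `W`. Since
at least one nonempty copy is written, every adjacent pair lies within one of the two. -/
lemma overwrite_mem_SFT {B : β → β → Prop} {symb : Set β} (hB : ∀ s s', B s s' → s ∈ symb)
    (hL : 0 < L) (hW : ∀ j, W (j + L) = W j) (hWB : ∀ j, B (W j) (W (j + 1)))
    (hc : IsConnector B symb L W t v v') (y : ℤ → Bool) {x : ℤ → β} (hx : x ∈ SFT B) :
    overwrite L W t v v' y x ∈ SFT B := by
  by_cases hy : y ∈ goodSet t L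
  swap
  · rwa [overwrite_of_not_mem hy]
  have hentry : ∀ a s, B (entrySeq (x a) (v (x a)) W s) (entrySeq (x a) (v (x a)) W (s + 1)) := by
    intro a s
    by_cases h : s < t + L
    · exact isChain_entry_iff.1 (hc (x a) (hB _ _ (hx a))).1 s h
    · unfold entrySeq
      rw [if_neg (by omega), dif_neg (by omega), if_neg (by omega), dif_neg (by omega),
        show s + 1 - 1 - t = s - 1 - t + 1 by omega]
      exact hWB _
  -- Only pairs from the last letter of the repetitions onwards are needed here, and for these the
  -- word with `k` copies looks like the word with one copy.
  have hexit : ∀ b (k : ℕ), 1 ≤ k → ∀ e, k * L ≤ e + 1 → e < k * L + t →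
      B (exitSeq (k * L) W (v' (x b)) (x b) e) (exitSeq (k * L) W (v' (x b)) (x b) (e + 1)) := by
    intro b k hk e h1 h2
    obtain ⟨q, rfl⟩ := Nat.exists_eq_add_of_le' hk
    have hqL : (q + 1) * L = q * L + L := by ring
    have hper : ∀ m, W (m + q * L) = W m := fun m => by
      have := Function.Periodic.nat_mul (f := W) hW q m
      simpa using this
    have hsh : ∀ e, e + 1 ≥ (q + 1) * L →
        exitSeq ((q + 1) * L) W (v' (x b)) (x b) e = exitSeq L W (v' (x b)) (x b) (e - q * L) := by
      intro e he
      unfold exitSeq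
      rw [hqL] at he ⊢
      by_cases h : e < q * L + L
      · rw [if_pos h, if_pos (by omega), ← hper (e - q * L), Nat.sub_add_cancel (by omega)]
      · rw [if_neg h, if_neg (by omega), Nat.sub_sub]
    rw [hsh e h1, hsh (e + 1) (by omega), show e + 1 - q * L = e - q * L + 1 by omega]
    exact isChain_exit_iff.1 (hc (x b) (hB _ _ (hx b))).2 _ (by omega)
  have key : ∀ i a b : ℤ, ∀ k : ℕ, 1 ≤ k → y ∈ IsGap a b → b - a = 2 * t + k * L + 1 →
      a ≤ i → i < b → B (overwrite L W t v v' y x i) (overwrite L W t v v' y x (i + 1)) := by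
    intro i a b k hk hab hkab hai hib
    have e3 : ((k * L : ℕ) : ℤ) = k * L := by push_cast; rfl
    obtain ⟨s, rfl⟩ : ∃ s : ℕ, i = a + s := ⟨(i - a).toNat, by omega⟩
    have hkL : 1 ≤ k * L := Nat.mul_pos hk hL
    by_cases hs : s + 1 ≤ t + k * L
    · have := overwrite_entry (v := v) (v' := v') (x := x) hW hy hab hkab hs
      push_cast at this
      rw [overwrite_entry hW hy hab hkab (by omega), add_assoc, this]
      exact hentry a s
    · obtain ⟨e, rfl⟩ : ∃ e, s = t + 1 + e := ⟨s - (t + 1), by omega⟩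
      have h1 := overwrite_exit (v := v) (v' := v') (x := x) hW hy hab hkab (e := e) (by omega)
      have h2 := overwrite_exit (v := v) (v' := v') (x := x) hW hy hab hkab (e := e + 1) (by omega)
      have e1 : a + ((t + 1 + e : ℕ) : ℤ) = a + t + 1 + e := by push_cast; ring
      have e2 : a + t + 1 + (e : ℤ) + 1 = a + t + 1 + ((e + 1 : ℕ) : ℤ) := by push_cast; ring
      rw [e1, h1, e2, h2]
      exact hexit b k hk e (by omega) (by omega)
  intro i
  cases h1 : y i with
  | false =>
    obtain ⟨a, b, ha, hb, hab, k, hk, hkab⟩ := mem_goodSet_iff.1 hy _ h1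
    exact key i a b k hk hab hkab ha.le hb
  | true =>
    cases h2 : y (i + 1) with
    | true =>
      rw [overwrite_of_true h1, overwrite_of_true h2]
      exact hx i
    | false =>
      obtain ⟨a, b, ha, hb, hab, k, hk, hkab⟩ := mem_goodSet_iff.1 hy _ h2
      exact key i a b k hk hab hkab (by omega) (by omega)

/-- Inside a long string of zeros, the overwritten sequence follows `W` for a long time. -/
lemma overwrite_run (hW : ∀ j, W (j + L) = W j) {y : ℤ → Bool} {x : ℤ → β} {k q : ℕ}
    (hy : y ∈ goodSet t L)
    (hab : y ∈ IsGap (-((t + 1 + q * L : ℕ) : ℤ)) ((2 * t + k * L + 1 : ℕ) - (t + 1 + q * L : ℕ)))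
    {i : ℕ} (hi : i + q * L < k * L) :
    overwrite L W t v v' y x i = W i := by
  have hper : W (i + q * L) = W i := by
    have := Function.Periodic.nat_mul (f := W) hW q i
    simpa using this
  have h := overwrite_entry (v := v) (v' := v') (x := x) hW hy hab (k := k) (by push_cast; ring)
    (s := t + 1 + q * L + i) (by omega)
  have e : -((t + 1 + q * L : ℕ) : ℤ) + ((t + 1 + q * L + i : ℕ) : ℤ) = i := by push_cast; ring
  rw [e] at h
  rw [h, entrySeq, if_neg (by omega), dif_neg (by omega), ← hper]
  congr 1
  omega

end Overwrite

/-! ### The measures of the construction -/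

section Construction

variable {α : Type*} {A : α → α → Prop} {n : ℕ} [NeZero n] {w : ℕ → α} {L t : ℕ}
  {v v' : (Fin n → α) → Fin t → Fin n → α}

lemma blockWord_add (hwN : ∀ i, w (i + L * n) = w i) (j : ℕ) :
    blockWord n w (j + L) = blockWord n w j := by
  funext i
  simp only [blockWord]
  rw [← hwN (j * n + i)]
  congr 1; ring

lemma IsAdmissibleVector.apply_zero {p : PMF ℕ} (hp : IsAdmissibleVector t L p) : p 0 = 0 := by
  by_contra h
  rcases hp 0 h with h | ⟨k, -, h⟩ <;> omega

variable [MeasurableSpace α] [Finite α] [DiscreteMeasurableSpace α]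

/-- The standing assumptions of the construction. -/
structure Setup (A : α → α → Prop) (n : ℕ) [NeZero n] (w : ℕ → α) (L t : ℕ)
    (v v' : (Fin n → α) → Fin t → Fin n → α) (ν : Measure (ℤ → α)) (p : PMF ℕ) : Prop where
  transitive : IsTransitive A
  period : IsPeriod A n
  adj : ∀ i, A (w i) (w (i + 1))
  periodic : ∀ i, w (i + L * n) = w i
  pos : 0 < L
  connector : IsConnector (blockAdj A n (w 0)) {u | IsBlockSymbol A n (w 0) u} L (blockWord n w) t
    v v'
  erg : ErgMeasure A ν
  admissible : IsAdmissibleVector t L p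
  summable : Summable fun k : ℕ => (k : ℝ) * (p k).toReal

namespace Setup

variable {ν : Measure (ℤ → α)} {p : PMF ℕ}

/-- The map whose image measure is the joining. -/
def pairMap (n : ℕ) (w : ℕ → α) (L t : ℕ) (v v' : (Fin n → α) → Fin t → Fin n → α)
    (q : (ℤ → Fin n → α) × (ℤ → Bool)) : (ℤ → Fin n → α) × (ℤ → Fin n → α) :=
  (q.1, overwrite L (blockWord n w) t v v' q.2 q.1)

omit [NeZero n] in
lemma measurable_pairMap : Measurable (pairMap n w L t v v') :=
  measurable_fst.prodMk measurable_overwrite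

omit [NeZero n] [MeasurableSpace α] [Finite α] [DiscreteMeasurableSpace α] in
lemma pairMap_shift (q : (ℤ → Fin n → α) × (ℤ → Bool)) :
    pairMap n w L t v v' (Prod.map shift shift q) =
      Prod.map shift shift (pairMap n w L t v v' q) := by
  simp [pairMap, overwrite_shift]

variable (S : Setup A n w L t v v' ν p)
include S

lemma isProbabilityMeasure_blocks : IsProbabilityMeasure (toBlocks A n (w 0) ν) := by
  obtain ⟨r, hr, -, hcl, -⟩ := exists_residue S.transitive S.period (w 0)
  exact isProbabilityMeasure_toBlocks hr hcl S.erg.1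

lemma ergodic_blocks : Ergodic shift (toBlocks A n (w 0) ν) := by
  obtain ⟨r, hr, -, hcl, -⟩ := exists_residue S.transitive S.period (w 0)
  exact ergodic_toBlocks hr hcl S.erg

lemma ae_blocks : ∀ᵐ x ∂toBlocks A n (w 0) ν, x ∈ SFT (blockAdj A n (w 0)) := by
  obtain ⟨r, hr, -, hcl, -⟩ := exists_residue S.transitive S.period (w 0)
  exact ae_mem_SFT_toBlocks hr hcl

lemma fromBlocks_blocks : fromBlocks n (toBlocks A n (w 0) ν) = ν := by
  obtain ⟨r, hr, -, hcl, -⟩ := exists_residue S.transitive S.period (w 0)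
  exact fromBlocks_toBlocks hr hcl S.erg.1

lemma isProbabilityMeasure_renewal : IsProbabilityMeasure (renewalMeasure p) :=
  isProbabilityMeasure_renewalMeasure S.summable S.admissible.apply_zero

lemma measurePreserving_prod :
    MeasurePreserving (Prod.map shift shift) ((toBlocks A n (w 0) ν).prod (renewalMeasure p))
      ((toBlocks A n (w 0) ν).prod (renewalMeasure p)) := by
  have := S.isProbabilityMeasure_blocks
  have := S.isProbabilityMeasure_renewal
  exact S.ergodic_blocks.toMeasurePreserving.prod
    (measurePreserving_shift_renewalMeasure S.admissible.apply_zero)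

lemma isProbabilityMeasure_joint : IsProbabilityMeasure (jointMeasure A n w L t v v' ν p) := by
  have := S.isProbabilityMeasure_blocks
  have := S.isProbabilityMeasure_renewal
  exact Measure.isProbabilityMeasure_map measurable_pairMap.aemeasurable

lemma measurePreserving_joint :
    MeasurePreserving (Prod.map shift shift) (jointMeasure A n w L t v v' ν p)
      (jointMeasure A n w L t v v' ν p) := by
  have hm : Measurable (Prod.map shift shift :
    (ℤ → Fin n → α) × (ℤ → Fin n → α) → (ℤ → Fin n → α) × (ℤ → Fin n → α)) :=
    measurable_shift.prodMap measurable_shift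
  refine ⟨hm, ?_⟩
  change (Measure.map (pairMap n w L t v v') _).map _ = Measure.map (pairMap n w L t v v') _
  conv_rhs => rw [← S.measurePreserving_prod.map_eq]
  rw [Measure.map_map hm measurable_pairMap,
    Measure.map_map measurable_pairMap S.measurePreserving_prod.measurable]
  congr 1
  funext q
  exact (pairMap_shift q).symm

omit S in
lemma joint_map_snd : (jointMeasure A n w L t v v' ν p).map Prod.snd =
    ((toBlocks A n (w 0) ν).prod (renewalMeasure p)).map
      fun q => overwrite L (blockWord n w) t v v' q.2 q.1 :=
  Measure.map_map measurable_snd measurable_pairMap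

lemma joint_map_fst : (jointMeasure A n w L t v v' ν p).map Prod.fst = toBlocks A n (w 0) ν := by
  have := S.isProbabilityMeasure_renewal
  refine (Measure.map_map measurable_fst measurable_pairMap).trans ?_
  change Measure.map Prod.fst _ = _
  rw [Measure.map_fst_prod]
  simp

lemma measurePreserving_second : MeasurePreserving shift
    ((jointMeasure A n w L t v v' ν p).map Prod.snd)
    ((jointMeasure A n w L t v v' ν p).map Prod.snd) := by
  refine ⟨measurable_shift, ?_⟩
  conv_rhs => rw [← S.measurePreserving_joint.map_eq]
  rw [Measure.map_map measurable_shift measurable_snd,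
    Measure.map_map measurable_snd S.measurePreserving_joint.measurable]
  rfl

lemma isProbabilityMeasure_second :
    IsProbabilityMeasure ((jointMeasure A n w L t v v' ν p).map Prod.snd) := by
  have := S.isProbabilityMeasure_joint
  exact Measure.isProbabilityMeasure_map measurable_snd.aemeasurable

lemma blockAdj_word (j : ℕ) :
    blockAdj A n (w 0) (blockWord n w j) (blockWord n w (j + 1)) := by
  obtain ⟨r, hr, hr0, hcl, -⟩ := exists_residue S.transitive S.period (w 0)
  exact blockAdj_blockWord (T := j + 2) hr hcl (fun m _ => S.adj m) hr0 j (by omega)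

lemma ae_second : ∀ᵐ x ∂(jointMeasure A n w L t v v' ν p).map Prod.snd,
    x ∈ SFT (blockAdj A n (w 0)) := by
  have := S.isProbabilityMeasure_renewal
  rw [joint_map_snd]
  refine (ae_map_iff (p := fun x => x ∈ SFT (blockAdj A n (w 0)))
    measurable_overwrite.aemeasurable (measurableSet_SFT _)).2 ?_
  filter_upwards [Measure.quasiMeasurePreserving_fst.ae S.ae_blocks] with q hq
  exact overwrite_mem_SFT (fun _ _ h => h.1) S.pos (blockWord_add S.periodic) S.blockAdj_word
    S.connector q.2 hq

theorem invMeasure : InvMeasure A (constructionA A n w L t v v' ν p) := by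
  have := S.isProbabilityMeasure_second
  exact invMeasure_fromBlocks S.measurePreserving_second S.ae_second

/-- The overwritten block measure is a factor of the ergodic product, and unblocking with averaging
keeps ergodicity. -/
theorem ergMeasure (hgcd : ∀ d : ℕ, (∀ k, p k ≠ 0 → d ∣ k) → d = 1) :
    ErgMeasure A (constructionA A n w L t v v' ν p) := by
  have := S.isProbabilityMeasure_blocks
  refine ⟨S.invMeasure, ergodic_fromBlocks ?_⟩
  have herg := ergodic_prod_renewalMeasure S.ergodic_blocks S.summable S.admissible.apply_zero hgcd
  refine ergodic_of_measure_eq_zero S.measurePreserving_second fun U hU hTU => ?_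
  have hm : Measurable fun q : (ℤ → Fin n → α) × (ℤ → Bool) =>
    overwrite L (blockWord n w) t v v' q.2 q.1 := measurable_overwrite
  rw [joint_map_snd, Measure.map_apply hm hU, Measure.map_apply hm hU.compl]
  refine measure_zero_or_of_ergodic herg (hm hU).nullMeasurableSet (Filter.EventuallyEq.of_eq ?_)
  ext q
  change overwrite L (blockWord n w) t v v' (shift q.2) (shift q.1) ∈ U ↔ _
  rw [overwrite_shift]
  exact Set.ext_iff.1 hTU _

theorem eq_of_pure (hp : p = PMF.pure 1) : constructionA A n w L t v v' ν p = ν := by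
  have := S.isProbabilityMeasure_blocks
  have hprob := S.isProbabilityMeasure_renewal
  have h : (jointMeasure A n w L t v v' ν p).map Prod.snd = toBlocks A n (w 0) ν := by
    rw [joint_map_snd]
    have hae : (fun q : (ℤ → Fin n → α) × (ℤ → Bool) =>
        overwrite L (blockWord n w) t v v' q.2 q.1) =ᵐ[(toBlocks A n (w 0) ν).prod
          (renewalMeasure p)] Prod.fst := by
      have h1 : ∀ᵐ y ∂renewalMeasure p, ∀ i, y i = true := by
        rw [hp]; exact ae_renewalMeasure_pure
      filter_upwards [Measure.quasiMeasurePreserving_snd.ae h1] with q hq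
      funext i
      exact overwrite_of_true (hq i)
    rw [Measure.map_congr hae, Measure.map_fst_prod]
    simp
  rw [constructionA, h]
  exact S.fromBlocks_blocks

/-- The cyclic average of the unblocked joint measure is an explicit joining, and each of its `n`
terms is bounded separately. -/
theorem dbar_le : dbar ν (constructionA A n w L t v v' ν p) ≤
    ENNReal.ofReal ((mean p - 1) / mean p) := by
  have := S.isProbabilityMeasure_joint
  have := S.isProbabilityMeasure_blocks
  have := S.isProbabilityMeasure_renewal
  set T : (ℤ → α) × (ℤ → α) → (ℤ → α) × (ℤ → α) := Prod.map shift shift with hT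
  set U : (ℤ → Fin n → α) × (ℤ → Fin n → α) → (ℤ → α) × (ℤ → α) :=
    Prod.map (unblock n) (unblock n) with hU
  have hTm : Measurable T := measurable_shift.prodMap measurable_shift
  have hUm : Measurable U := measurable_unblock.prodMap measurable_unblock
  have hiter : ∀ i, T^[i] = Prod.map shift^[i] shift^[i] := fun i => Prod.map_iterate _ _ _
  have hUT : ∀ q, U (Prod.map shift shift q) = T^[n] (U q) := fun q => by
    rw [hiter]
    exact Prod.ext (unblock_shift q.1) (unblock_shift q.2)
  set J := jointMeasure A n w L t v v' ν p with hJ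
  have : IsProbabilityMeasure (J.map U) := Measure.isProbabilityMeasure_map hUm.aemeasurable
  have hinv : (J.map U).map T^[n] = J.map U := by
    conv_rhs => rw [hJ, ← S.measurePreserving_joint.map_eq]
    rw [Measure.map_map (hTm.iterate n) hUm,
      Measure.map_map hUm S.measurePreserving_joint.measurable]
    congr 1; funext q; exact (hUT q).symm
  set D : Set ((ℤ → α) × (ℤ → α)) := {q | q.1 1 ≠ q.2 1} with hD
  have hDm : MeasurableSet D := by
    have : D = (fun q : (ℤ → α) × (ℤ → α) => (q.1 1, q.2 1)) ⁻¹' {s | s.1 ≠ s.2} := rfl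
    rw [this]
    exact (((measurable_pi_apply 1).comp measurable_fst).prodMk
      ((measurable_pi_apply 1).comp measurable_snd)) MeasurableSet.of_discrete
  have hjoin : IsJoining ν (constructionA A n w L t v v' ν p) (cyclicAverage T n (J.map U)) := by
    refine ⟨isProbabilityMeasure_cyclicAverage hTm, measurePreserving_cyclicAverage hTm hinv, ?_, ?_⟩
    · rw [map_cyclicAverage hTm measurable_shift measurable_fst (fun _ => rfl),
        Measure.map_map measurable_fst hUm]
      conv_rhs => rw [← S.fromBlocks_blocks, ← S.joint_map_fst, fromBlocks_eq,
        Measure.map_map measurable_unblock measurable_fst]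
      rfl
    · rw [map_cyclicAverage hTm measurable_shift measurable_snd (fun _ => rfl),
        Measure.map_map measurable_snd hUm, constructionA, fromBlocks_eq,
        Measure.map_map measurable_unblock measurable_snd]
      rfl
  refine (iInf₂_le _ hjoin).trans ?_
  rw [cyclicAverage_apply hTm hDm]
  have hterm : ∀ i ∈ Finset.range n, (J.map U) (T^[i] ⁻¹' D) ≤
      ENNReal.ofReal ((mean p - 1) / mean p) := by
    intro i _
    obtain ⟨q, j, hj, hij⟩ := exists_eq_mul_add n (1 + (i : ℤ))
    rw [Measure.map_apply hUm (hTm.iterate i hDm)]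
    change (Measure.map (pairMap n w L t v v') _) _ ≤ _
    rw [Measure.map_apply measurable_pairMap (hUm (hTm.iterate i hDm))]
    -- Position `1 + i` lies in block `q`, and a block is altered only where `y` vanishes.
    refine le_trans (measure_mono (t := Prod.snd ⁻¹' {y : ℤ → Bool | y q = false}) ?_) ?_
    · rintro ⟨x, y⟩ hxy
      change (T^[i] (U (pairMap n w L t v v' (x, y)))) ∈ D at hxy
      rw [hiter] at hxy
      simp only [hU, pairMap, hD, Prod.map, Set.mem_ofPred_eq, shift_iterate, hij] at hxy
      rw [unblock_mul_add _ _ _ hj, unblock_mul_add _ _ _ hj] at hxy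
      by_contra h
      have h' : y q = true := by simpa using h
      rw [overwrite_of_true h'] at hxy
      exact hxy rfl
    · rw [← Measure.map_apply measurable_snd (measurableSet_coord q false), Measure.map_snd_prod]
      simpa using renewalMeasure_coord_false S.summable S.admissible.apply_zero q
  calc (n : ℝ≥0∞)⁻¹ * ∑ i ∈ Finset.range n, (J.map U) (T^[i] ⁻¹' D)
      ≤ (n : ℝ≥0∞)⁻¹ * ∑ i ∈ Finset.range n, ENNReal.ofReal ((mean p - 1) / mean p) := by
        gcongr with i hi
        exact hterm i hi
    _ = ENNReal.ofReal ((mean p - 1) / mean p) := by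
        rw [Finset.sum_const, Finset.card_range, nsmul_eq_mul, ← mul_assoc,
          ENNReal.inv_mul_cancel (by simp [NeZero.ne n]) (by simp), one_mul]

end Setup

/-! ### Long repetitions of the word -/

/-- The sequences which follow `w` in the positions `0, …, m - 1`. -/
def prefixSet (w : ℕ → α) (m : ℕ) : Set (ℤ → α) := {x | ∀ i : ℕ, i < m → x i = w i}

omit [Finite α] in
lemma measurableSet_prefixSet (w : ℕ → α) (m : ℕ) : MeasurableSet (prefixSet w m) := by
  have : prefixSet w m = ⋂ (i : ℕ) (_ : i < m), (fun x : ℤ → α => x i) ⁻¹' {w i} := by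
    ext x; simp [prefixSet]
  rw [this]
  exact MeasurableSet.iInter fun i => MeasurableSet.iInter fun _ =>
    (measurable_pi_apply _) MeasurableSet.of_discrete

/-- The good sequences for which the position `0` is at the beginning of at least `m` repetitions
of the block word. -/
def runSet (t L m : ℕ) : Set (ℤ → Bool) :=
  {y | y ∈ goodSet t L ∧ ∃ k q : ℕ, q + m ≤ k ∧
    y ∈ IsGap (-((t + 1 + q * L : ℕ) : ℤ)) ((2 * t + k * L + 1 : ℕ) - (t + 1 + q * L : ℕ))}

lemma measurableSet_runSet (t L m : ℕ) : MeasurableSet (runSet t L m) := by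
  have : runSet t L m = goodSet t L ∩ ⋃ (k : ℕ) (q : ℕ) (_ : q + m ≤ k),
      IsGap (-((t + 1 + q * L : ℕ) : ℤ)) ((2 * t + k * L + 1 : ℕ) - (t + 1 + q * L : ℕ)) := by
    ext y; simp [runSet]
  rw [this]
  exact (measurableSet_goodSet t L).inter (MeasurableSet.iUnion fun k => MeasurableSet.iUnion fun q =>
    MeasurableSet.iUnion fun _ => measurableSet_isGap _ _)

variable {ν : Measure (ℤ → α)} {p : PMF ℕ}

/-- Only the unshifted term of the cyclic average is kept, which costs the factor 1/n. On it, a run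
of `m` copies of the block word unblocks to `m * (L * n)` letters of `w`, whatever the original
sequence is. -/
lemma Setup.le_prefixSet (S : Setup A n w L t v v' ν p) (m : ℕ) :
    (n : ℝ≥0∞)⁻¹ * renewalMeasure p (runSet t L m) ≤
      constructionA A n w L t v v' ν p (prefixSet w (m * (L * n))) := by
  have := S.isProbabilityMeasure_blocks
  have := S.isProbabilityMeasure_renewal
  have hP := measurableSet_prefixSet w (m * (L * n))
  rw [constructionA, fromBlocks_eq, cyclicAverage_apply measurable_shift hP]
  gcongr
  refine le_trans ?_ (Finset.single_le_sum (fun _ _ => zero_le)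
    (Finset.mem_range.2 (NeZero.pos n)))
  rw [Function.iterate_zero, Set.preimage_id, Measure.map_apply measurable_unblock hP,
    Setup.joint_map_snd, Measure.map_apply measurable_overwrite (measurable_unblock hP)]
  have h1 : renewalMeasure p (runSet t L m) =
      ((toBlocks A n (w 0) ν).prod (renewalMeasure p)) (Prod.snd ⁻¹' runSet t L m) := by
    rw [← Measure.map_apply measurable_snd (measurableSet_runSet t L m), Measure.map_snd_prod]
    simp
  rw [h1]
  refine measure_mono ?_
  rintro ⟨x, y⟩ ⟨hy, k, q, hqk, hgap⟩ i hi
  change unblock n (overwrite L (blockWord n w) t v v' y x) (i : ℤ) = w i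
  have hj : i % n < n := Nat.mod_lt _ (NeZero.pos n)
  have hi' : (i : ℤ) = ((i / n : ℕ) : ℤ) * n + (i % n : ℕ) := by
    exact_mod_cast (Nat.div_add_mod' i n).symm
  have hdiv : i / n < m * L := by
    rw [Nat.div_lt_iff_lt_mul (NeZero.pos n)]
    linarith
  rw [hi', unblock_mul_add _ _ _ hj, overwrite_run (blockWord_add S.periodic) hy hgap]
  · simp only [blockWord]
    rw [Nat.div_add_mod']
  · have : (q + m) * L ≤ k * L := Nat.mul_le_mul_right _ hqk
    nlinarith

/-- The copies of the word in the first gap start at the levels `t + 1 + q * L` with `q < j`, and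
the one at `q` has `j - q` copies ahead. The sum of these numbers is at least j²/2. -/
lemma tsum_runSet_ge {x : ℤ → ℕ} (hx : ∀ i, x i ≠ 0) (hxg : eta x ∈ goodSet t L) (hL : 0 < L)
    {j : ℕ} (hj : x 0 = 2 * t + j * L + 1) :
    ((j : ℝ≥0∞) * j) / 2 ≤ ∑ m ∈ Finset.range (x 0), ∑' K : ℕ,
      (runSet t L (K + 1)).indicator (1 : (ℤ → Bool) → ℝ≥0∞) (shift^[m] (eta x)) := by
  have hinj : Set.InjOn (fun q => t + 1 + q * L) (Finset.range j : Set ℕ) := by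
    intro a _ b _ h
    have h' : a * L = b * L := by simpa using h
    exact Nat.eq_of_mul_eq_mul_right hL h'
  have hsub : (Finset.range j).image (fun q => t + 1 + q * L) ⊆ Finset.range (x 0) := by
    intro m hm
    obtain ⟨q, hq, rfl⟩ := Finset.mem_image.1 hm
    have hq := Finset.mem_range.1 hq
    have : (q + 1) * L ≤ j * L := Nat.mul_le_mul_right _ hq
    rw [Finset.mem_range, hj]
    nlinarith
  refine le_trans ?_ (Finset.sum_le_sum_of_subset hsub)
  rw [Finset.sum_image hinj]
  have hterm : ∀ q ∈ Finset.range j, ((j - q : ℕ) : ℝ≥0∞) ≤ ∑' K : ℕ,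
      (runSet t L (K + 1)).indicator (1 : (ℤ → Bool) → ℝ≥0∞)
        (shift^[t + 1 + q * L] (eta x)) := by
    intro q hq
    refine le_trans (le_of_eq ?_) (ENNReal.sum_le_tsum (Finset.range (j - q)))
    rw [Finset.sum_congr rfl (g := fun _ => (1 : ℝ≥0∞))]
    · simp
    · intro K hK
      have hK := Finset.mem_range.1 hK
      refine Set.indicator_of_mem ?_ _
      refine ⟨?_, j, q, by omega, ?_⟩
      · rw [shift_iterate_eq, zshift_mem_goodSet]; exact hxg
      · have hg : eta x ∈ IsGap 0 (x 0) :=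
          ⟨eta_zero x, eta_apply_zero x, fun i h1 h2 => eta_lt_apply_zero hx h1 h2⟩
        have := zshift_mem_isGap hg ((t + 1 + q * L : ℕ) : ℤ)
        rw [zero_sub, hj] at this
        rw [shift_iterate_eq]
        exact this
  refine le_trans ?_ (Finset.sum_le_sum hterm)
  rw [← Nat.cast_sum]
  have hs : ∑ q ∈ Finset.range j, (j - q) = ∑ q ∈ Finset.range j, (q + 1) := by
    rw [← Finset.sum_range_reflect]
    refine Finset.sum_congr rfl fun q hq => ?_
    have := Finset.mem_range.1 hq
    omega
  have h2 : j * j ≤ (∑ q ∈ Finset.range j, (j - q)) * 2 := by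
    rw [hs, Finset.sum_add_distrib, add_mul, Finset.sum_range_id_mul_two]
    simp only [Finset.sum_const, Finset.card_range, smul_eq_mul, mul_one]
    rcases j with _ | j
    · simp
    · simp only [Nat.add_sub_cancel]; nlinarith
  rw [ENNReal.div_le_iff (by norm_num) (by norm_num)]
  exact_mod_cast h2

/-- The tail condition on the vector. -/
def HasCubicTail (t L : ℕ) (p : PMF ℕ) : Prop :=
  ∃ r : ℝ, 1 ≤ r ∧ ∃ K : ℕ, ∀ k : ℕ, K ≤ k → (∃ j, 1 ≤ j ∧ k = 2 * t + j * L + 1) →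
    r⁻¹ * ((k : ℝ) ^ 3)⁻¹ ≤ (p k).toReal ∧ (p k).toReal ≤ r * ((k : ℝ) ^ 3)⁻¹

/-- A quadratic weight against a cubic tail leaves the harmonic series. The upper bound in the tail
condition plays no role here. -/
lemma HasCubicTail.tsum_eq_top (h : HasCubicTail t L p) (hL : 0 < L) :
    ∑' j : ℕ, ((j : ℝ≥0∞) * j) / 2 * p (2 * t + j * L + 1) = ∞ := by
  obtain ⟨r, hr, K, hK⟩ := h
  by_contra hne
  have hs := ENNReal.summable_toReal hne
  set M : ℝ := 2 * t + L + 1 with hM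
  have hMpos : 0 < M := by positivity
  have hr0 : 0 < r := by linarith
  have hcmp : ∀ᶠ j : ℕ in atTop, ‖(r⁻¹ * (M ^ 3)⁻¹ / 2) * (j : ℝ)⁻¹‖ ≤
      (((j : ℝ≥0∞) * j) / 2 * p (2 * t + j * L + 1)).toReal := by
    filter_upwards [eventually_ge_atTop (max K 1)] with j hj
    have hj1 : 1 ≤ j := (le_max_right _ _).trans hj
    have hjK : K ≤ j := (le_max_left _ _).trans hj
    have hjL : j ≤ j * L := Nat.le_mul_of_pos_right _ hL
    have hk := (hK (2 * t + j * L + 1) (by omega) ⟨j, hj1, rfl⟩).1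
    have hjr : (1 : ℝ) ≤ j := by exact_mod_cast hj1
    have hkM : ((2 * t + j * L + 1 : ℕ) : ℝ) ≤ M * j := by
      push_cast
      rw [hM]
      have ht : (0 : ℝ) ≤ t := by positivity
      nlinarith
    have hkpos : (0 : ℝ) < ((2 * t + j * L + 1 : ℕ) : ℝ) := by positivity
    have hk3 : ((M * j) ^ 3)⁻¹ ≤ (((2 * t + j * L + 1 : ℕ) : ℝ) ^ 3)⁻¹ :=
      inv_anti₀ (by positivity) (pow_le_pow_left₀ hkpos.le hkM 3)
    rw [Real.norm_of_nonneg (by positivity), ENNReal.toReal_mul, ENNReal.toReal_div,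
      ENNReal.toReal_mul]
    simp only [ENNReal.toReal_natCast, ENNReal.toReal_ofNat]
    calc r⁻¹ * (M ^ 3)⁻¹ / 2 * (j : ℝ)⁻¹ = (j : ℝ) * j / 2 * (r⁻¹ * ((M * j) ^ 3)⁻¹) := by
          field_simp
      _ ≤ (j : ℝ) * j / 2 * (p (2 * t + j * L + 1)).toReal := by
          gcongr
          exact le_trans (by gcongr) hk
  have hs2 : Summable fun j : ℕ => (r⁻¹ * (M ^ 3)⁻¹ / 2) * (j : ℝ)⁻¹ :=
    Summable.of_norm_bounded_eventually_nat hs hcmp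
  have hc : r⁻¹ * (M ^ 3)⁻¹ / 2 ≠ 0 := by positivity
  exact Real.not_summable_natCast_inv ((summable_mul_left_iff hc).1 hs2)

theorem Setup.tsum_prefixSet (S : Setup A n w L t v v' ν p) (h : HasCubicTail t L p) :
    ∑' K : ℕ, constructionA A n w L t v v' ν p (prefixSet w ((K + 1) * (L * n))) = ∞ := by
  have h0 := S.admissible.apply_zero
  have hE := one_le_mean S.summable h0
  have hmeas : ∀ K, Measurable ((runSet t L (K + 1)).indicator (1 : (ℤ → Bool) → ℝ≥0∞)) := fun K =>
    measurable_one.indicator (measurableSet_runSet t L (K + 1))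
  have hrun : ∑' K : ℕ, renewalMeasure p (runSet t L (K + 1)) = ∞ := by
    have h1 : ∑' K : ℕ, renewalMeasure p (runSet t L (K + 1)) = ∫⁻ y, ∑' K : ℕ,
        (runSet t L (K + 1)).indicator (1 : (ℤ → Bool) → ℝ≥0∞) y ∂renewalMeasure p := by
      rw [lintegral_tsum fun K => (hmeas K).aemeasurable]
      exact tsum_congr fun K => (lintegral_indicator_one (measurableSet_runSet t L (K + 1))).symm
    rw [h1, lintegral_renewalMeasure h0 (Measurable.tsum hmeas)]
    have hinj : Function.Injective fun j : ℕ => 2 * t + j * L + 1 := by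
      intro a b hab
      have h' : a * L = b * L := by simpa using hab
      exact Nat.eq_of_mul_eq_mul_right S.pos h'
    -- The lower bound as a function of the gap, extended by 0 to gaps of any other length.
    set F : ℕ → ℝ≥0∞ := Function.extend (fun j : ℕ => 2 * t + j * L + 1)
      (fun j => ((j : ℝ≥0∞) * j) / 2) 0 with hF
    have hle : ∫⁻ x, F (x 0) ∂bernoulli p ≤ ∫⁻ x, ∑ m ∈ Finset.range (x 0), ∑' K : ℕ,
        (runSet t L (K + 1)).indicator (1 : (ℤ → Bool) → ℝ≥0∞) (shift^[m] (eta x))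
        ∂bernoulli p := by
      refine lintegral_mono_ae ?_
      filter_upwards [ae_bernoulli_pos h0, ae_bernoulli_ne_zero p] with x hx hx'
      by_cases hj : ∃ j, 2 * t + j * L + 1 = x 0
      · obtain ⟨j, hj⟩ := hj
        rw [← hj, hF, hinj.extend_apply, hj]
        exact tsum_runSet_ge hx (eta_mem_goodSet S.admissible hx hx') S.pos hj.symm
      · rw [hF, Function.extend_apply' _ _ _ hj]
        exact zero_le
    have htop : ∫⁻ x, F (x 0) ∂bernoulli p = ∞ := by
      rw [lintegral_bernoulli_eval, ← top_le_iff, ← h.tsum_eq_top S.pos]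
      refine le_trans (le_of_eq (tsum_congr fun j => ?_))
        (ENNReal.tsum_comp_le_tsum_of_injective hinj _)
      simp only [hF, hinj.extend_apply]
    rw [htop, top_le_iff] at hle
    rw [hle]
    refine ENNReal.mul_top ?_
    simp only [ne_eq, ENNReal.ofReal_eq_zero, not_le]
    positivity
  have hle : (n : ℝ≥0∞)⁻¹ * ∑' K : ℕ, renewalMeasure p (runSet t L (K + 1)) ≤
      ∑' K : ℕ, constructionA A n w L t v v' ν p (prefixSet w ((K + 1) * (L * n))) := by
    rw [← ENNReal.tsum_mul_left]
    exact ENNReal.tsum_le_tsum fun K => S.le_prefixSet (K + 1)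
  rw [hrun, ENNReal.mul_top (by simp)] at hle
  exact top_le_iff.1 hle

/-- Prefix sets decrease, so a null one would leave only finitely many nonzero terms in a divergent
series of finite measures. -/
theorem Setup.prefixSet_pos (S : Setup A n w L t v v' ν p) (h : HasCubicTail t L p) (m : ℕ) :
    constructionA A n w L t v v' ν p (prefixSet w m) ≠ 0 := by
  intro h0
  have hprob := S.invMeasure.1
  have hz : ∀ K, m ≤ K → constructionA A n w L t v v' ν p (prefixSet w ((K + 1) * (L * n))) = 0 := by
    intro K hK
    have hLn : 0 < L * n := Nat.mul_pos S.pos (NeZero.pos n)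
    have hle : m ≤ (K + 1) * (L * n) := by nlinarith
    exact measure_mono_null (t := prefixSet w m) (fun x hx i hi => hx i (hi.trans_le hle)) h0
  have htop := S.tsum_prefixSet h
  rw [tsum_eq_sum (s := Finset.range m) fun K hK => hz K (by simpa using hK)] at htop
  exact ENNReal.sum_ne_top.2 (fun K _ => measure_ne_top _ _) htop

end Construction

namespace MarkovMap

variable {J : ℕ} (M : MarkovMap J)

/-! ### Cylinders of a Markov map -/

lemma pt_lt (j : Fin J) : M.pt j.castSucc < M.pt j.succ := M.pt_strictMono Fin.castSucc_lt_succ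

lemma isOpen_piece (j : Fin J) : IsOpen (M.piece j) := isOpen_Ioo

lemma piece_nonempty (j : Fin J) : (M.piece j).Nonempty := Set.nonempty_Ioo.2 (M.pt_lt j)

lemma eq_of_mem_piece {i j : Fin J} {x : I} (hi : x ∈ M.piece i) (hj : x ∈ M.piece j) : i = j := by
  have key : ∀ {i j : Fin J}, x ∈ M.piece i → x ∈ M.piece j → ¬ i < j := by
    intro i j hi hj hij
    have : M.pt i.succ ≤ M.pt j.castSucc := M.pt_strictMono.monotone (by
      rw [Fin.le_def]; simp; omega)
    exact absurd (hi.2.trans_le (this.trans hj.1.le)) (lt_irrefl x)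
  exact le_antisymm (not_lt.1 (key hj hi)) (not_lt.1 (key hi hj))

lemma pt_notMem_piece (i : Fin (J + 1)) (j : Fin J) : M.pt i ∉ M.piece j := by
  rintro ⟨h1, h2⟩
  rw [M.pt_strictMono.lt_iff_lt, Fin.lt_def] at h1 h2
  simp at h1 h2
  omega

lemma realLift_coe (x : I) : realLift M.f x = M.f x := by
  simp [realLift, Set.projIcc_val]

lemma continuousOn_piece (j : Fin J) : ContinuousOn M.f (M.piece j) := by
  rw [Topology.IsInducing.subtypeVal.continuousOn_iff]
  have h : ContinuousOn (fun x : I => realLift M.f x) (M.piece j) :=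
    (M.contDiffOn j).continuousOn.comp continuous_subtype_val.continuousOn
      fun x hx => ⟨hx.1, hx.2⟩
  exact h.congr fun x _ => (M.realLift_coe x).symm

lemma continuousAt_of_mem {j : Fin J} {x : I} (hx : x ∈ M.piece j) : ContinuousAt M.f x :=
  (M.continuousOn_piece j).continuousAt ((M.isOpen_piece j).mem_nhds hx)

/-- The map expands distances on the partition intervals. -/
lemma exists_expansion : ∃ χ : ℝ, 1 < χ ∧ ∀ j, ∀ x ∈ M.piece j, ∀ y ∈ M.piece j,
    χ * dist x y ≤ dist (M.f x) (M.f y) := by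
  obtain ⟨χ, hχ, h⟩ := M.expanding
  refine ⟨χ, hχ, fun j => ?_⟩
  have key : ∀ x ∈ M.piece j, ∀ y ∈ M.piece j, x < y → χ * dist x y ≤ dist (M.f x) (M.f y) := by
    intro x hx y hy hxy
    have hsub : Set.Icc (x : ℝ) y ⊆ Set.Ioo (M.pt j.castSucc : ℝ) (M.pt j.succ) :=
      Set.Icc_subset_Ioo hx.1 hy.2
    have hxy' : (x : ℝ) < y := hxy
    obtain ⟨ξ, hξ, hslope⟩ := exists_deriv_eq_slope (realLift M.f) hxy'
      ((M.contDiffOn j).continuousOn.mono hsub)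
      (((M.contDiffOn j).differentiableOn (by norm_num)).mono
        (Set.Ioo_subset_Icc_self.trans hsub))
    have hd := h j ξ (hsub (Set.Ioo_subset_Icc_self hξ))
    rw [hslope, M.realLift_coe, M.realLift_coe, abs_div, abs_of_pos (sub_pos.2 hxy'),
      le_div_iff₀ (sub_pos.2 hxy')] at hd
    rw [dist_comm x y, dist_comm (M.f x), Subtype.dist_eq, Subtype.dist_eq, Real.dist_eq,
      Real.dist_eq, abs_of_pos (sub_pos.2 hxy')]
    exact hd
  intro x hx y hy
  rcases lt_trichotomy x y with hxy | rfl | hxy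
  · exact key x hx y hy hxy
  · simp
  · rw [dist_comm, dist_comm (M.f x)]; exact key y hy x hx hxy

lemma monotone_piece (j : Fin J) :
    StrictMonoOn M.f (M.piece j) ∨ StrictAntiOn M.f (M.piece j) := by
  obtain ⟨χ, hχ, h⟩ := M.exists_expansion
  refine ContinuousOn.strictMonoOn_of_injOn_Ioo (M.pt_lt j) (M.continuousOn_piece j) ?_
  intro x hx y hy hxy
  have := h j x hx y hy
  rw [hxy, dist_self] at this
  have hd : dist x y ≤ 0 := by
    by_contra hlt
    push Not at hlt
    nlinarith
  exact dist_le_zero.1 hd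

/-- Admissible one-sided sequences. -/
def Admissible (ω : ℕ → Fin J) : Prop := ∀ i, M.adj (ω i) (ω (i + 1))

variable {M} in
lemma Admissible.add {ω : ℕ → Fin J} (h : M.Admissible ω) (k : ℕ) :
    M.Admissible fun i => ω (i + k) := fun i => by
  have := h (i + k)
  rwa [add_right_comm] at this

lemma cylinder_zero (ω : ℕ → Fin J) : M.cylinder ω 0 = Set.univ := by ext; simp [cylinder]

lemma cylinder_succ (ω : ℕ → Fin J) (k : ℕ) :
    M.cylinder ω (k + 1) = M.piece (ω 0) ∩ M.f ⁻¹' M.cylinder (fun i => ω (i + 1)) k := by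
  ext x
  simp only [cylinder, Set.mem_ofPred_eq, Set.mem_inter_iff, Set.mem_preimage]
  constructor
  · intro h
    exact ⟨h 0 (by omega), fun i hi => h (i + 1) (by omega)⟩
  · rintro ⟨h0, h⟩ i hi
    rcases i with _ | i
    · exact h0
    · exact h i (by omega)

lemma cylinder_anti (ω : ℕ → Fin J) {k l : ℕ} (h : k ≤ l) : M.cylinder ω l ⊆ M.cylinder ω k :=
  fun _ hx i hi => hx i (hi.trans_le h)

lemma cylinder_congr {ω ω' : ℕ → Fin J} {k : ℕ} (h : ∀ i < k, ω i = ω' i) :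
    M.cylinder ω k = M.cylinder ω' k := by
  ext x
  exact forall₂_congr fun i hi => by rw [h i hi]

lemma cylinder_nonempty_aux (k : ℕ) : ∀ {ω : ℕ → Fin J}, M.Admissible ω →
    (M.cylinder ω (k + 1)).Nonempty := by
  induction k with
  | zero =>
    intro ω _
    rw [cylinder_succ, cylinder_zero]
    simpa using M.piece_nonempty _
  | succ k ih =>
    intro ω hω
    obtain ⟨y, hy⟩ := ih (hω.add 1)
    have hy0 : y ∈ M.piece (ω 1) := hy 0 (by omega)
    obtain ⟨x, hx, rfl⟩ := hω 0 hy0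
    exact ⟨x, by rw [cylinder_succ]; exact ⟨hx, hy⟩⟩

lemma cylinder_nonempty {ω : ℕ → Fin J} (hω : M.Admissible ω) (k : ℕ) :
    (M.cylinder ω k).Nonempty :=
  (M.cylinder_nonempty_aux k hω).mono (M.cylinder_anti ω (Nat.le_succ k))

/-- Each branch is monotone, so intervals pull back to intervals within a partition piece. -/
lemma ordConnected_cylinder (k : ℕ) : ∀ ω : ℕ → Fin J, (M.cylinder ω k).OrdConnected := by
  induction k with
  | zero => intro ω; rw [cylinder_zero]; exact Set.ordConnected_univ
  | succ k ih =>
    intro ω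
    rw [cylinder_succ]
    refine ⟨fun x hx y hy z hz => ?_⟩
    have hzp : z ∈ M.piece (ω 0) := ⟨hx.1.1.trans_le hz.1, hz.2.trans_lt hy.1.2⟩
    refine ⟨hzp, ?_⟩
    rcases M.monotone_piece (ω 0) with h | h
    · exact (ih _).out hx.2 hy.2 ⟨h.monotoneOn hx.1 hzp hz.1, h.monotoneOn hzp hy.1 hz.2⟩
    · exact (ih _).out hy.2 hx.2 ⟨h.antitoneOn hzp hy.1 hz.2, h.antitoneOn hx.1 hzp hz.1⟩

/-- A uniform expansion constant. -/
def IsExpansion (χ : ℝ) : Prop := 1 < χ ∧ ∀ j, ∀ x ∈ M.piece j, ∀ y ∈ M.piece j,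
    χ * dist x y ≤ dist (M.f x) (M.f y)

variable {M}

lemma dist_cylinder {χ : ℝ} (hχ : M.IsExpansion χ) (k : ℕ) : ∀ {ω : ℕ → Fin J} {x y : I},
    x ∈ M.cylinder ω k → y ∈ M.cylinder ω k → χ ^ k * dist x y ≤ 1 := by
  have hpos : 0 < χ := by linarith [hχ.1]
  induction k with
  | zero =>
    intro ω x y _ _
    rw [pow_zero, one_mul, Subtype.dist_eq, Real.dist_eq, abs_le]
    constructor <;> linarith [x.2.1, x.2.2, y.2.1, y.2.2]
  | succ k ih =>
    intro ω x y hx hy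
    rw [cylinder_succ] at hx hy
    calc χ ^ (k + 1) * dist x y = χ ^ k * (χ * dist x y) := by ring
      _ ≤ χ ^ k * dist (M.f x) (M.f y) := by
        gcongr
        exact hχ.2 _ x hx.1 y hy.1
      _ ≤ 1 := ih hx.2 hy.2

lemma dist_closure_cylinder {χ : ℝ} (hχ : M.IsExpansion χ) {k : ℕ} {ω : ℕ → Fin J} {x y : I}
    (hx : x ∈ closure (M.cylinder ω k)) (hy : y ∈ closure (M.cylinder ω k)) :
    dist x y ≤ (χ ^ k)⁻¹ := by
  have hpos : 0 < χ ^ k := pow_pos (by linarith [hχ.1]) _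
  have h1 : Metric.diam (M.cylinder ω k) ≤ (χ ^ k)⁻¹ := by
    refine Metric.diam_le_of_forall_dist_le (by positivity) fun a ha b hb => ?_
    rw [← one_div, le_div_iff₀ hpos, mul_comm]
    exact dist_cylinder hχ k ha hb
  rw [← Metric.diam_closure] at h1
  exact (Metric.dist_le_diam_of_mem Metric.isBounded_of_compactSpace hx hy).trans h1

lemma eq_of_mem_closure_cylinder {ω : ℕ → Fin J} {x y : I}
    (hx : ∀ k, x ∈ closure (M.cylinder ω k)) (hy : ∀ k, y ∈ closure (M.cylinder ω k)) : x = y := by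
  obtain ⟨χ, hχ⟩ := M.exists_expansion
  have hχ : M.IsExpansion χ := hχ
  have h0 : Tendsto (fun k : ℕ => (χ ^ k)⁻¹) atTop (𝓝 0) := by
    simp only [← inv_pow]
    exact tendsto_pow_atTop_nhds_zero_of_lt_one (by linarith [inv_pos.2 (zero_lt_one.trans hχ.1)])
      (inv_lt_one_of_one_lt₀ hχ.1)
  exact dist_le_zero.1 (ge_of_tendsto' h0 fun k => dist_closure_cylinder hχ (hx k) (hy k))

lemma coding_mem {ω : ℕ → Fin J} (hω : M.Admissible ω) (k : ℕ) :
    M.coding ω ∈ closure (M.cylinder ω k) := by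
  have h : ∃ x, ∀ k, x ∈ closure (M.cylinder ω k) := by
    obtain ⟨x, hx⟩ := IsCompact.nonempty_iInter_of_sequence_nonempty_isCompact_isClosed
      (fun k => closure (M.cylinder ω k))
      (fun k => closure_mono (M.cylinder_anti ω (Nat.le_succ k)))
      (fun k => (M.cylinder_nonempty hω k).closure) isClosed_closure.isCompact
      (fun k => isClosed_closure)
    exact ⟨x, fun k => Set.mem_iInter.1 hx k⟩
  exact Classical.epsilon_spec h k

lemma coding_eq {ω : ℕ → Fin J} (hω : M.Admissible ω) {x : I}
    (hx : ∀ k, x ∈ closure (M.cylinder ω k)) : M.coding ω = x :=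
  eq_of_mem_closure_cylinder (coding_mem hω) hx

/-- Two admissible sequences which code the same point outside the interval of the first symbol
coincide as soon as their first symbols do. -/
lemma eq_of_coding_eq {ω ω' : ℕ → Fin J} (hω : M.Admissible ω) (hω' : M.Admissible ω') {a : I}
    (ha : M.coding ω = a) (ha' : M.coding ω' = a) (h0 : ω 0 = ω' 0) (hp : a ∉ M.piece (ω 0)) :
    ω = ω' := by
  by_contra hne
  obtain ⟨i, hi⟩ := Function.ne_iff.1 hne
  have hdisj : ∀ x, x ∈ M.cylinder ω (i + 1) → x ∉ M.cylinder ω' (i + 1) := fun x hx hx' =>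
    hi (M.eq_of_mem_piece (hx i (by omega)) (hx' i (by omega)))
  have hsub : M.cylinder ω (i + 1) ⊆ M.piece (ω 0) := fun x hx => hx 0 (by omega)
  have hsub' : M.cylinder ω' (i + 1) ⊆ M.piece (ω 0) := fun x hx => by
    rw [h0]; exact hx 0 (by omega)
  have hcl := coding_mem hω (i + 1)
  have hcl' := coding_mem hω' (i + 1)
  rw [ha] at hcl
  rw [ha'] at hcl'
  obtain ⟨x, hx⟩ := M.cylinder_nonempty hω (i + 1)
  -- The cylinders at the first disagreement are disjoint intervals, both accumulating at `a` from
  -- the same side. Points of the two then interleave, which is impossible.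
  have hside : a ≤ M.pt (ω 0).castSucc ∨ M.pt (ω 0).succ ≤ a := by
    by_contra! h
    exact hp h
  rcases hside with h | h
  · obtain ⟨y, hyx, hy⟩ := mem_closure_iff.1 hcl' (Set.Iio x) isOpen_Iio
      (h.trans_lt (hsub hx).1)
    obtain ⟨z, hzy, hz⟩ := mem_closure_iff.1 hcl (Set.Iio y) isOpen_Iio
      (h.trans_lt (hsub' hy).1)
    exact hdisj y ((M.ordConnected_cylinder _ ω).out hz hx ⟨le_of_lt hzy, le_of_lt hyx⟩) hy
  · obtain ⟨y, hyx, hy⟩ := mem_closure_iff.1 hcl' (Set.Ioi x) isOpen_Ioi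
      ((hsub hx).2.trans_le h)
    obtain ⟨z, hzy, hz⟩ := mem_closure_iff.1 hcl (Set.Ioi y) isOpen_Ioi
      ((hsub' hy).2.trans_le h)
    exact hdisj y ((M.ordConnected_cylinder _ ω).out hx hz ⟨le_of_lt hyx, le_of_lt hzy⟩) hy

/-- The semiconjugacy of the coding map at points of continuity. -/
lemma map_coding {ω : ℕ → Fin J} (hω : M.Admissible ω) (hp : M.coding ω ∉ Set.range M.pt) :
    M.f (M.coding ω) = M.coding fun i => ω (i + 1) := by
  have hmem : M.coding ω ∈ M.piece (ω 0) := by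
    have h1 := coding_mem hω 1
    rw [cylinder_succ, cylinder_zero, Set.preimage_univ, Set.inter_univ] at h1
    have h2 : M.coding ω ∈ Set.Icc (M.pt (ω 0).castSucc) (M.pt (ω 0).succ) :=
      closure_minimal Set.Ioo_subset_Icc_self isClosed_Icc h1
    exact ⟨lt_of_le_of_ne h2.1 fun h => hp ⟨_, h⟩, lt_of_le_of_ne h2.2 fun h => hp ⟨_, h.symm⟩⟩
  refine (coding_eq (hω.add 1) fun k => ?_).symm
  have h1 := mem_closure_image (M.continuousAt_of_mem hmem) (coding_mem hω (k + 1))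
  refine closure_mono ?_ h1
  rintro _ ⟨x, hx, rfl⟩
  rw [cylinder_succ] at hx
  exact hx.2

lemma measurable_f (M : MarkovMap J) : Measurable M.f := by
  refine measurable_of_isOpen fun U hU => ?_
  have hcover : ∀ x : I, x ∉ Set.range M.pt → ∃ j, x ∈ M.piece j := by
    intro x hx
    by_contra! hno
    have key : ∀ i : Fin (J + 1), M.pt i ≤ x := by
      intro i
      induction i using Fin.induction with
      | zero => rw [M.pt_zero]; exact x.2.1
      | succ i ih =>
        by_contra! h
        exact hno i ⟨lt_of_le_of_ne ih fun h => hx ⟨_, h⟩, h⟩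
    refine hx ⟨Fin.last J, le_antisymm (key _) ?_⟩
    rw [M.pt_last]; exact x.2.2
  have h : M.f ⁻¹' U = (⋃ j, (M.piece j ∩ M.f ⁻¹' U)) ∪ (Set.range M.pt ∩ M.f ⁻¹' U) := by
    ext x
    simp only [Set.mem_union, Set.mem_iUnion, Set.mem_inter_iff, Set.mem_preimage]
    constructor
    · intro hxU
      by_cases hx : x ∈ Set.range M.pt
      · exact Or.inr ⟨hx, hxU⟩
      · obtain ⟨j, hj⟩ := hcover x hx
        exact Or.inl ⟨j, hj, hxU⟩
    · rintro (⟨j, -, h⟩ | ⟨-, h⟩) <;> exact h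
  rw [h]
  refine (MeasurableSet.iUnion fun j => ?_).union ?_
  · exact ((M.continuousOn_piece j).isOpen_inter_preimage (M.isOpen_piece j) hU).measurableSet
  · exact ((Set.finite_range M.pt).subset Set.inter_subset_left).measurableSet

/-- The coordinates of index `≥ 0`. -/
def future {α : Type*} (x : ℤ → α) : ℕ → α := fun i => x i

lemma push_eq (M : MarkovMap J) (μ : Measure (ℤ → Fin J)) :
    M.push μ = μ.map fun x => M.coding (future x) := rfl

lemma admissible_future {x : ℤ → Fin J} (hx : x ∈ SFT M.adj) : M.Admissible (future x) := fun i => by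
  have := hx i
  simpa [future] using this

/-- On inadmissible sequences the coding is an arbitrary choice, so only almost everywhere
measurability is claimed. Choosing a point in each cylinder gives functions of finitely many
coordinates that converge by expansion. -/
lemma aemeasurable_coding {μ : Measure (ℤ → Fin J)} (hμ : ∀ᵐ x ∂μ, x ∈ SFT M.adj) :
    AEMeasurable (fun x => M.coding (future x)) μ := by
  obtain ⟨χ, hχ⟩ := M.exists_expansion
  have hχ : M.IsExpansion χ := hχ
  let G : ∀ k : ℕ, (Fin k → Fin J) → I := fun k u =>
    Classical.epsilon fun z => ∀ i : Fin k, M.f^[i] z ∈ M.piece (u i)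
  refine aemeasurable_of_tendsto_metrizable_ae atTop
    (f := fun k x => G k fun i : Fin k => x (i : ℕ)) (fun k => ?_) ?_
  · refine Measurable.aemeasurable ?_
    exact (Measurable.of_discrete (f := G k)).comp
      (measurable_pi_lambda _ fun i => measurable_pi_apply _)
  · filter_upwards [hμ] with x hx
    have hω := admissible_future hx
    have hG : ∀ k, G k (fun i : Fin k => x (i : ℕ)) ∈ M.cylinder (future x) k := by
      intro k
      obtain ⟨z, hz⟩ := M.cylinder_nonempty hω k
      have h : ∃ z, ∀ i : Fin k, M.f^[i] z ∈ M.piece (x (i : ℕ)) := ⟨z, fun i => hz i i.2⟩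
      have := Classical.epsilon_spec h
      exact fun i hi => this ⟨i, hi⟩
    rw [tendsto_iff_dist_tendsto_zero]
    have h0 : Tendsto (fun k : ℕ => (χ ^ k)⁻¹) atTop (𝓝 0) := by
      simp only [← inv_pow]
      exact tendsto_pow_atTop_nhds_zero_of_lt_one
        (by linarith [inv_pos.2 (zero_lt_one.trans hχ.1)]) (inv_lt_one_of_one_lt₀ hχ.1)
    exact squeeze_zero (fun _ => dist_nonneg)
      (fun k => dist_closure_cylinder hχ (subset_closure (hG k)) (coding_mem hω k)) h0

/-! ### The right itinerary of a right periodic point -/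

section Itinerary

variable {c : I} {N : ℕ} {w : ℕ → Fin J}

lemma IsRightPeriodic.neBot (hc : M.IsRightPeriodic c N) : NeBot (𝓝[>] c) := by
  obtain ⟨j, rfl⟩ := hc.1
  exact nhdsGT_neBot_of_exists_gt ⟨_, M.pt_lt j⟩

lemma IsRightPeriodic.pos (hc : M.IsRightPeriodic c N) : 0 < N := hc.2.1.1

lemma IsRightPeriodic.tendsto (hc : M.IsRightPeriodic c N) :
    Tendsto M.f^[N] (𝓝[>] c) (𝓝[>] c) := by
  obtain ⟨-, h1, δ, hδ, h2⟩ := hc.2.1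
  refine tendsto_nhdsWithin_iff.2 ⟨h1, ?_⟩
  have hlt : ∀ᶠ x : I in 𝓝[>] c, (x : ℝ) < c + δ := by
    refine eventually_nhdsWithin_of_eventually_nhds ?_
    exact (continuous_subtype_val.tendsto c).eventually (gt_mem_nhds (by linarith))
  filter_upwards [hlt, self_mem_nhdsWithin] with x hx hx'
  exact (h2 x hx' hx).1

lemma IsRightPeriodic.monoLength_pos (hc : M.IsRightPeriodic c N) : 0 < M.monoLength c := by
  have := hc.neBot
  obtain ⟨-, h1, δ, hδ, h2⟩ := hc.2.1
  have hlt : ∀ᶠ x : I in 𝓝[>] c, (x : ℝ) < c + δ := by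
    refine eventually_nhdsWithin_of_eventually_nhds ?_
    exact (continuous_subtype_val.tendsto c).eventually (gt_mem_nhds (by linarith))
  obtain ⟨x, hx, hx'⟩ := (hlt.and self_mem_nhdsWithin).exists
  have := h2 x hx' hx
  linarith [this.1, this.2]

lemma IsRightItinerary.eventually_cylinder (hw : M.IsRightItinerary c w) (i k : ℕ) :
    ∀ᶠ x in 𝓝[>] c, M.f^[i] x ∈ M.cylinder (fun l => w (l + i)) k := by
  have : ∀ᶠ x in 𝓝[>] c, ∀ l ∈ Finset.range k, M.f^[l + i] x ∈ M.piece (w (l + i)) :=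
    (Finset.eventually_all _).2 fun l _ => hw (l + i)
  filter_upwards [this] with x hx l hl
  rw [← Function.iterate_add_apply]
  exact hx l (Finset.mem_range.2 hl)

variable (hc : M.IsRightPeriodic c N) (hw : M.IsRightItinerary c w)
include hc hw

lemma IsRightItinerary.admissible : M.Admissible w := by
  intro i
  have := hc.neBot
  obtain ⟨x, hx, hx'⟩ := ((hw i).and (hw (i + 1))).exists
  refine (M.markov (w i) (w (i + 1))).resolve_right fun h => ?_
  rw [Function.iterate_succ_apply'] at hx'
  exact Set.disjoint_left.1 h hx' ⟨_, hx, rfl⟩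

lemma IsRightItinerary.periodic (i : ℕ) : w (i + N) = w i := by
  have := hc.neBot
  obtain ⟨x, hx, hx'⟩ := ((hw (i + N)).and (hc.tendsto.eventually (hw i))).exists
  rw [Function.iterate_add_apply] at hx
  exact M.eq_of_mem_piece hx hx'

lemma IsRightItinerary.coding_eq_of_tendsto {i : ℕ} {a : I}
    (h : Tendsto M.f^[i] (𝓝[>] c) (𝓝 a)) : M.coding (fun l => w (l + i)) = a := by
  have := hc.neBot
  exact coding_eq ((hw.admissible hc).add i) fun k =>
    mem_closure_of_tendsto h (hw.eventually_cylinder i k)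

lemma IsRightItinerary.coding_eq : M.coding w = c :=
  hw.coding_eq_of_tendsto hc (i := 0) (tendsto_id.mono_left nhdsWithin_le_nhds)

lemma IsRightItinerary.left_endpoint : c = M.pt (w 0).castSucc := by
  have := hc.neBot
  obtain ⟨j, rfl⟩ := hc.1
  have hlt : ∀ᶠ x : I in 𝓝[>] (M.pt j.castSucc), x < M.pt j.succ :=
    eventually_nhdsWithin_of_eventually_nhds (gt_mem_nhds (M.pt_lt j))
  obtain ⟨x, ⟨hx, hx'⟩, hx''⟩ := ((hlt.and self_mem_nhdsWithin).and (hw 0)).exists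
  rw [M.eq_of_mem_piece (show x ∈ M.piece j from ⟨hx', hx⟩) hx'']

/-- Sequences which follow the itinerary of `c` for a long time code points close to `c`, to the
right of `c`. -/
lemma IsRightItinerary.coding_near {χ : ℝ} (hχ : M.IsExpansion χ) {ω : ℕ → Fin J}
    (hω : M.Admissible ω) {m : ℕ} (hm : 0 < m) (h : ∀ i < m, ω i = w i) :
    (c : ℝ) ≤ M.coding ω ∧ (M.coding ω : ℝ) - c ≤ (χ ^ m)⁻¹ := by
  have h1 := coding_mem hω m
  rw [M.cylinder_congr h] at h1
  have h2 := coding_mem (hw.admissible hc) m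
  rw [hw.coding_eq hc] at h2
  constructor
  · have hsub : M.cylinder w m ⊆ Set.Ici c := fun x hx => by
      rw [hw.left_endpoint hc]
      exact (hx 0 hm).1.le
    exact closure_minimal hsub isClosed_Ici h1
  · have := dist_closure_cylinder hχ h1 h2
    rw [Subtype.dist_eq, Real.dist_eq] at this
    exact (le_abs_self _).trans this

end Itinerary

end MarkovMap

open MarkovMap

/-! ### Atoms of the one-sided projection of an ergodic measure -/

section Atoms

variable {α : Type*}

lemma future_shift_iterate (x : ℤ → α) (m : ℕ) :
    future (shift^[m] x) = fun k => future x (k + m) := by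
  funext k
  simp [future, shift_iterate]

variable [MeasurableSpace α] [MeasurableSingletonClass α]

lemma measurableSet_future (ω : ℕ → α) : MeasurableSet {x : ℤ → α | future x = ω} := by
  have : {x : ℤ → α | future x = ω} = ⋂ k : ℕ, (fun x : ℤ → α => x k) ⁻¹' {ω k} := by
    ext x; simp [funext_iff, future]
  rw [this]
  exact MeasurableSet.iInter fun k => (measurable_pi_apply _) (measurableSet_singleton _)

/-- If the projection of an ergodic measure to the one-sided sequences has an atom and gives
positive measure to all cylinders of a periodic sequence, then it is carried by the orbit of this
sequence. -/
lemma ae_orbit_of_atom {μ : Measure (ℤ → α)} [IsProbabilityMeasure μ] (hμ : Ergodic shift μ)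
    {ω w : ℕ → α} (hω : μ {x | future x = ω} ≠ 0) {N : ℕ} (hN : 0 < N)
    (hwN : ∀ i, w (i + N) = w i) (hw : ∀ m, μ (prefixSet w m) ≠ 0) :
    (∀ᵐ x ∂μ, ∃ i, future x = fun k => w (k + i)) ∧ μ {x | future x = w} ≠ 0 := by
  -- Poincaré recurrence: a future of positive mass returns to itself, hence is periodic.
  obtain ⟨x, hx, q, hq, hxq⟩ := hμ.toMeasurePreserving.conservative.exists_mem_iterate_mem
    (measurableSet_future ω).nullMeasurableSet hω
  have hper : ∀ k, ω (k + q) = ω k := by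
    intro k
    have h1 : future (shift^[q] x) = ω := hxq
    rw [future_shift_iterate, show future x = ω from hx] at h1
    exact congrFun h1 k
  set F : Set (ℤ → α) := {x | ∃ i : ℕ, future x = fun k => ω (k + i)} with hF
  have hFm : MeasurableSet F := by
    have : F = ⋃ i : ℕ, {x | future x = fun k => ω (k + i)} := by ext; simp [F]
    rw [this]
    exact MeasurableSet.iUnion fun i => measurableSet_future _
  have hF0 : μ F ≠ 0 := fun h => hω (measure_mono_null (t := F) (fun x hx => ⟨0, hx⟩) h)
  have hFull : ∀ᵐ x ∂μ, x ∈ F := by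
    have hsub : F ⊆ shift ⁻¹' F := by
      rintro x ⟨i, hi⟩
      refine ⟨i + 1, ?_⟩
      have := future_shift_iterate x 1
      rw [Function.iterate_one, hi] at this
      rw [this]
      funext k
      change ω (k + 1 + i) = ω (k + (i + 1))
      congr 1; omega
    rcases hμ.ae_empty_or_univ_of_ae_le_preimage' hFm.nullMeasurableSet
      hsub.eventuallyLE (measure_ne_top _ _) with h | h
    · exact absurd (ae_eq_empty.1 h) hF0
    · exact ae_eq_univ.1 h
  have hωper : ∀ a k, ω (k + q * a) = ω k := fun a k => by
    have := Function.Periodic.nat_mul (f := ω) hper a k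
    simpa [mul_comm] using this
  have hwper : ∀ a k, w (k + N * a) = w k := fun a k => by
    have := Function.Periodic.nat_mul (f := w) hwN a k
    simpa [mul_comm] using this
  have hshort : ∀ m, ∃ i < q, ∀ k < m, w k = ω (k + i) := by
    intro m
    have : ∃ x, x ∈ prefixSet w m ∧ x ∈ F := by
      by_contra! h
      exact hw m (measure_mono_null (fun x hx => h x hx) hFull)
    obtain ⟨x, hx, i, hi⟩ := this
    refine ⟨i % q, Nat.mod_lt _ (Nat.pos_of_ne_zero hq), fun k hk => ?_⟩
    rw [← hx k hk, show x k = future x k from rfl, hi]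
    change ω (k + i) = _
    conv_lhs => rw [← Nat.mod_add_div i q, ← add_assoc, hωper]
  -- Every prefix of `w` occurs in `ω` at an offset below `q`. If each of the finitely many offsets
  -- failed somewhere, a prefix beyond all the failures would have none left.
  have hlong : ∃ i, ∀ k, w k = ω (k + i) := by
    by_contra! h
    choose k hk using h
    obtain ⟨i, hi, h⟩ := hshort ((Finset.range q).sup k + 1)
    exact hk i (h (k i) (Nat.lt_succ_of_le (Finset.le_sup (Finset.mem_range.2 hi))))
  obtain ⟨i₀, hi₀⟩ := hlong
  have horb : ∀ᵐ x ∂μ, ∃ i, future x = fun k => w (k + i) := by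
    filter_upwards [hFull] with x hx
    obtain ⟨i, hi⟩ := hx
    -- Adding the offset `i₀` of `w` inside `ω` turns the correction into a multiple of the period
    -- `q`.
    refine ⟨i + (q * i₀ - i₀), ?_⟩
    rw [hi]
    funext k
    have hq1 : i₀ ≤ q * i₀ := Nat.le_mul_of_pos_left _ (Nat.pos_of_ne_zero hq)
    rw [hi₀, show k + (i + (q * i₀ - i₀)) + i₀ = k + i + q * i₀ by omega, hωper]
  refine ⟨horb, fun h0 => ?_⟩
  have hnull : ∀ᵐ x ∂μ, ∀ m : ℕ, future (shift^[m] x) ≠ w :=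
    ae_all_iff.2 fun m => (hμ.toMeasurePreserving.iterate m).quasiMeasurePreserving.ae
      (p := fun x => future x ≠ w) (measure_eq_zero_iff_ae_notMem.1 h0)
  obtain ⟨x, ⟨i, hi⟩, hx⟩ := (horb.and hnull).exists
  refine hx (N * i - i) ?_
  rw [future_shift_iterate, hi]
  funext k
  have hN1 : i ≤ N * i := Nat.le_mul_of_pos_left _ hN
  change w (k + (N * i - i) + i) = w k
  rw [show k + (N * i - i) + i = k + N * i by omega, hwper]

end Atoms

namespace MarkovMap

variable {J : ℕ} {M : MarkovMap J} {c : I} {N : ℕ} {w : ℕ → Fin J} {μ : Measure (ℤ → Fin J)}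

/-! ### Nonadaptedness -/

lemma measurable_b (M : MarkovMap J) (c : I) : Measurable (M.b c) := by
  unfold b
  refine Measurable.ite ?_ ?_ measurable_const
  · exact (measurableSet_lt measurable_const measurable_subtype_coe).inter
      (measurableSet_lt measurable_subtype_coe measurable_const)
  · exact (Real.measurable_log.comp (measurable_subtype_coe.sub_const _)).abs

lemma b_nonneg (M : MarkovMap J) (c x : I) : 0 ≤ M.b c x := by
  unfold b; split_ifs <;> positivity

/-- The constant absorbs the points beyond `c + ℓ`, where `b` is cut off to 0. -/
lemma log_le_b (hc : M.IsRightPeriodic c N) {x : I} (hx : (c : ℝ) < x) :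
    -Real.log (x - c) ≤ M.b c x + max 0 (-Real.log (M.monoLength c)) := by
  have hl := hc.monoLength_pos
  have hd : 0 < (x : ℝ) - c := sub_pos.2 hx
  by_cases h : (x : ℝ) < c + M.monoLength c
  · rw [b, if_pos ⟨hx, h⟩]
    have := neg_le_abs (Real.log (x - c))
    have := le_max_left 0 (-Real.log (M.monoLength c))
    linarith
  · have h1 : Real.log (M.monoLength c) ≤ Real.log (x - c) := Real.log_le_log hl (by linarith)
    have := le_max_right 0 (-Real.log (M.monoLength c))
    have := M.b_nonneg c x
    linarith

lemma ae_mem_of_push_singleton (hμ : ∀ᵐ x ∂μ, x ∈ SFT M.adj) (h : M.push μ {c} = 0) :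
    ∀ᵐ x ∂μ, M.coding (future x) ≠ c := by
  rw [push_eq, Measure.map_apply_of_aemeasurable (aemeasurable_coding hμ)
    (measurableSet_singleton c)] at h
  exact measure_eq_zero_iff_ae_notMem.1 h

theorem not_isAdapted (hc : M.IsRightPeriodic c N) (hw : M.IsRightItinerary c w)
    [IsProbabilityMeasure μ] (hμ : ∀ᵐ x ∂μ, x ∈ SFT M.adj)
    (htop : ∑' K : ℕ, μ (prefixSet w ((K + 1) * N)) = ∞) : ¬ M.IsAdapted c (M.push μ) := by
  rintro ⟨h0, hint⟩
  obtain ⟨χ, hχ⟩ := M.exists_expansion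
  have hχ : M.IsExpansion χ := hχ
  have hlog : 0 < Real.log χ := Real.log_pos hχ.1
  have hχ0 : 0 < χ := by linarith [hχ.1]
  have hN : (0 : ℝ) < N := by exact_mod_cast hc.pos
  have hne := ae_mem_of_push_singleton hμ h0
  have hbm : Measurable fun x => ENNReal.ofReal (M.b c x) := (M.measurable_b c).ennreal_ofReal
  rw [push_eq, lintegral_map' hbm.aemeasurable (aemeasurable_coding hμ)] at hint
  set C : ℝ := max 0 (-Real.log (M.monoLength c)) with hC
  -- The sum of indicators is at most the number `R` of complete periods followed, and following `R
  -- * N` letters brings the point within χ^{-RN} of `c`. `R` is finite almost everywhere, since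
  -- otherwise the coded point is `c`, which has no mass in this case.
  have hpt : ∀ᵐ x ∂μ, ENNReal.ofReal (N * Real.log χ) *
      ∑' K : ℕ, (prefixSet w ((K + 1) * N)).indicator (1 : (ℤ → Fin J) → ℝ≥0∞) x ≤
      ENNReal.ofReal (M.b c (M.coding (future x))) + ENNReal.ofReal C := by
    filter_upwards [hμ, hne] with x hx hxc
    have hω := admissible_future hx
    have hex : ∃ K : ℕ, x ∉ prefixSet w ((K + 1) * N) := by
      by_contra! h
      refine hxc ?_
      have : future x = w := by
        funext i
        refine h i i ?_
        have := hc.pos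
        nlinarith
      rw [this, hw.coding_eq hc]
    classical
    set R := Nat.find hex with hR
    have hsum : ∑' K : ℕ, (prefixSet w ((K + 1) * N)).indicator (1 : (ℤ → Fin J) → ℝ≥0∞) x ≤ R := by
      rw [tsum_eq_sum (s := Finset.range R)]
      · exact (Finset.sum_le_sum (g := fun _ => (1 : ℝ≥0∞)) fun K _ =>
          Set.indicator_le_self' (by simp) x).trans (by simp)
      · intro K hK
        refine Set.indicator_of_notMem (fun hxK => Nat.find_spec hex fun i hi => ?_) _
        refine hxK i (hi.trans_le (Nat.mul_le_mul_right _ ?_))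
        have : R ≤ K := by simpa using hK
        omega
    refine (mul_le_mul_right hsum _).trans ?_
    rcases Nat.eq_zero_or_pos R with h | hRpos
    · simp [h]
    have hmem : x ∈ prefixSet w (R * N) := by
      have := Nat.find_min hex (m := R - 1) (by omega)
      rw [not_not, Nat.sub_add_cancel hRpos] at this
      exact this
    obtain ⟨h1, h2⟩ := hw.coding_near hc hχ hω (Nat.mul_pos hRpos hc.pos) fun i hi => hmem i hi
    have hlt : (c : ℝ) < M.coding (future x) := lt_of_le_of_ne h1 fun h => hxc (Subtype.ext h.symm)
    have hle := Real.log_le_log (sub_pos.2 hlt) h2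
    rw [Real.log_inv, Real.log_pow] at hle
    have hb := log_le_b hc hlt
    rw [← ENNReal.ofReal_add (M.b_nonneg _ _) (le_max_left _ _), ← ENNReal.ofReal_natCast,
      ← ENNReal.ofReal_mul (by positivity)]
    refine ENNReal.ofReal_le_ofReal ?_
    push_cast at hle
    linarith
  have hmeas : ∀ K, Measurable
      ((prefixSet w ((K + 1) * N)).indicator (1 : (ℤ → Fin J) → ℝ≥0∞)) := fun K =>
    measurable_one.indicator (measurableSet_prefixSet w _)
  have hI := lintegral_mono_ae hpt
  have hS : ∫⁻ x, ∑' K : ℕ, (prefixSet w ((K + 1) * N)).indicator (1 : (ℤ → Fin J) → ℝ≥0∞) x ∂μ =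
      ∞ := by
    rw [lintegral_tsum fun K => (hmeas K).aemeasurable, ← htop]
    exact tsum_congr fun K => lintegral_indicator_one (measurableSet_prefixSet w _)
  rw [lintegral_const_mul _ (Measurable.tsum hmeas), hS, lintegral_add_right _ measurable_const,
    lintegral_const, measure_univ, mul_one, ENNReal.mul_top (by
      simp only [ne_eq, ENNReal.ofReal_eq_zero, not_le]; positivity), top_le_iff] at hI
  exact ENNReal.add_ne_top.2 ⟨hint.ne, ENNReal.ofReal_ne_top⟩ hI

/-! ### Invariance and ergodicity of the push-forward -/

/-- The coding map is almost everywhere a semiconjugacy. -/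
lemma ae_semiconj (hc : M.IsRightPeriodic c N) (hw : M.IsRightItinerary c w)
    (hμ : ErgMeasure M.adj μ) (hpos : ∀ m, μ (prefixSet w m) ≠ 0)
    (hcase : (∀ i : ℕ, Tendsto (M.f^[i]) (𝓝[>] c) (𝓝 (M.f^[i] c))) ∨ M.push μ {c} = 0) :
    ∀ᵐ x ∂μ, M.f (M.coding (future x)) = M.coding (future (shift x)) := by
  have hprob := hμ.1.1
  have hshift : ∀ x : ℤ → Fin J, future (shift x) = fun k => future x (k + 1) := fun x =>
    future_shift_iterate x 1
  by_cases hD : ∀ᵐ x ∂μ, M.coding (future x) ∉ Set.range M.pt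
  · filter_upwards [hD, hμ.1.ae_mem] with x hx hxS
    rw [hshift, map_coding (admissible_future hxS) hx]
  -- A partition point together with a first symbol determines the admissible future. Without atoms,
  -- the finitely many such pairs would be null.
  have hatom : ∃ ω : ℕ → Fin J, μ {x | future x = ω} ≠ 0 := by
    by_contra! hno
    refine hD ?_
    have hpair : ∀ (i : Fin (J + 1)) (s : Fin J), ∀ᵐ x ∂μ,
        ¬ (x ∈ SFT M.adj ∧ M.coding (future x) = M.pt i ∧ future x 0 = s) := by
      intro i s
      by_cases hex : ∃ x, x ∈ SFT M.adj ∧ M.coding (future x) = M.pt i ∧ future x 0 = s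
      · obtain ⟨z, hz, hz', hz0⟩ := hex
        refine measure_mono_null (fun x hx => ?_) (hno (future z))
        obtain ⟨hx, hx', hx0⟩ := not_not.1 hx
        exact eq_of_coding_eq (admissible_future hx) (admissible_future hz) hx' hz'
          (hx0.trans hz0.symm) (M.pt_notMem_piece _ _)
      · push Not at hex
        exact Filter.Eventually.of_forall fun x hx => hex x hx.1 hx.2.1 hx.2.2
    have hall : ∀ᵐ x ∂μ, ∀ (i : Fin (J + 1)) (s : Fin J),
        ¬ (x ∈ SFT M.adj ∧ M.coding (future x) = M.pt i ∧ future x 0 = s) :=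
      ae_all_iff.2 fun i => ae_all_iff.2 fun s => hpair i s
    filter_upwards [hall, hμ.1.ae_mem] with x hx hxS
    rintro ⟨i, hi⟩
    exact hx i _ ⟨hxS, hi.symm, rfl⟩
  obtain ⟨ω, hω⟩ := hatom
  obtain ⟨horb, hpw⟩ := ae_orbit_of_atom hμ.2 hω hc.pos (hw.periodic hc) hpos
  -- On the orbit of `www…`, right continuity identifies the point coded by the i-th shift with the
  -- i-th iterate of `c`, even at partition points. Otherwise the positive mass of `www…` would be
  -- an atom at `c`.
  rcases hcase with hcont | h0
  · filter_upwards [horb] with x hx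
    obtain ⟨i, hi⟩ := hx
    rw [hshift, hi, hw.coding_eq_of_tendsto hc (hcont i), ← Function.iterate_succ_apply' M.f,
      ← hw.coding_eq_of_tendsto hc (hcont (i + 1))]
    congr 1
    funext k
    congr 1
    omega
  · exfalso
    refine hpw (measure_mono_null (fun x hx => ?_) (ae_mem_of_push_singleton hμ.1.ae_mem h0))
    refine not_not.2 ?_
    rw [show future x = w from hx, hw.coding_eq hc]

theorem push_mem_nonadaptedErg (hc : M.IsRightPeriodic c N) (hw : M.IsRightItinerary c w)
    (hμ : ErgMeasure M.adj μ) (hpos : ∀ m, μ (prefixSet w m) ≠ 0)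
    (hcase : (∀ i : ℕ, Tendsto (M.f^[i]) (𝓝[>] c) (𝓝 (M.f^[i] c))) ∨ M.push μ {c} = 0)
    (hnon : ¬ M.IsAdapted c (M.push μ)) : M.push μ ∈ M.nonadaptedErg c := by
  have hprob := hμ.1.1
  have hmeas := aemeasurable_coding hμ.1.ae_mem
  have hsemi := ae_semiconj hc hw hμ hpos hcase
  have hcomp : AEMeasurable (fun x => M.coding (future (shift x))) μ :=
    hmeas.comp_quasiMeasurePreserving hμ.2.quasiMeasurePreserving
  refine ⟨Measure.isProbabilityMeasure_map hmeas, ?_, hnon⟩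
  have hpres : MeasurePreserving M.f (M.push μ) (M.push μ) := by
    refine ⟨M.measurable_f, ?_⟩
    ext s hs
    rw [Measure.map_apply M.measurable_f hs, push_eq,
      Measure.map_apply_of_aemeasurable hmeas (M.measurable_f hs),
      Measure.map_apply_of_aemeasurable hmeas hs,
      ← hμ.2.measure_preimage (hmeas.nullMeasurable hs)]
    refine measure_congr ?_
    filter_upwards [hsemi] with x hx
    exact congrArg (· ∈ s) hx
  refine ergodic_of_measure_eq_zero hpres fun s hs hfs => ?_
  rw [push_eq, Measure.map_apply_of_aemeasurable hmeas hs,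
    Measure.map_apply_of_aemeasurable hmeas hs.compl]
  refine measure_zero_or_of_ergodic hμ.2 (hmeas.nullMeasurable hs) ?_
  filter_upwards [hsemi] with x hx
  change (M.coding (future (shift x)) ∈ s) = (M.coding (future x) ∈ s)
  rw [← hx]
  exact propext (Set.ext_iff.1 hfs _)

end MarkovMap

/-! ### Assembly of the proposition -/

lemma exists_period_mul {J : ℕ} {M : MarkovMap J} {c : I} {N : ℕ} {w : ℕ → Fin J}
    (hc : M.IsRightPeriodic c N) (hw : M.IsRightItinerary c w) {n : ℕ} [NeZero n]
    (hn : IsPeriod M.adj n) : N / n * n = N ∧ 0 < N / n := by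
  have hpath : HasPath M.adj N (w 0) (w 0) := by
    have := HasPath.of_seq (hw.admissible hc) N
    rwa [← zero_add N, hw.periodic hc, zero_add] at this
  have hdvd : n ∣ N := hn.1 _ _ hpath
  exact ⟨Nat.div_mul_cancel hdvd, Nat.div_pos (Nat.le_of_dvd hc.pos hdvd) (NeZero.pos n)⟩

end NonadaptedA

end

theorem proposition3p2 {J : ℕ} (M : MarkovMap J) (hM : IsTransitive M.adj)
    (c : I) (N : ℕ) (hc : M.IsRightPeriodic c N) (w : ℕ → Fin J) (hw : M.IsRightItinerary c w)
    (n : ℕ) [NeZero n] (hn : IsPeriod M.adj n) :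
    -- the construction can be carried out: connecting words of some fixed length exist
    (∃ (t : ℕ) (v v' : (Fin n → Fin J) → Fin t → Fin n → Fin J),
      IsConnector (blockAdj M.adj n (w 0)) {u | IsBlockSymbol M.adj n (w 0) u} (N / n)
        (blockWord n w) t v v') ∧
    ∀ (t : ℕ) (v v' : (Fin n → Fin J) → Fin t → Fin n → Fin J),
      IsConnector (blockAdj M.adj n (w 0)) {u | IsBlockSymbol M.adj n (w 0) u} (N / n)
        (blockWord n w) t v v' →
    ∀ ν : Measure (ℤ → Fin J), ErgMeasure M.adj ν →
    ∀ p : PMF ℕ, IsAdmissibleVector t (N / n) p →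
      Summable (fun k : ℕ => (k : ℝ) * (p k).toReal) →
    -- `μ_{ν,p}` is an invariant probability measure on the subshift, and it is ergodic as soon as
    -- the indices of the nonzero entries of `p` have greatest common divisor `1`
    InvMeasure M.adj (constructionA M.adj n w (N / n) t v v' ν p) ∧
    ((∀ d : ℕ, (∀ k, p k ≠ 0 → d ∣ k) → d = 1) →
      ErgMeasure M.adj (constructionA M.adj n w (N / n) t v v' ν p)) ∧
    (p = PMF.pure 1 → constructionA M.adj n w (N / n) t v v' ν p = ν) ∧
    dbar ν (constructionA M.adj n w (N / n) t v v' ν p)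
      ≤ ENNReal.ofReal ((mean p - 1) / mean p) ∧
    -- `p_k ≍ k⁻³` along the indices `k` at which `p` is allowed to be nonzero
    ((∃ r : ℝ, 1 ≤ r ∧ ∃ K : ℕ, ∀ k : ℕ, K ≤ k → (∃ j, 1 ≤ j ∧ k = 2 * t + j * (N / n) + 1) →
        r⁻¹ * ((k : ℝ) ^ 3)⁻¹ ≤ (p k).toReal ∧ (p k).toReal ≤ r * ((k : ℝ) ^ 3)⁻¹) →
      ¬ M.IsAdapted c (M.push (constructionA M.adj n w (N / n) t v v' ν p)) ∧
      ((∀ d : ℕ, (∀ k, p k ≠ 0 → d ∣ k) → d = 1) →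
        ((∀ i : ℕ, Tendsto (M.f^[i]) (𝓝[>] c) (𝓝 (M.f^[i] c))) ∨
          M.push (constructionA M.adj n w (N / n) t v v' ν p) {c} = 0) →
        M.push (constructionA M.adj n w (N / n) t v v' ν p) ∈ M.nonadaptedErg c)) := by
  obtain ⟨hLn, hL⟩ := exists_period_mul hc hw hn
  have hadm := hw.admissible hc
  have hper := hw.periodic hc
  refine ⟨exists_connector hM hn hadm hL, fun t v v' hv ν hν p hp hsum => ?_⟩
  have S : Setup M.adj n w (N / n) t v v' ν p :=
    ⟨hM, hn, hadm, fun i => by rw [hLn]; exact hper i, hL, hv, hν, hp, hsum⟩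
  refine ⟨S.invMeasure, S.ergMeasure, S.eq_of_pure, S.dbar_le, fun htail => ?_⟩
  have hprob := S.invMeasure.1
  have htop := S.tsum_prefixSet htail
  rw [hLn] at htop
  have hnon := MarkovMap.not_isAdapted hc hw S.invMeasure.ae_mem htop
  exact ⟨hnon, fun hgcd hcase => MarkovMap.push_mem_nonadaptedErg hc hw (S.ergMeasure hgcd)
    (S.prefixSet_pos htail) hcase hnon⟩
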